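/- Let $d\ge 1$ and $\alpha,\beta\in[-\tfrac12,\infty)^d$. For real $a,b>-1$ let $$\rho^{(a,b)}(x)=\frac{\Gamma(a+b+2)}{\Gamma(b+1)\Gamma(a+1)2^{a+b+1}}(1-x)^{a}(1+x)^{b}$$ be the Jacobi probability density on $(-1,1)$, let $\rho^{(\alpha,\beta)}(x)=\prod_{j=1}^d\rho^{(\alpha_j,\beta_j)}(x_j)$ on $(-1,1)^d$, and let $\rho_c=\prod_{j=1}^d \rho^{(-1/2,-1/2)}(x_j)$ be the Chebyshev density. For each $j$ let $\varphi^j_0,\varphi^j_1,\dots$ be the orthonormal polynomials of $\rho^{(\alpha_j,\beta_j)}$ ($\deg\varphi^j_m=m$, unique up to sign), and put $\psi_k(x)=\prod_j\varphi^j_{k_j}(x_j)$ for $k\in\Lambda=\{k\in\mathbb N_0^d:\ |k|\le n\}$, $M=|\Lambda|$, $n\ge 0$. For samples $z^{(1)},\dots,z^{(N)}\in(-1,1)^d$ let $\Phi=(\psi_k(z^{(i)}))_{i,k}\in\mathbb R^{N\times M}$, let $\tilde\Phi\in\mathbb R^{N(d+1)\times M}$ be $\Phi$ stacked on the matrices $(\partial_{x_m}\psi_k(z^{(i)}))_{i,k}$,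 $m=1,\dots,d$, and let $W=\mathrm{diag}(W^0,\dots,W^d)$ and $P$ be the diagonal matrices with $$W^0_{ii}=\sqrt{\frac{\rho^{(\alpha,\beta)}(z^{(i)})}{\rho_c(z^{(i)})}},\quad W^m_{ii}=\sqrt{\frac{\rho^{(\alpha+e_m,\beta+e_m)}(z^{(i)})}{\rho_c(z^{(i)})}},\quad P_{kk}=\Bigl(1+\sum_{m=1}^d c^2(k_m,\alpha_m,\beta_m)\Bigr)^{-1/2},$$ $$c^2(m,a,b)=m(m+a+b+1)\frac{(a+b+2)(a+b+3)}{4(a+1)(b+1)},$$ where $e_m$ is the $m$-th unit vector. Put $\widehat\Phi=W\tilde\Phi P$. Let $\mu_L$ be the largest squared entry of the preconditioned standard design matrix $W^0\Phi$, and let $\beta_L(\widehat\Phi)$ be the largest value, over all columns $k$ and all samples $z^{(i)}$, of the squared Euclidean norm of the vector of the $d+1$ entries of column $k$ of $\widehat\Phi$ that belong to $z^{(i)}$ (both are $0$ if $N=0$). Let $$C=\max_{1\le j\le d}\frac{2+\sqrt{(\alpha_j+1)^2+(\beta_j+1)^2}}{2+\sqrt{\alpha_j^2+\beta_j^2}}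 .$$ Then: 1. $1\le C\le 1+\frac{\sqrt2}{2}$; $C=1$ if $\alpha_k=\beta_k=-\frac12$ for all $k$, and $C=1+\frac{\sqrt2}2$ if $\alpha_k=\beta_k=0$ for some $k$. 2. For all samples $z^{(1)},\dots,z^{(N)}\in(-1,1)^d$, $$\mu_L\le\prod_{j=1}^d 2e\Bigl(2+\sqrt{\alpha_j^2+\beta_j^2}\Bigr),\qquad \beta_L(\widehat\Phi)\le C\prod_{j=1}^d 2e\Bigl(2+\sqrt{\alpha_j^2+\beta_j^2}\Bigr),$$ and, with $\mathcal N(\cdot)$ the nullspace, $P\,\mathcal N(\widehat\Phi)\subseteq\mathcal N(\Phi)$ (that is, $\mathcal N(\widehat\Phi P^{-1})\subseteq\mathcal N(\Phi)$). 3. If $z^{(1)},\dots,z^{(N)}$ are independent random vectors with density $\rho_c$, then almost surely all of them lie in $(-1,1)^d$, and if $1\le N<M$ (under-sampling), then almost surely $P\,\mathcal N(\widehat\Phi)\subsetneq\mathcal N(\Phi)$. -/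

import Mathlib

open MeasureTheory ProbabilityTheory

noncomputable section

namespace JacobiPCE

/-- The normalization constant
`d^{(α,β)} = Γ(α+β+2) / (Γ(β+1) Γ(α+1) 2^{α+β+1})`. -/
def normConst (α β : ℝ) : ℝ :=
  Real.Gamma (α + β + 2) /
    (Real.Gamma (β + 1) * Real.Gamma (α + 1) * (2 : ℝ) ^ (α + β + 1))

/-- The univariate Jacobi (Beta) probability density on `(-1,1)`. -/
def density (α β x : ℝ) : ℝ :=
  normConst α β * (1 - x) ^ α * (1 + x) ^ β

/-- The univariate Jacobi probability measure, carried by `(-1,1)`. -/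
def jacobiMeasure (α β : ℝ) : Measure ℝ :=
  (volume.restrict (Set.Ioo (-1 : ℝ) 1)).withDensity
    (fun x => ENNReal.ofReal (density α β x))

/-- The tensor-product Jacobi density `∏ⱼ ρ^{(αⱼ,βⱼ)}(xⱼ)`. -/
def densityPi {d : ℕ} (α β x : Fin d → ℝ) : ℝ :=
  ∏ j, density (α j) (β j) (x j)

/-- The tensor-product Chebyshev density `ρ_c = ρ^{(-1/2,-1/2)}`. -/
def chebDensity {d : ℕ} (x : Fin d → ℝ) : ℝ :=
  densityPi (fun _ => -1 / 2) (fun _ => -1 / 2) x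

/-- The tensor-product Chebyshev (arcsine) probability measure on the cube. -/
def chebMeasure (d : ℕ) : Measure (Fin d → ℝ) :=
  Measure.pi (fun _ => jacobiMeasure (-1 / 2) (-1 / 2))

/-- The open cube `(-1,1)^d`; `ρ_c` is infinite on its boundary, which is a Chebyshev-null set. -/
def cube (d : ℕ) : Set (Fin d → ℝ) := {x | ∀ j, x j ∈ Set.Ioo (-1 : ℝ) 1}

/-- `p 0, p 1, …` are the orthonormal polynomials of the Jacobi density `ρ^{(α,β)}`:
`p n` has degree `n`, and the family is orthonormal. This determines each `p n` up to its sign. -/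
structure IsJacobiBasis (α β : ℝ) (p : ℕ → Polynomial ℝ) : Prop where
  degree_eq : ∀ n, (p n).degree = n
  orthonormal : ∀ n m,
    ∫ x in (-1 : ℝ)..1, (p n).eval x * (p m).eval x * density α β x = if n = m then 1 else 0

section Existence

open Polynomial

theorem density_integrable {α β : ℝ} (hα : -1 < α) (hβ : -1 < β) :
    IntervalIntegrable (density α β) volume (-1) 1 := by
  have h := Complex.betaIntegral_convergent (u := (β + 1 : ℝ)) (v := (α + 1 : ℝ))
    (by simpa using by linarith) (by simpa using by linarith)
  have h1 : IntervalIntegrable (fun x : ℝ => x ^ β * (1 - x) ^ α) volume 0 1 := by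
    refine h.norm.congr_uIoo ?_
    intro x hx
    rw [Set.uIoo_of_le zero_le_one] at hx
    have e1 : (1 - (x : ℂ)) = ((1 - x : ℝ) : ℂ) := by push_cast; ring
    simp only [norm_mul]
    rw [e1, Complex.norm_cpow_eq_rpow_re_of_pos hx.1,
      Complex.norm_cpow_eq_rpow_re_of_pos (by linarith [hx.2])]
    simp
  have h2 := (h1.comp_mul_right (c := 1 / 2) |>.comp_add_right 1)
  norm_num at h2
  have h3 := h2.const_mul (normConst α β * 2 ^ α * 2 ^ β)
  refine h3.congr_uIoo ?_
  intro x hx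
  rw [Set.uIoo_of_le (by norm_num)] at hx
  have a1 : (0:ℝ) ≤ 1 - x := by linarith [hx.2]
  have a2 : (0:ℝ) ≤ 1 + x := by linarith [hx.1]
  have e1 : (x + 1) * (1 / 2) = (1 + x) / 2 := by ring
  have e2 : 1 - (1 + x) / 2 = (1 - x) / 2 := by ring
  simp only [density, e1, e2]
  rw [Real.div_rpow a2 (by norm_num), Real.div_rpow a1 (by norm_num)]
  have := Real.rpow_pos_of_pos (two_pos : (0:ℝ) < 2) α
  have := Real.rpow_pos_of_pos (two_pos : (0:ℝ) < 2) β
  field_simp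

theorem density_pos {α β : ℝ} (hα : -1 < α) (hβ : -1 < β) {x : ℝ}
    (hx : x ∈ Set.Ioo (-1 : ℝ) 1) : 0 < density α β x := by
  have h1 : 0 < 1 - x := by linarith [hx.2]
  have h2 : 0 < 1 + x := by linarith [hx.1]
  have := Real.Gamma_pos_of_pos (s := α + β + 2) (by linarith)
  have := Real.Gamma_pos_of_pos (s := β + 1) (by linarith)
  have := Real.Gamma_pos_of_pos (s := α + 1) (by linarith)
  unfold density normConst
  positivity

theorem density_nonneg {α β : ℝ} (hα : -1 < α) (hβ : -1 < β) {x : ℝ}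
    (hx : x ∈ Set.Icc (-1 : ℝ) 1) : 0 ≤ density α β x := by
  have h1 : 0 ≤ 1 - x := by linarith [hx.2]
  have h2 : 0 ≤ 1 + x := by linarith [hx.1]
  have := Real.Gamma_pos_of_pos (s := α + β + 2) (by linarith)
  have := Real.Gamma_pos_of_pos (s := β + 1) (by linarith)
  have := Real.Gamma_pos_of_pos (s := α + 1) (by linarith)
  unfold density normConst
  positivity

theorem poly_density_integrable {α β : ℝ} (hα : -1 < α) (hβ : -1 < β) (p : ℝ[X]) :
    IntervalIntegrable (fun x => p.eval x * density α β x) volume (-1) 1 :=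
  (density_integrable hα hβ).continuousOn_mul p.continuous.continuousOn

/-- The orthonormal Jacobi polynomials exist. -/
theorem exists_isJacobiBasis {α β : ℝ} (hα : -1 < α) (hβ : -1 < β) :
    ∃ p, IsJacobiBasis α β p := by
  have hint := fun p => poly_density_integrable hα hβ p
  let I : ℝ[X] → ℝ := fun p => ∫ x in (-1 : ℝ)..1, p.eval x * density α β x
  have hadd : ∀ p q, I (p + q) = I p + I q := by
    intro p q
    simp only [I, eval_add, add_mul]
    exact intervalIntegral.integral_add (hint p) (hint q)
  have hsmul : ∀ (c : ℝ) p, I (c • p) = c * I p := by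
    intro c p
    simp only [I, eval_smul, smul_eq_mul, mul_assoc]
    exact intervalIntegral.integral_const_mul _ _
  have hnn : ∀ p : ℝ[X], 0 ≤ I (p * p) := by
    intro p
    refine intervalIntegral.integral_nonneg (by norm_num) fun x hx => ?_
    have := density_nonneg hα hβ hx
    rw [eval_mul]
    exact mul_nonneg (mul_self_nonneg _) this
  have hdef : ∀ p : ℝ[X], I (p * p) = 0 → p = 0 := by
    intro p hp
    by_contra hne
    have key : 0 < I (p * p) := by
      refine (intervalIntegral.integral_pos_iff_support_of_nonneg_ae' ?_ (hint _)).2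
        ⟨by norm_num, ?_⟩
      · rw [Set.uIoc_of_le (by norm_num)]
        filter_upwards [ae_restrict_mem measurableSet_Ioc] with x hx
        have := density_nonneg hα hβ (Set.Ioc_subset_Icc_self hx)
        simp only [Pi.zero_apply, eval_mul]
        exact mul_nonneg (mul_self_nonneg _) this
      · have hsub : Set.Ioo (-1 : ℝ) 1 \ (p.roots.toFinset : Set ℝ) ⊆
            (Function.support fun x => (p * p).eval x * density α β x) ∩ Set.Ioc (-1) 1 := by
          rintro x ⟨hx, hr⟩
          refine ⟨?_, Set.Ioo_subset_Ioc_self hx⟩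
          have h1 : p.eval x ≠ 0 := by simpa [hne] using hr
          have h2 := (density_pos hα hβ hx).ne'
          simp [h1, h2]
        refine lt_of_lt_of_le ?_ (measure_mono hsub)
        rw [measure_sdiff_null (Finset.measure_zero _ _)]
        simp
    exact key.ne' hp
  let core : InnerProductSpace.Core ℝ ℝ[X] :=
    { inner := fun p q => I (p * q)
      conj_inner_symm := fun p q => by simp [mul_comm]
      re_inner_nonneg := fun p => by simpa using hnn p
      add_left := fun p q r => by simp [add_mul, hadd]
      smul_left := fun p q c => by simp [hsmul]
      definite := fun p hp => hdef p hp }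
  let : NormedAddCommGroup ℝ[X] := core.toNormedAddCommGroup
  let : InnerProductSpace ℝ ℝ[X] := InnerProductSpace.ofCore core.toCore
  have hli : LinearIndependent ℝ (fun n : ℕ => (X ^ n : ℝ[X])) := by
    have := (Polynomial.basisMonomials ℝ).linearIndependent
    simpa [Polynomial.coe_basisMonomials, Polynomial.monomial_one_right_eq_X_pow] using this
  have hon := InnerProductSpace.gramSchmidtNormed_orthonormal hli
  have hdeg : ∀ n : ℕ,
      (InnerProductSpace.gramSchmidt ℝ (fun n : ℕ => (X ^ n : ℝ[X])) n).degree = n := by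
    intro n
    induction n using Nat.strong_induction_on with
    | _ n ih =>
      rw [InnerProductSpace.gramSchmidt_def]
      rw [Polynomial.degree_sub_eq_left_of_degree_lt, Polynomial.degree_X_pow]
      rw [Polynomial.degree_X_pow]
      refine (Polynomial.degree_sum_le _ _).trans_lt ?_
      refine (Finset.sup_lt_iff (WithBot.bot_lt_coe n)).2 ?_
      intro i hi
      rw [Finset.mem_Iio] at hi
      rw [Submodule.starProjection_singleton]
      refine (Polynomial.degree_smul_le _ _).trans_lt ?_
      rw [ih i hi]
      exact WithBot.coe_lt_coe.2 hi
  refine ⟨InnerProductSpace.gramSchmidtNormed ℝ (fun n : ℕ => (X ^ n : ℝ[X])), ?_, ?_⟩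
  · intro n
    rw [← hdeg n]
    refine Polynomial.degree_smul_of_smul_regular _ ?_
    refine IsSMulRegular.of_ne_zero ?_
    simpa using InnerProductSpace.gramSchmidt_ne_zero n hli
  · intro n m
    have h := orthonormal_iff_ite.1 hon n m
    rw [← h]
    change _ = I (_ * _)
    simp only [I, eval_mul]

end Existence

/-- The tensor-product basis function `ψ_k(x) = ∏ⱼ φʲ_{kⱼ}(xⱼ)`. -/
def psi {d : ℕ} (φ : Fin d → ℕ → Polynomial ℝ) (k : Fin d → ℕ) (x : Fin d → ℝ) : ℝ :=
  ∏ j, (φ j (k j)).eval (x j)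

/-- The partial derivative `∂f/∂x_k` at `x`. -/
def partialDeriv {d : ℕ} (k : Fin d) (f : (Fin d → ℝ) → ℝ) (x : Fin d → ℝ) : ℝ :=
  deriv (fun t => f (Function.update x k t)) (x k)

/-- The total-degree multi-index set `{k ∈ ℕ₀^d : |k| ≤ n}`. -/
def totalDegree (d n : ℕ) : Finset (Fin d → ℕ) :=
  (Fintype.piFinset fun _ => Finset.range (n + 1)).filter fun k => ∑ j, k j ≤ n

theorem mem_totalDegree {d n : ℕ} (k : Fin d → ℕ) :
    k ∈ totalDegree d n ↔ ∑ j, k j ≤ n := by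
  simp only [totalDegree, Finset.mem_filter, Fintype.mem_piFinset, Finset.mem_range,
    and_iff_right_iff_imp]
  intro h j
  have := Finset.single_le_sum (f := k) (fun i _ => Nat.zero_le _) (Finset.mem_univ j)
  omega

/-- The standard design matrix `Φ_{i,k} = ψ_k(z⁽ⁱ⁾)`. -/
def Phi {d : ℕ} (φ : Fin d → ℕ → Polynomial ℝ) (n : ℕ) {N : ℕ} (z : Fin N → Fin d → ℝ) :
    Matrix (Fin N) (totalDegree d n) ℝ :=
  Matrix.of fun i k => psi φ k (z i)

/-- The stacked matrix of the partial derivatives of the basis functions at the samples. -/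
def PhiGrad {d : ℕ} (φ : Fin d → ℕ → Polynomial ℝ) (n : ℕ) {N : ℕ} (z : Fin N → Fin d → ℝ) :
    Matrix (Fin d × Fin N) (totalDegree d n) ℝ :=
  Matrix.of fun r k => partialDeriv r.1 (psi φ k) (z r.2)

/-- The diagonal of the block `W⁰`: `√(ρ^{(α,β)} / ρ_c)` at the samples. -/
def w0 {d : ℕ} (α β : Fin d → ℝ) {N : ℕ} (z : Fin N → Fin d → ℝ) (i : Fin N) : ℝ :=
  √(densityPi α β (z i) / chebDensity (z i))

/-- The diagonals of the blocks `W¹, …, W^d`: `√(ρ^{(α+e_k,β+e_k)} / ρ_c)` at the samples. -/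
def wGrad {d : ℕ} (α β : Fin d → ℝ) {N : ℕ} (z : Fin N → Fin d → ℝ) (r : Fin d × Fin N) : ℝ :=
  √(densityPi (α + Pi.single r.1 1) (β + Pi.single r.1 1) (z r.2) / chebDensity (z r.2))

/-- The preconditioning matrix `W = diag(W⁰, W¹, …, W^d)`. -/
def W {d : ℕ} (α β : Fin d → ℝ) {N : ℕ} (z : Fin N → Fin d → ℝ) :
    Matrix (Fin N ⊕ Fin d × Fin N) (Fin N ⊕ Fin d × Fin N) ℝ :=
  Matrix.diagonal (Sum.elim (w0 α β z) (wGrad α β z))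

/-- The constant `c²(m,α,β)`. -/
def cSq (m : ℕ) (α β : ℝ) : ℝ :=
  m * (m + α + β + 1) * ((α + β + 2) * (α + β + 3) / (4 * (α + 1) * (β + 1)))

/-- The normalizing matrix `P`, with entries `(1 + ∑_k c²(i_k,α_k,β_k))^{-1/2}`. -/
def P {d : ℕ} (α β : Fin d → ℝ) (n : ℕ) :
    Matrix (totalDegree d n) (totalDegree d n) ℝ :=
  Matrix.diagonal fun i => (√(1 + ∑ k, cSq (i.1 k) (α k) (β k)))⁻¹

/-- The standard design matrix preconditioned for Chebyshev sampling, `W⁰ Φ`. -/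
def PhiPre {d : ℕ} (α β : Fin d → ℝ) (φ : Fin d → ℕ → Polynomial ℝ) (n : ℕ) {N : ℕ}
    (z : Fin N → Fin d → ℝ) : Matrix (Fin N) (totalDegree d n) ℝ :=
  Matrix.diagonal (w0 α β z) * Phi φ n z

/-- The gradient-enhanced, preconditioned and normalized design matrix `Φ̂ = W Φ̃ P`, where
`Φ̃` is `Φ` stacked on top of the derivative block. -/
def PhiHat {d : ℕ} (α β : Fin d → ℝ) (φ : Fin d → ℕ → Polynomial ℝ) (n : ℕ) {N : ℕ}
    (z : Fin N → Fin d → ℝ) : Matrix (Fin N ⊕ Fin d × Fin N) (totalDegree d n) ℝ :=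
  W α β z * Matrix.fromRows (Phi φ n z) (PhiGrad φ n z) * P α β n

/-- The coherence parameter of a design matrix with one row for each sample: the largest
squared entry. -/
def muL {N : ℕ} {ι : Type*} (A : Matrix (Fin N) ι ℝ) : ℝ :=
  ⨆ q : ι × Fin N, A q.2 q.1 ^ 2

/-- The coherence parameter of a design matrix with `d + 1` rows for each sample: the largest
squared Euclidean norm of the part of a column that belongs to one sample. -/
def betaL {d N : ℕ} {ι : Type*} (A : Matrix (Fin N ⊕ Fin d × Fin N) ι ℝ) : ℝ :=
  ⨆ q : ι × Fin N, (A (Sum.inl q.2) q.1 ^ 2 + ∑ k : Fin d, A (Sum.inr (k, q.2)) q.1 ^ 2)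

/-- The nullspace of a matrix. -/
def nullspace {m ι : Type*} [Fintype ι] (A : Matrix m ι ℝ) : Submodule ℝ (ι → ℝ) :=
  LinearMap.ker A.mulVecLin

/-- The product `∏ⱼ 2e(2 + √(αⱼ² + βⱼ²))`. -/
def cohBound {d : ℕ} (α β : Fin d → ℝ) : ℝ :=
  ∏ j, 2 * Real.exp 1 * (2 + √(α j ^ 2 + β j ^ 2))

/-- The constant
`C = max_j (2 + √((αⱼ+1)² + (βⱼ+1)²)) / (2 + √(αⱼ² + βⱼ²))`. -/
def gradConst {d : ℕ} (α β : Fin d → ℝ) : ℝ :=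
  ⨆ j, (2 + √((α j + 1) ^ 2 + (β j + 1) ^ 2)) / (2 + √(α j ^ 2 + β j ^ 2))

end JacobiPCE

end

noncomputable section

namespace JacobiPCE

open Polynomial

/-! Everything in the coherence bounds reduces to one univariate estimate,
`IsJacobiBasis.chebRatio_mul_sq_le`: (ρ/ρ_c) p_n² ≤ 2e(2 + A) on [-1,1] with A = √(α² + β²),
uniformly in n. Tensor products of it bound the entries of W⁰Φ. By `IsJacobiBasis.raise`, p_m'
divided by √(c²(m)) is orthonormal for the raised parameters, so the same estimate bounds the
derivative rows; C absorbs the change of parameters in one coordinate, and P divides each column by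
exactly the sum of weights 1 + ∑ c² that the d + 1 rows collect.

The univariate estimate combines two arguments. First, a Hardy space argument on the disc
(`chebRatio_mul_sq_le` in the root of the namespace) gives a Nikolskii inequality, hence (ρ/ρ_c) K_n
≤ e(ν + 1/2) for the diagonal kernel K_n = ∑_{k≤n} p_k² and ν = n + (α+β+1)/2. If ν ≤ 7/2 + 2A,
bounding one term by the whole sum is enough.

For larger ν, put u(θ) = √(ρ/ρ_c) p_n at x = cos θ. Then u'' = -qu, and `IsJacobiBasis.energy_eq`
writes the kernel through u, u' and q. At an interior maximum of u² this reads (q + ν)u² = 2ν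
(ρ/ρ_c) K_n ≤ 2νe(ν + 1/2), so a value of u² above the claimed bound forces q(2 + A) < ν² there. By
reflection the maximum lies in [0, π/2]. If |α| ≤ 1/2 then q is at least 7ν²/8 and this is absurd.
If α > 1/2 then q' has a positive lower bound L up to the maximum; an energy comparison
(`cube_lower_bound`) gives q³ ≥ 4L²/9, while elementary estimates (`potential_slope_bound`) give q³
< 4L²/9. A maximum at θ = 0 forces α = -1/2 and is handled at nearby points.

The null space inclusion holds because W is invertible on the open cube. For strictness, fix all
samples but one. The remaining equations leave at least two independent expansions F, G, and G(x)F -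
F(x)G also vanishes at the free sample x. Its gradient there is the Wronskian G∇F - F∇G, a
polynomial vector that is not identically zero and so is nonzero for almost every x. The gradient
rows thus exclude a vector of the null space of Φ. -/

/-! ### Jacobi inner product and differential equation. -/

/-- Integration of polynomials against the Jacobi density, as a linear functional. -/
def jInt {α β : ℝ} (hα : -1 < α) (hβ : -1 < β) : ℝ[X] →ₗ[ℝ] ℝ where
  toFun p := ∫ x in (-1 : ℝ)..1, p.eval x * density α β x
  map_add' p q := by
    simp only [eval_add, add_mul]
    exact intervalIntegral.integral_add (poly_density_integrable hα hβ p)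
      (poly_density_integrable hα hβ q)
  map_smul' c p := by
    simp only [eval_smul, smul_eq_mul, mul_assoc, RingHom.id_apply]
    exact intervalIntegral.integral_const_mul _ _

theorem jInt_apply {α β : ℝ} (hα : -1 < α) (hβ : -1 < β) (p : ℝ[X]) :
    jInt hα hβ p = ∫ x in (-1 : ℝ)..1, p.eval x * density α β x := rfl

theorem jInt_C_mul {α β : ℝ} (hα : -1 < α) (hβ : -1 < β) (c : ℝ) (p : ℝ[X]) :
    jInt hα hβ (C c * p) = c * jInt hα hβ p := by
  rw [← smul_eq_C_mul, map_smul, smul_eq_mul]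

/-- Integration by parts: the total derivative of `(1 - x²) p ρ` integrates to zero. -/
theorem jInt_parts {α β : ℝ} (hα : -1 < α) (hβ : -1 < β) (p : ℝ[X]) :
    jInt hα hβ ((1 - X ^ 2) * derivative p + (C (β - α) - C (α + β + 2) * X) * p) = 0 := by
  rw [jInt_apply]
  have hcont : ContinuousOn
      (fun x : ℝ => normConst α β * p.eval x * ((1 - x) ^ (α + 1) * (1 + x) ^ (β + 1)))
      (Set.Icc (-1) 1) := by
    refine ((continuous_const.mul p.continuous).mul (Continuous.mul ?_ ?_)).continuousOn
    · exact (continuous_const.sub continuous_id).rpow_const fun x => Or.inr (by linarith)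
    · exact (continuous_const.add continuous_id).rpow_const fun x => Or.inr (by linarith)
  have := intervalIntegral.integral_eq_sub_of_hasDerivAt_of_le (a := (-1 : ℝ)) (b := 1)
    (by norm_num) hcont
    (f' := fun x => ((1 - X ^ 2) * derivative p + (C (β - α) - C (α + β + 2) * X) * p).eval x *
      density α β x) ?_ (poly_density_integrable hα hβ _)
  · rw [this]
    -- The exponents α + 1 and β + 1 are positive, so the antiderivative vanishes at both endpoints.
    have h1 : α + 1 ≠ 0 := by linarith
    have h2 : β + 1 ≠ 0 := by linarith
    simp [Real.zero_rpow h1, Real.zero_rpow h2]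
  · intro x hx
    have h1 : 0 < 1 - x := by linarith [hx.2]
    have h2 : 0 < 1 + x := by linarith [hx.1]
    have d1 : HasDerivAt (fun x : ℝ => (1 - x) ^ (α + 1)) (-1 * (α + 1) * (1 - x) ^ α) x := by
      simpa using ((hasDerivAt_id x).const_sub 1).rpow_const (p := α + 1) (Or.inl h1.ne')
    have d2 : HasDerivAt (fun x : ℝ => (1 + x) ^ (β + 1)) (1 * (β + 1) * (1 + x) ^ β) x := by
      simpa using ((hasDerivAt_id x).const_add 1).rpow_const (p := β + 1) (Or.inl h2.ne')
    refine (((p.hasDerivAt x).const_mul (normConst α β)).mul (d1.mul d2)).congr_deriv ?_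
    simp only [density, eval_add, eval_mul, eval_sub, eval_one, eval_pow, eval_X, eval_C]
    rw [Pi.mul_apply, Real.rpow_add_one h1.ne', Real.rpow_add_one h2.ne']
    ring

/-- The Jacobi differential operator `(1 - x²) q'' + (β - α - (α + β + 2) x) q'`. -/
def jOp (α β : ℝ) (q : ℝ[X]) : ℝ[X] :=
  (1 - X ^ 2) * derivative (derivative q) + (C (β - α) - C (α + β + 2) * X) * derivative q

/-- Integration by parts for q'r. The right side is symmetric in q and r, which makes the operator
self-adjoint. -/
theorem jInt_jOp_mul {α β : ℝ} (hα : -1 < α) (hβ : -1 < β) (q r : ℝ[X]) :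
    jInt hα hβ (jOp α β q * r) =
      -jInt hα hβ ((1 - X ^ 2) * (derivative q * derivative r)) := by
  have h := jInt_parts hα hβ (derivative q * r)
  rw [eq_neg_iff_add_eq_zero, ← map_add, ← h, jOp, derivative_mul]
  congr 1
  ring

theorem coeff_X_mul_derivative (q : ℝ[X]) (m : ℕ) :
    (X * derivative q).coeff m = m * q.coeff m := by
  rcases m with _ | m
  · simp
  · rw [coeff_X_mul, coeff_derivative]; push_cast; ring

theorem coeff_X_sq_mul_derivative_derivative (q : ℝ[X]) (m : ℕ) :
    (X ^ 2 * derivative (derivative q)).coeff m = m * (m - 1) * q.coeff m := by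
  have : X ^ 2 * derivative (derivative q) = X * derivative (X * derivative q) -
      X * derivative q := by
    rw [derivative_mul, derivative_X]; ring
  rw [this, coeff_sub, coeff_X_mul_derivative, coeff_X_mul_derivative]
  ring

theorem coeff_jOp (α β : ℝ) (q : ℝ[X]) (m : ℕ) :
    (jOp α β q).coeff m = (m + 2) * (m + 1) * q.coeff (m + 2) +
      (β - α) * (m + 1) * q.coeff (m + 1) - m * (m + α + β + 1) * q.coeff m := by
  have : jOp α β q = derivative (derivative q) - X ^ 2 * derivative (derivative q) +
      C (β - α) * derivative q - C (α + β + 2) * (X * derivative q) := by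
    rw [jOp]; ring
  rw [this, coeff_sub, coeff_add, coeff_sub, coeff_C_mul, coeff_C_mul, coeff_X_mul_derivative,
    coeff_X_sq_mul_derivative_derivative, coeff_derivative, coeff_derivative,
    coeff_derivative]
  push_cast
  ring

theorem degree_jOp_lt (α β : ℝ) {q : ℝ[X]} {n : ℕ} (hq : q.degree < n) :
    (jOp α β q).degree < n := by
  rw [degree_lt_iff_coeff_zero] at hq ⊢
  intro m hm
  rw [coeff_jOp, hq m hm, hq (m + 1) (by omega), hq (m + 2) (by omega)]
  ring

namespace IsJacobiBasis

variable {α β : ℝ} {p : ℕ → ℝ[X]}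

theorem jInt_mul (h : IsJacobiBasis α β p) (hα : -1 < α) (hβ : -1 < β) (n m : ℕ) :
    jInt hα hβ (p n * p m) = if n = m then 1 else 0 := by
  rw [jInt_apply, ← h.orthonormal n m]
  simp only [eval_mul]

/-- Since p_n has exact degree n, a multiple of it removes the coefficient of X^n and the induction
continues in lower degree. -/
theorem exists_eq_sum (h : IsJacobiBasis α β p) (n : ℕ) :
    ∀ q : ℝ[X], q.degree < n → ∃ c : ℕ → ℝ, q = ∑ k ∈ Finset.range n, C (c k) * p k := by
  induction n with
  | zero =>
    intro q hq
    exact ⟨0, by simpa using hq⟩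
  | succ n ih =>
    intro q hq
    have hne : (p n).coeff n ≠ 0 := by
      have := h.degree_eq n
      exact coeff_ne_zero_of_eq_degree this
    obtain ⟨c, hc⟩ := ih (q - C (q.coeff n / (p n).coeff n) * p n) (by
      rw [degree_lt_iff_coeff_zero] at hq ⊢
      intro m hm
      rw [coeff_sub, coeff_C_mul]
      rcases hm.eq_or_lt with rfl | hm'
      · rw [div_mul_cancel₀ _ hne, sub_self]
      · rw [hq m hm', coeff_eq_zero_of_degree_lt (p := p n) (n := m)]
        · ring
        · rw [h.degree_eq]; exact_mod_cast hm')
    refine ⟨Function.update c n (q.coeff n / (p n).coeff n), ?_⟩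
    rw [Finset.sum_range_succ, Function.update_self]
    rw [Finset.sum_congr rfl (g := fun k => C (c k) * p k), ← hc]
    · ring
    · intro k hk
      rw [Function.update_of_ne (Finset.mem_range.1 hk).ne]

theorem eq_sum (h : IsJacobiBasis α β p) (hα : -1 < α) (hβ : -1 < β) {n : ℕ} {q : ℝ[X]}
    (hq : q.degree < n) : q = ∑ k ∈ Finset.range n, C (jInt hα hβ (q * p k)) * p k := by
  obtain ⟨c, hc⟩ := h.exists_eq_sum n q hq
  have : ∀ k ∈ Finset.range n, jInt hα hβ (q * p k) = c k := by
    intro k hk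
    rw [hc, Finset.sum_mul, map_sum, Finset.sum_eq_single k]
    · rw [mul_assoc, jInt_C_mul, h.jInt_mul]; simp
    · intro j _ hj
      rw [mul_assoc, jInt_C_mul, h.jInt_mul, if_neg hj, mul_zero]
    · exact fun hk' => absurd hk hk'
  conv_lhs => rw [hc]
  exact Finset.sum_congr rfl fun k hk => by rw [this k hk]

theorem jInt_mul_eq_zero (h : IsJacobiBasis α β p) (hα : -1 < α) (hβ : -1 < β) {n : ℕ}
    {q : ℝ[X]} (hq : q.degree < n) : jInt hα hβ (q * p n) = 0 := by
  obtain ⟨c, hc⟩ := h.exists_eq_sum n q hq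
  rw [hc, Finset.sum_mul, map_sum]
  refine Finset.sum_eq_zero fun k hk => ?_
  rw [mul_assoc, jInt_C_mul, h.jInt_mul, if_neg (Finset.mem_range.1 hk).ne, mul_zero]

/-- The Jacobi differential equation. -/
theorem jOp_eq (h : IsJacobiBasis α β p) (hα : -1 < α) (hβ : -1 < β) (n : ℕ) :
    jOp α β (p n) = -C (n * (n + α + β + 1)) * p n := by
  have hlt : (p n).degree < (n + 1 : ℕ) := by
    rw [h.degree_eq]; exact_mod_cast Nat.lt_succ_self n
  have hs := h.eq_sum hα hβ (degree_jOp_lt α β hlt)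
  rw [Finset.sum_range_succ, Finset.sum_eq_zero, zero_add] at hs
  -- Only the top term of the expansion survives; comparing coefficients of X^n identifies the
  -- eigenvalue.
  · have hc := congrArg (fun q => q.coeff n) hs
    simp only [coeff_C_mul] at hc
    rw [coeff_jOp, coeff_eq_zero_of_degree_lt (n := n + 1) hlt,
      coeff_eq_zero_of_degree_lt (n := n + 2) (hlt.trans (by exact_mod_cast Nat.lt_succ_self _)),
      mul_zero, mul_zero, zero_add, zero_sub, ← neg_mul] at hc
    have := mul_right_cancel₀ (coeff_ne_zero_of_eq_degree (h.degree_eq n)) hc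
    rw [hs, ← this, C_neg]
  -- Self-adjointness moves the operator onto p_k, whose image still has degree below n and is
  -- orthogonal to p_n.
  · intro k hk
    have hk := Finset.mem_range.1 hk
    have hkn : (jOp α β (p k)).degree < n :=
      degree_jOp_lt α β (by rw [h.degree_eq]; exact_mod_cast hk)
    have := h.jInt_mul_eq_zero hα hβ hkn
    rw [jInt_jOp_mul] at this
    rw [jInt_jOp_mul, mul_comm (derivative (p n)), this, C_0, zero_mul]

/-- Self-adjointness and the eigenvalue equation make the derivatives orthogonal for the weight (1 -
x²)ρ, with the eigenvalue as squared norm. -/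
theorem jInt_deriv_mul_deriv (h : IsJacobiBasis α β p) (hα : -1 < α) (hβ : -1 < β) (n m : ℕ) :
    jInt hα hβ ((1 - X ^ 2) * (derivative (p n) * derivative (p m))) =
      n * (n + α + β + 1) * if n = m then 1 else 0 := by
  have := jInt_jOp_mul hα hβ (p n) (p m)
  rw [h.jOp_eq hα hβ, ← C_neg, mul_assoc, jInt_C_mul, h.jInt_mul] at this
  linarith

end IsJacobiBasis

/-! ### Raising both parameters by one. -/

theorem normConst_add_one {α β : ℝ} (hα : -1 < α) (hβ : -1 < β) :
    normConst (α + 1) (β + 1) =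
      (α + β + 2) * (α + β + 3) / (4 * (α + 1) * (β + 1)) * normConst α β := by
  have e1 : Real.Gamma (α + 1 + (β + 1) + 2) =
      (α + β + 3) * ((α + β + 2) * Real.Gamma (α + β + 2)) := by
    rw [show α + 1 + (β + 1) + 2 = (α + β + 3) + 1 by ring, Real.Gamma_add_one (by linarith),
      show α + β + 3 = (α + β + 2) + 1 by ring, Real.Gamma_add_one (by linarith)]
  have e2 : (2 : ℝ) ^ (α + 1 + (β + 1) + 1) = 4 * 2 ^ (α + β + 1) := by
    rw [show α + 1 + (β + 1) + 1 = (α + β + 1) + 2 by ring, Real.rpow_add two_pos]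
    norm_num; ring
  have h1 : α + 1 ≠ 0 := by linarith
  have h2 : β + 1 ≠ 0 := by linarith
  have := (Real.Gamma_pos_of_pos (s := α + 1) (by linarith)).ne'
  have := (Real.Gamma_pos_of_pos (s := β + 1) (by linarith)).ne'
  have := (Real.rpow_pos_of_pos (two_pos : (0:ℝ) < 2) (α + β + 1)).ne'
  rw [normConst, normConst, e1, e2, Real.Gamma_add_one h1, Real.Gamma_add_one h2]
  field_simp

/-- The quotient of normalizing constants is the rational factor in `cSq`; thus c² is the eigenvalue
times the cost of renormalizing (1 - x²)ρ. -/
theorem density_add_one {α β : ℝ} (hα : -1 < α) (hβ : -1 < β) {x : ℝ}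
    (hx : x ∈ Set.Ioo (-1 : ℝ) 1) :
    density (α + 1) (β + 1) x =
      (α + β + 2) * (α + β + 3) / (4 * (α + 1) * (β + 1)) * ((1 - x ^ 2) * density α β x) := by
  have h1 : 0 < 1 - x := by linarith [hx.2]
  have h2 : 0 < 1 + x := by linarith [hx.1]
  rw [density, density, normConst_add_one hα hβ, Real.rpow_add_one h1.ne',
    Real.rpow_add_one h2.ne']
  ring

theorem cSq_pos {α β : ℝ} (hα : -1 / 2 ≤ α) (hβ : -1 / 2 ≤ β) (m : ℕ) :
    0 < cSq (m + 1) α β := by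
  have h1 : 0 < α + 1 := by linarith
  have h2 : 0 < β + 1 := by linarith
  have h3 : 0 < α + β + 2 := by linarith
  have h4 : 0 < α + β + 3 := by linarith
  have h5 : (0:ℝ) < (m + 1 : ℕ) + α + β + 1 := by
    have : (0:ℝ) ≤ m := m.cast_nonneg
    push_cast; linarith
  unfold cSq
  have : (0:ℝ) < ((m + 1 : ℕ) : ℝ) := by positivity
  positivity

/-- The normalized derivatives of the Jacobi polynomials are the Jacobi polynomials with both
parameters raised by one. -/
theorem IsJacobiBasis.raise {α β : ℝ} {p : ℕ → ℝ[X]} (h : IsJacobiBasis α β p)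
    (hα : -1 / 2 ≤ α) (hβ : -1 / 2 ≤ β) :
    IsJacobiBasis (α + 1) (β + 1)
      (fun m => C (√(cSq (m + 1) α β))⁻¹ * derivative (p (m + 1))) := by
  have hα' : -1 < α := by linarith
  have hβ' : -1 < β := by linarith
  have hs : ∀ m, √(cSq (m + 1) α β) ≠ 0 := fun m => (Real.sqrt_pos.2 (cSq_pos hα hβ m)).ne'
  refine ⟨fun n => ?_, fun n m => ?_⟩
  · rw [degree_C_mul (inv_ne_zero (hs n)), degree_derivative]
    · rw [natDegree_eq_of_degree_eq_some (h.degree_eq (n + 1))]; simp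
    · rw [natDegree_eq_of_degree_eq_some (h.degree_eq (n + 1))]; exact n.succ_ne_zero
  · have key := h.jInt_deriv_mul_deriv hα' hβ' (n + 1) (m + 1)
    have e : ∫ x in (-1 : ℝ)..1,
        (C (√(cSq (n + 1) α β))⁻¹ * Polynomial.derivative (p (n + 1))).eval x *
        (C (√(cSq (m + 1) α β))⁻¹ * Polynomial.derivative (p (m + 1))).eval x *
          density (α + 1) (β + 1) x =
        (√(cSq (n + 1) α β))⁻¹ * (√(cSq (m + 1) α β))⁻¹ *
          ((α + β + 2) * (α + β + 3) / (4 * (α + 1) * (β + 1))) *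
        jInt hα' hβ' ((1 - X ^ 2) *
          (Polynomial.derivative (p (n + 1)) * Polynomial.derivative (p (m + 1)))) := by
      rw [jInt_apply, ← intervalIntegral.integral_const_mul]
      refine intervalIntegral.integral_congr_uIoo fun x hx => ?_
      rw [Set.uIoo_of_le (by norm_num)] at hx
      simp only [eval_mul, eval_C, eval_sub, eval_one, eval_pow, eval_X,
        density_add_one hα' hβ' hx]
      ring
    rw [e, key]
    by_cases hnm : n = m
    · subst hnm
      have h1 := Real.mul_self_sqrt (cSq_pos hα hβ n).le
      have h2 : ((n + 1 : ℕ) : ℝ) * ((n + 1 : ℕ) + α + β + 1) *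
          ((α + β + 2) * (α + β + 3) / (4 * (α + 1) * (β + 1))) = cSq (n + 1) α β := rfl
      simp only [if_true, mul_one]
      rw [mul_assoc, mul_comm _ (((n + 1 : ℕ) : ℝ) * _), h2, ← mul_inv, h1,
        inv_mul_cancel₀ (cSq_pos hα hβ n).ne']
    · simp [hnm]

/-! ### Recurrence, Christoffel–Darboux and the kernel as a quadratic form. -/

/-- The terms of degree k + 1 in -X²q' and kXq cancel, so multiplication by quadratic and linear
factors does not raise the degree. -/
theorem degree_structure_lt {q : ℝ[X]} {k : ℕ} (hq : q.degree < ((k + 1 : ℕ) : WithBot ℕ)) :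
    ((1 - X ^ 2) * derivative q + C (k : ℝ) * X * q).degree < ((k + 1 : ℕ) : WithBot ℕ) := by
  rw [degree_lt_iff_coeff_zero] at hq ⊢
  intro m hm
  obtain ⟨m, rfl⟩ : ∃ l, m = l + 1 := ⟨m - 1, by omega⟩
  have : (1 - X ^ 2) * derivative q + C (k : ℝ) * X * q =
      derivative q - X * (X * derivative q) + C (k : ℝ) * (X * q) := by ring
  rw [this, coeff_add, coeff_sub, coeff_C_mul, coeff_X_mul, coeff_X_mul, coeff_derivative,
    coeff_X_mul_derivative, hq (m + 1 + 1) (by omega)]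
  rcases (show k ≤ m by omega).eq_or_lt with rfl | h
  · ring
  · rw [hq m h]; ring

namespace IsJacobiBasis

variable {α β : ℝ} {p : ℕ → ℝ[X]}

theorem degree_lt (h : IsJacobiBasis α β p) {n m : ℕ} (hnm : n < m) :
    (p n).degree < (m : WithBot ℕ) := by
  rw [h.degree_eq]; exact_mod_cast hnm

theorem degree_X_mul_lt (h : IsJacobiBasis α β p) {n m : ℕ} (hnm : n + 1 < m) :
    (X * p n).degree < (m : WithBot ℕ) := by
  rw [X_mul, degree_mul_X, h.degree_eq]; exact_mod_cast hnm

theorem X_mul_zero (h : IsJacobiBasis α β p) (hα : -1 < α) (hβ : -1 < β) :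
    X * p 0 = C (jInt hα hβ (X * p 0 * p 0)) * p 0 + C (jInt hα hβ (X * p 0 * p 1)) * p 1 := by
  have := h.eq_sum hα hβ (h.degree_X_mul_lt (n := 0) (m := 2) (by norm_num))
  rw [Finset.sum_range_succ, Finset.sum_range_one] at this
  exact this

/-- The three-term recurrence. -/
theorem X_mul_succ (h : IsJacobiBasis α β p) (hα : -1 < α) (hβ : -1 < β) (n : ℕ) :
    X * p (n + 1) = C (jInt hα hβ (X * p n * p (n + 1))) * p n +
      C (jInt hα hβ (X * p (n + 1) * p (n + 1))) * p (n + 1) +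
      C (jInt hα hβ (X * p (n + 1) * p (n + 2))) * p (n + 2) := by
  have := h.eq_sum hα hβ (h.degree_X_mul_lt (n := n + 1) (m := n + 3) (by omega))
  rw [Finset.sum_range_succ, Finset.sum_range_succ, Finset.sum_range_succ,
    Finset.sum_eq_zero, zero_add] at this
  · rw [show X * p (n + 1) * p n = X * p n * p (n + 1) by ring] at this
    exact this
  · intro k hk
    have hk := Finset.mem_range.1 hk
    rw [show X * p (n + 1) * p k = X * p k * p (n + 1) by ring,
      h.jInt_mul_eq_zero hα hβ (h.degree_X_mul_lt (by omega)), C_0, zero_mul]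

/-- The confluent Christoffel–Darboux formula. -/
theorem christoffel_darboux (h : IsJacobiBasis α β p) (hα : -1 < α) (hβ : -1 < β) (n : ℕ) :
    C (jInt hα hβ (X * p n * p (n + 1))) *
      (Polynomial.derivative (p (n + 1)) * p n - Polynomial.derivative (p n) * p (n + 1)) =
      ∑ k ∈ Finset.range (n + 1), p k ^ 2 := by
  induction n with
  | zero =>
    have h0 := h.X_mul_zero hα hβ
    have h1 := congrArg Polynomial.derivative h0
    simp only [derivative_add, derivative_mul, derivative_X, derivative_C, zero_mul, zero_add,
      one_mul] at h1
    rw [zero_add, Finset.sum_range_one]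
    linear_combination Polynomial.derivative (p 0) * h0 - p 0 * h1
  | succ n ih =>
    have h0 := h.X_mul_succ hα hβ n
    have h1 := congrArg Polynomial.derivative h0
    simp only [derivative_add, derivative_mul, derivative_X, derivative_C, zero_mul, zero_add,
      one_mul] at h1
    rw [Finset.sum_range_succ, ← ih]
    -- Multiply the recurrence by the derivative and the differentiated recurrence by the
    -- polynomial. In the difference the diagonal term cancels, leaving the square and the two
    -- neighbouring Wronskians.
    linear_combination Polynomial.derivative (p (n + 1)) * h0 - p (n + 1) * h1

/-- The structure relation expressing `pₙ` through `pₙ₊₁` and its derivative. -/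
theorem structure_relation (h : IsJacobiBasis α β p) (hα : -1 < α) (hβ : -1 < β) (n : ℕ) :
    ∃ b : ℝ, (1 - X ^ 2) * Polynomial.derivative (p (n + 1)) + C ((n + 1 : ℕ) : ℝ) * X * p (n + 1) =
      C ((2 * n + α + β + 3) * jInt hα hβ (X * p n * p (n + 1))) * p n + C b * p (n + 1) := by
  have hs := h.eq_sum hα hβ (degree_structure_lt (h.degree_lt (Nat.lt_succ_self (n + 1))))
  set Y := (1 - X ^ 2) * Polynomial.derivative (p (n + 1)) + C ((n + 1 : ℕ) : ℝ) * X * p (n + 1)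
    with hY
  -- Integrate the total derivative of (1 - x²) p_{n+1} p_k ρ. The part containing p_k' is completed
  -- to a polynomial of degree at most k, which is orthogonal to p_{n+1}.
  have key : ∀ k, k ≤ n → jInt hα hβ (Y * p k) =
      (n + 1 + k + α + β + 2) * jInt hα hβ (X * p k * p (n + 1)) := by
    intro k hk
    have h1 := jInt_parts hα hβ (p (n + 1) * p k)
    have h2 := h.jInt_mul_eq_zero hα hβ (n := n + 1)
      ((degree_structure_lt (h.degree_lt (Nat.lt_succ_self k))).trans_le
        (by exact_mod_cast Nat.succ_le_succ hk))
    have h3 := h.jInt_mul hα hβ k (n + 1)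
    rw [if_neg (by omega)] at h3
    have e : (1 - X ^ 2) * Polynomial.derivative (p (n + 1) * p k) +
        (C (β - α) - C (α + β + 2) * X) * (p (n + 1) * p k) =
        Y * p k + ((1 - X ^ 2) * Polynomial.derivative (p k) + C (k : ℝ) * X * p k) * p (n + 1) +
        C (β - α) * (p k * p (n + 1)) -
        C (n + 1 + k + α + β + 2) * (X * p k * p (n + 1)) := by
      rw [hY, derivative_mul]
      simp only [C_add, Nat.cast_add, Nat.cast_one]
      ring
    rw [e, map_sub, map_add, map_add, jInt_C_mul, jInt_C_mul, h2, h3] at h1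
    linarith
  refine ⟨jInt hα hβ (Y * p (n + 1)), ?_⟩
  rw [Finset.sum_range_succ, Finset.sum_range_succ, Finset.sum_eq_zero, zero_add,
    key n le_rfl] at hs
  · refine hs.trans ?_
    rw [show (n + 1 + n + α + β + 2 : ℝ) = 2 * n + α + β + 3 by ring]
  · intro k hk
    have hk := Finset.mem_range.1 hk
    rw [key k hk.le, h.jInt_mul_eq_zero hα hβ (h.degree_X_mul_lt (by omega)), mul_zero, C_0,
      zero_mul]

/-- The diagonal reproducing kernel as a quadratic form in `pₙ₊₁` and its derivative. -/
theorem kernel_eq (h : IsJacobiBasis α β p) (hα : -1 < α) (hβ : -1 < β) (n : ℕ) :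
    C (2 * n + α + β + 3) * ∑ k ∈ Finset.range (n + 1), p k ^ 2 =
      (1 - X ^ 2) * Polynomial.derivative (p (n + 1)) ^ 2 +
      (C (β - α) - C (α + β) * X) * (p (n + 1) * Polynomial.derivative (p (n + 1))) +
      C ((n + 1) * (n + 1 + α + β)) * p (n + 1) ^ 2 := by
  obtain ⟨b, hb⟩ := h.structure_relation hα hβ n
  have hode := h.jOp_eq hα hβ (n + 1)
  have hd := congrArg Polynomial.derivative hb
  rw [← h.christoffel_darboux hα hβ n]
  rw [jOp] at hode
  simp only [derivative_add, derivative_mul, derivative_X, derivative_C, zero_mul, zero_add,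
    mul_one, derivative_sub, derivative_one, derivative_pow] at hd
  simp only [C_add, C_mul, C_sub, C_1, Nat.cast_add, Nat.cast_one, map_ofNat] at hode hd hb ⊢
  have h2 : (C ((2 : ℕ) : ℝ) : ℝ[X]) = 2 := map_ofNat C 2
  rw [h2] at hd
  -- The structure relation and its derivative eliminate p_n and p_n' from Christoffel–Darboux. The
  -- unknown b cancels and the differential equation removes the second derivative.
  linear_combination Polynomial.derivative (p (n + 1)) * (-hb) + p (n + 1) * hd - p (n + 1) * hode

end IsJacobiBasis

/-! ### Zero-free polynomials on the disc and a Nikolskii-type inequality -/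

/-- After squaring, the difference of the two sides is increasing in the real inner product of ζ and
b, so the worst case is -|b|. There it factors with (1 - r)(|b| - 1) ≥ 0. Moving inward thus loses
at most a fixed factor per zero outside the open disc. -/
theorem norm_sub_le_dilate {ζ b : ℂ} {r : ℝ} (hζ : ‖ζ‖ = 1) (hb : 1 ≤ ‖b‖) (hr0 : 0 ≤ r)
    (hr1 : r ≤ 1) : ‖ζ - b‖ ≤ 2 / (1 + r) * ‖r * ζ - b‖ := by
  have hr : 0 < 1 + r := by linarith
  rw [div_mul_eq_mul_div, le_div_iff₀ hr]
  refine abs_le_of_sq_le_sq' ?_ (by positivity) |>.2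
  have e1 := Complex.sq_norm (ζ - b)
  have e2 := Complex.sq_norm (r * ζ - b)
  have e3 := Complex.sq_norm ζ
  have e4 := Complex.sq_norm b
  rw [Complex.normSq_apply] at e1 e2 e3 e4
  simp only [Complex.sub_re, Complex.sub_im, Complex.re_ofReal_mul, Complex.im_ofReal_mul]
    at e1 e2
  rw [hζ] at e3
  set t := ‖b‖
  have hc : -t ≤ ζ.re * b.re + ζ.im * b.im := by
    have : (ζ.re * b.re + ζ.im * b.im) ^ 2 ≤ t ^ 2 := by
      nlinarith [sq_nonneg (ζ.re * b.im - ζ.im * b.re)]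
    exact (abs_le_of_sq_le_sq' this (by positivity)).1
  have hkey : 0 ≤ (1 - r) * (t - 1) * (2 * (r + t) + (1 + r) * (1 + t)) := by
    have : 0 ≤ 1 - r := by linarith
    have : 0 ≤ t - 1 := by linarith
    positivity
  have h1 : 0 ≤ (1 - r) ^ 2 * (ζ.re * b.re + ζ.im * b.im + t) :=
    mul_nonneg (sq_nonneg _) (by linarith)
  rw [mul_pow, mul_pow, e1, e2]
  have e3' : ζ.im * ζ.im = 1 - ζ.re * ζ.re := by linarith
  have e4' : b.im * b.im = t ^ 2 - b.re * b.re := by linarith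
  have f1 : (ζ.re - b.re) * (ζ.re - b.re) + (ζ.im - b.im) * (ζ.im - b.im) =
      1 - 2 * (ζ.re * b.re + ζ.im * b.im) + t ^ 2 := by linear_combination e3' + e4'
  have f2 : (r * ζ.re - b.re) * (r * ζ.re - b.re) + (r * ζ.im - b.im) * (r * ζ.im - b.im) =
      r ^ 2 - 2 * r * (ζ.re * b.re + ζ.im * b.im) + t ^ 2 := by
    linear_combination r ^ 2 * e3' + e4'
  rw [f1, f2]
  linarith

/-- The two roots of the quadratic have product 1, so one of them lies outside the open disc. -/
theorem exists_joukowski (a : ℂ) : ∃ b : ℂ, 1 ≤ ‖b‖ ∧ b ^ 2 + 1 = 2 * a * b := by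
  obtain ⟨s, hs⟩ := IsAlgClosed.exists_pow_nat_eq (a ^ 2 - 1) two_pos
  have h : ‖a + s‖ * ‖a - s‖ = 1 := by
    rw [← norm_mul, show (a + s) * (a - s) = 1 by linear_combination -hs, norm_one]
  rcases le_total 1 ‖a + s‖ with h1 | h1
  · exact ⟨a + s, h1, by linear_combination hs⟩
  · refine ⟨a - s, ?_, by linear_combination hs⟩
    nlinarith [norm_nonneg (a - s), norm_nonneg (a + s)]

/-- On the unit circle |z - b̄| = |zb - 1|, and (z - b)(zb - 1) is z · 2b(Re z - a) by the equation
for b. -/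
theorem norm_re_sub_eq {z a b : ℂ} (hz : ‖z‖ = 1) (hb : b ^ 2 + 1 = 2 * a * b) :
    ‖z - b‖ * ‖z - starRingEnd ℂ b‖ = 2 * ‖b‖ * ‖(z.re : ℂ) - a‖ := by
  have hzz : z * starRingEnd ℂ z = 1 := by
    rw [Complex.mul_conj, Complex.normSq_eq_norm_sq, hz]; simp
  have h1 : ‖z - starRingEnd ℂ b‖ = ‖z * b - 1‖ := by
    rw [← Complex.norm_conj, map_sub, Complex.conj_conj, ← one_mul ‖_ - b‖, ← hz, ← norm_mul,
      mul_sub, hzz, ← norm_neg, neg_sub]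
  have hre : (z.re : ℂ) = (z + starRingEnd ℂ z) / 2 := Complex.re_eq_add_conj z
  rw [h1, ← norm_mul, show (z - b) * (z * b - 1) = z * (2 * b * ((z.re : ℂ) - a)) by
    rw [hre]; linear_combination -b * hzz - z * hb, norm_mul, norm_mul, norm_mul, hz]
  simp

/-- Every polynomial in `cos θ` has the modulus, on the unit circle, of a polynomial of twice the
degree without zeros in the open disc. -/
theorem exists_zeroFree (n : ℕ) : ∀ Q : ℂ[X], Q.natDegree ≤ n → ∃ R : ℂ[X],
    (∀ z : ℂ, ‖z‖ = 1 → ‖R.eval z‖ = ‖Q.eval (z.re : ℂ)‖) ∧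
    ∀ (ζ : ℂ) (r : ℝ), ‖ζ‖ = 1 → 0 ≤ r → r ≤ 1 →
      ‖R.eval ζ‖ ≤ (2 / (1 + r)) ^ (2 * n) * ‖R.eval (r * ζ)‖ := by
  induction n with
  | zero =>
    intro Q hQ
    obtain ⟨c, rfl⟩ := natDegree_eq_zero.1 (Nat.le_zero.1 hQ)
    exact ⟨C c, fun z _ => by simp, fun ζ r _ _ _ => by simp⟩
  | succ n ih =>
    intro Q hQ
    have hone : ∀ r : ℝ, 0 ≤ r → r ≤ 1 → 1 ≤ 2 / (1 + r) := by
      intro r h0 h1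
      rw [le_div_iff₀ (by linarith)]; linarith
    by_cases hdeg : Q.natDegree ≤ n
    · obtain ⟨R, h1, h2⟩ := ih Q hdeg
      refine ⟨R, h1, fun ζ r hζ h0 hr => (h2 ζ r hζ h0 hr).trans ?_⟩
      gcongr
      · exact hone r h0 hr
      · omega
    -- Peel off one root a: on the circle, x - a has the modulus of (z - b)(z - b̄)/(2b), at the
    -- cost of two dilation factors.
    obtain ⟨a, ha⟩ := IsAlgClosed.exists_root Q
      (by rw [degree_eq_natDegree (by rintro rfl; simp at hdeg)]; norm_cast; omega)
    obtain ⟨Q', rfl⟩ := dvd_iff_isRoot.2 ha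
    have hQ' : Q' ≠ 0 := by rintro rfl; simp at hdeg
    rw [natDegree_mul (X_sub_C_ne_zero a) hQ', natDegree_X_sub_C] at hQ
    obtain ⟨R, h1, h2⟩ := ih Q' (by omega)
    obtain ⟨b, hb1, hb⟩ := exists_joukowski a
    have hb0 : ‖b‖ ≠ 0 := by linarith
    refine ⟨C (2 * b)⁻¹ * (X - C b) * (X - C (starRingEnd ℂ b)) * R, ?_, ?_⟩
    · intro z hz
      have := norm_re_sub_eq hz hb
      simp only [eval_mul, eval_sub, eval_C, eval_X, norm_mul, norm_inv, h1 z hz, Complex.norm_two]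
      rw [mul_assoc (2 * ‖b‖)⁻¹, this, inv_mul_cancel_left₀ (by positivity)]
    · intro ζ r hζ h0 hr
      have i1 := norm_sub_le_dilate hζ hb1 h0 hr
      have i2 := norm_sub_le_dilate hζ (b := starRingEnd ℂ b) (by rwa [Complex.norm_conj]) h0 hr
      have i3 := h2 ζ r hζ h0 hr
      have : 0 ≤ 2 / (1 + r) := by linarith [hone r h0 hr]
      simp only [eval_mul, eval_sub, eval_C, eval_X, norm_mul]
      calc _ ≤ ‖(2 * b)⁻¹‖ * (2 / (1 + r) * ‖r * ζ - b‖) *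
            (2 / (1 + r) * ‖r * ζ - starRingEnd ℂ b‖) *
            ((2 / (1 + r)) ^ (2 * n) * ‖R.eval (r * ζ)‖) := by gcongr
        _ = _ := by ring

/-- The point evaluation bound in the Hardy space of the disc. -/
theorem norm_sq_mul_le_circleAverage {f : ℂ → ℂ} (hf : DiffContOnCl ℂ f (Metric.ball 0 1))
    {w : ℂ} (hw : ‖w‖ < 1) :
    ‖f w‖ ^ 2 * (1 - ‖w‖ ^ 2) ≤ Real.circleAverage (fun z => ‖f z‖ ^ 2) 0 1 := by
  -- The factor (1 - w̄z)² has modulus |z - w|² on the circle and cancels the denominator of the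
  -- Poisson kernel at w; at z = w its modulus is (1 - |w|²)².
  have hh : DiffContOnCl ℂ (fun z => f z ^ 2 * (1 - starRingEnd ℂ w * z) ^ 2)
      (Metric.ball 0 1) := by
    refine DiffContOnCl.smul (c := fun z => f z ^ 2) ?_ ?_
    · exact (differentiable_pow 2).comp_diffContOnCl hf
    · exact (by fun_prop : Differentiable ℂ
        fun z : ℂ => (1 - starRingEnd ℂ w * z) ^ 2).diffContOnCl
  have key := hh.circleAverage_poissonKernel_smul (w := w) (by simpa using hw)
  have hpos : 0 < 1 - ‖w‖ ^ 2 := by nlinarith [norm_nonneg w]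
  have hpt : ∀ z : ℂ, ‖z‖ = 1 → ‖(poissonKernel 0 w • fun z => f z ^ 2 *
      (1 - starRingEnd ℂ w * z) ^ 2) z‖ = (1 - ‖w‖ ^ 2) * ‖f z‖ ^ 2 := by
    intro z hz
    have hzz : z * starRingEnd ℂ z = 1 := by
      rw [Complex.mul_conj, Complex.normSq_eq_norm_sq, hz]; simp
    have hzw : ‖z - w‖ ≠ 0 := by
      rw [norm_ne_zero_iff, sub_ne_zero]; rintro rfl; linarith
    have e : ‖1 - starRingEnd ℂ w * z‖ = ‖z - w‖ := by
      rw [← Complex.norm_conj (z - w), ← one_mul ‖starRingEnd ℂ (z - w)‖, ← hz, ← norm_mul,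
        map_sub, mul_sub, hzz, mul_comm z]
    simp only [Pi.smul_apply', poissonKernel_def, sub_zero, norm_smul, norm_mul, norm_pow, e, hz,
      Real.norm_eq_abs, abs_div, abs_pow, abs_norm, one_pow, abs_of_pos hpos]
    field_simp
  have hle : ‖f w ^ 2 * (1 - starRingEnd ℂ w * w) ^ 2‖ ≤
      (1 - ‖w‖ ^ 2) * Real.circleAverage (fun z => ‖f z‖ ^ 2) 0 1 := by
    rw [← key, Real.circleAverage_def, Real.circleAverage_def, norm_smul, smul_eq_mul,
      mul_left_comm, ← intervalIntegral.integral_const_mul]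
    rw [Real.norm_of_nonneg (by positivity)]
    gcongr
    refine (intervalIntegral.norm_integral_le_integral_norm (by positivity)).trans_eq ?_
    refine intervalIntegral.integral_congr fun θ _ => ?_
    exact hpt _ (by simp)
  have e : ‖1 - starRingEnd ℂ w * w‖ = 1 - ‖w‖ ^ 2 := by
    rw [mul_comm, Complex.mul_conj, Complex.normSq_eq_norm_sq, ← Complex.ofReal_one,
      ← Complex.ofReal_sub, Complex.norm_real, Real.norm_of_nonneg hpos.le]
  rw [norm_mul, norm_pow, norm_pow, e] at hle
  nlinarith

/-! ### The Jacobi weight on the circle. -/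

/-- The ratio of the Jacobi and the Chebyshev density. -/
def chebRatio (α β x : ℝ) : ℝ :=
  Real.pi * normConst α β * ((1 - x) ^ (α + 1 / 2) * (1 + x) ^ (β + 1 / 2))

theorem normConst_pos {α β : ℝ} (hα : -1 < α) (hβ : -1 < β) : 0 < normConst α β := by
  have := Real.Gamma_pos_of_pos (s := α + β + 2) (by linarith)
  have := Real.Gamma_pos_of_pos (s := β + 1) (by linarith)
  have := Real.Gamma_pos_of_pos (s := α + 1) (by linarith)
  unfold normConst
  positivity

theorem density_div_cheb (α β : ℝ) {x : ℝ} (hx : x ∈ Set.Ioo (-1 : ℝ) 1) :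
    density α β x / density (-1 / 2) (-1 / 2) x = chebRatio α β x := by
  have h1 : 0 < 1 - x := by linarith [hx.2]
  have h2 : 0 < 1 + x := by linarith [hx.1]
  have e : normConst (-1 / 2) (-1 / 2) = Real.pi⁻¹ := by
    have h : (-1 / 2 : ℝ) + 1 = 1 / 2 := by norm_num
    have h' : (-1 / 2 : ℝ) + -1 / 2 + 2 = 1 := by norm_num
    have h'' : (-1 / 2 : ℝ) + -1 / 2 + 1 = 0 := by norm_num
    rw [normConst, h, h', h'', Real.Gamma_one, Real.Gamma_one_half_eq, Real.rpow_zero, mul_one,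
      Real.mul_self_sqrt Real.pi_pos.le, one_div]
  have k1 : (1 - x) ^ (α + 1 / 2) = (1 - x) ^ α / (1 - x) ^ (-1 / 2 : ℝ) := by
    rw [← Real.rpow_sub h1]; congr 1; ring
  have k2 : (1 + x) ^ (β + 1 / 2) = (1 + x) ^ β / (1 + x) ^ (-1 / 2 : ℝ) := by
    rw [← Real.rpow_sub h2]; congr 1; ring
  have := (Real.rpow_pos_of_pos h1 (-1 / 2)).ne'
  have := (Real.rpow_pos_of_pos h2 (-1 / 2)).ne'
  rw [chebRatio, k1, k2, density, density, e]
  field_simp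

/-- The substitution is made on open intervals because `g` will contain the Jacobi density, which
may blow up at the endpoints. -/
theorem integral_comp_cos_Ioo (g : ℝ → ℝ) :
    ∫ θ in (0 : ℝ)..Real.pi, Real.sin θ * g (Real.cos θ) = ∫ x in (-1 : ℝ)..1, g x := by
  have hd : ∀ θ ∈ Set.Ioo 0 Real.pi,
      HasDerivWithinAt Real.cos (-Real.sin θ) (Set.Ioo 0 Real.pi) θ :=
    fun θ _ => (Real.hasDerivAt_cos θ).hasDerivWithinAt
  have hinj : Set.InjOn Real.cos (Set.Ioo 0 Real.pi) :=
    Real.injOn_cos.mono Set.Ioo_subset_Icc_self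
  have himg : Real.cos '' Set.Ioo 0 Real.pi = Set.Ioo (-1) 1 := by
    ext x
    constructor
    · rintro ⟨θ, hθ, rfl⟩
      constructor
      · rw [← Real.cos_pi]
        exact Real.cos_lt_cos_of_nonneg_of_le_pi hθ.1.le le_rfl hθ.2
      · rw [← Real.cos_zero]
        exact Real.cos_lt_cos_of_nonneg_of_le_pi le_rfl hθ.2.le hθ.1
    · intro hx
      exact ⟨Real.arccos x, ⟨Real.arccos_pos.2 hx.2, Real.arccos_lt_pi.2 hx.1⟩,
        Real.cos_arccos hx.1.le hx.2.le⟩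
  have := integral_image_eq_integral_abs_deriv_smul measurableSet_Ioo hd hinj g
  rw [himg] at this
  rw [intervalIntegral.integral_of_le Real.pi_pos.le, integral_Ioc_eq_integral_Ioo,
    intervalIntegral.integral_of_le (by norm_num), integral_Ioc_eq_integral_Ioo, this]
  refine setIntegral_congr_fun measurableSet_Ioo fun θ hθ => ?_
  simp only [smul_eq_mul, abs_neg, abs_of_pos (Real.sin_pos_of_mem_Ioo hθ)]

theorem circleAverage_comp_re (g : ℝ → ℝ) (hg : ContinuousOn g (Set.Icc (-1) 1)) :
    Real.circleAverage (fun z => g z.re) 0 1 =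
      Real.pi⁻¹ * ∫ θ in (0 : ℝ)..Real.pi, g (Real.cos θ) := by
  have e : ∀ θ : ℝ, (circleMap 0 1 θ).re = Real.cos θ := by
    intro θ
    simp [circleMap, Complex.exp_ofReal_mul_I_re]
  have hc : Continuous fun θ => g (Real.cos θ) :=
    hg.comp_continuous Real.continuous_cos fun θ => ⟨Real.neg_one_le_cos θ, Real.cos_le_one θ⟩
  have h2 : ∫ θ in Real.pi..2 * Real.pi, g (Real.cos θ) =
      ∫ θ in (0 : ℝ)..Real.pi, g (Real.cos θ) := by
    have := intervalIntegral.integral_comp_sub_left (a := 0) (b := Real.pi)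
      (fun θ => g (Real.cos θ)) (2 * Real.pi)
    simp only [Real.cos_two_pi_sub, sub_zero] at this
    rw [this]
    congr 1
    ring
  rw [Real.circleAverage_def]
  simp only [e, smul_eq_mul]
  rw [← intervalIntegral.integral_add_adjacent_intervals (b := Real.pi)
    (hc.intervalIntegrable _ _) (hc.intervalIntegrable _ _), h2]
  field_simp
  ring

/-- On the closed disc 1 - cz meets the complement of the slit plane only at 0, where a positive
exponent restores continuity. -/
theorem continuous_cpow_one_sub_mul {s c : ℝ} (hs : 0 ≤ s) (hc : |c| = 1) :
    ContinuousOn (fun z : ℂ => (1 - c * z) ^ (s : ℂ)) (Metric.closedBall 0 1) := by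
  rcases hs.eq_or_lt with rfl | hs
  · simpa using continuousOn_const
  intro z hz
  have hlin : ContinuousWithinAt (fun z : ℂ => 1 - c * z) (Metric.closedBall 0 1) z := by fun_prop
  have hn : ‖(c : ℂ) * z‖ ≤ 1 := by
    rw [norm_mul, Complex.norm_real, Real.norm_eq_abs, hc, one_mul]
    simpa using hz
  by_cases h0 : 1 - (c : ℂ) * z = 0
  · have : ContinuousAt (fun y : ℂ => y ^ (s : ℂ)) (1 - c * z) := by
      rw [h0]
      refine (Complex.continuousAt_cpow_zero_of_re_pos (z := (s : ℂ)) (by simpa using hs)).comp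
        (f := fun y : ℂ => (y, (s : ℂ))) (by fun_prop)
    exact ContinuousAt.comp_continuousWithinAt (f := fun z : ℂ => 1 - c * z) this hlin
  · refine hlin.cpow continuousWithinAt_const ?_
    rw [Complex.mem_slitPlane_iff]
    by_contra hcon
    push Not at hcon
    have hre : 1 ≤ ((c : ℂ) * z).re := by
      have := hcon.1; simp only [Complex.sub_re, Complex.one_re] at this; linarith
    have him : ((c : ℂ) * z).im = 0 := by
      have := hcon.2; simpa using this
    have hre' := (Complex.re_le_norm _).trans hn
    apply h0
    rw [sub_eq_zero]
    apply Complex.ext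
    · simpa using (le_antisymm hre' hre).symm
    · simpa using him.symm

theorem diffContOnCl_cpow_one_sub_mul {s c : ℝ} (hs : 0 ≤ s) (hc : |c| = 1) :
    DiffContOnCl ℂ (fun z : ℂ => (1 - c * z) ^ (s : ℂ)) (Metric.ball 0 1) := by
  refine DiffContOnCl.mk_ball ?_ (continuous_cpow_one_sub_mul hs hc)
  intro z hz
  refine DifferentiableAt.differentiableWithinAt ?_
  refine DifferentiableAt.cpow (by fun_prop) (by fun_prop) ?_
  rw [Complex.mem_slitPlane_iff]
  left
  have hn : ‖(c : ℂ) * z‖ < 1 := by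
    rw [norm_mul, Complex.norm_real, Real.norm_eq_abs, hc, one_mul]
    simpa using hz
  have := (Complex.re_le_norm _).trans_lt hn
  simp only [Complex.sub_re, Complex.one_re]
  linarith

theorem norm_one_sub_mul_sq {z : ℂ} {c : ℝ} (hz : ‖z‖ = 1) (hc : |c| = 1) :
    ‖1 - c * z‖ ^ 2 = 2 * (1 - c * z.re) := by
  have h := Complex.sq_norm z
  rw [hz, Complex.normSq_apply] at h
  have hc2 : c ^ 2 = 1 := by rw [← sq_abs, hc, one_pow]
  rw [Complex.sq_norm, Complex.normSq_apply]
  simp only [Complex.sub_re, Complex.sub_im, Complex.one_re, Complex.one_im,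
    Complex.re_ofReal_mul, Complex.im_ofReal_mul]
  linear_combination -c ^ 2 * h + hc2

theorem norm_cpow_one_sub_mul_sq {z : ℂ} {c : ℝ} (s : ℝ) (hz : ‖z‖ = 1) (hc : |c| = 1) :
    ‖(1 - c * z) ^ (s : ℂ)‖ ^ 2 = (2 * (1 - c * z.re)) ^ s := by
  rw [Complex.norm_cpow_real, ← norm_one_sub_mul_sq hz hc, ← Real.rpow_natCast,
    ← Real.rpow_natCast, ← Real.rpow_mul (norm_nonneg _), ← Real.rpow_mul (norm_nonneg _),
    mul_comm s]

/-- A rotation by c turns this into `norm_sub_le_dilate` with b = 1, raised to the power s: the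
endpoint weights behave like zeros of real multiplicity s. -/
theorem norm_cpow_le_dilate {ζ : ℂ} {r s c : ℝ} (hs : 0 ≤ s) (hζ : ‖ζ‖ = 1) (hc : |c| = 1)
    (hr0 : 0 ≤ r) (hr1 : r ≤ 1) :
    ‖(1 - c * ζ) ^ (s : ℂ)‖ ≤ (2 / (1 + r)) ^ s * ‖(1 - c * (r * ζ)) ^ (s : ℂ)‖ := by
  rw [Complex.norm_cpow_real, Complex.norm_cpow_real, ← Real.mul_rpow (by positivity)
    (norm_nonneg _)]
  have h := norm_sub_le_dilate (ζ := c * ζ) (b := 1) (r := r)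
    (by rw [norm_mul, Complex.norm_real, Real.norm_eq_abs, hc, hζ, one_mul]) (by simp) hr0 hr1
  rw [norm_sub_rev (c * ζ) 1, norm_sub_rev _ (1 : ℂ),
    show (r : ℂ) * (c * ζ) = c * (r * ζ) by ring] at h
  exact Real.rpow_le_rpow (norm_nonneg _) h hs

/-- The radius r = 1 - 2/m minimizes (2/(1+r))^(m-2)/(1-r²). With it 2/(1+r) = m/(m-1), and the
constant e enters through (m/(m-1))^(m-1) ≤ e. -/
theorem dilation_factor_le {m : ℝ} (hm : 2 ≤ m) :
    (2 / (1 + (1 - 2 / m))) ^ (m - 2) ≤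
      Real.exp 1 * (m / 4) * (1 - (1 - 2 / m) ^ 2) := by
  have h1 : 0 < m - 1 := by linarith
  have e1 : 2 / (1 + (1 - 2 / m)) = m / (m - 1) := by
    have : m ≠ 0 := by linarith
    have h2 : 1 + (1 - 2 / m) = 2 * (m - 1) / m := by field_simp; ring
    rw [h2]
    field_simp
  have e2 : m / 4 * (1 - (1 - 2 / m) ^ 2) = (m - 1) / m := by
    have : m ≠ 0 := by linarith
    field_simp; ring
  have e3 : (m / (m - 1)) ^ (m - 2) = (m / (m - 1)) ^ (m - 1) * ((m - 1) / m) := by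
    have hp : 0 < m / (m - 1) := by positivity
    rw [show m - 2 = (m - 1) - 1 by ring, Real.rpow_sub_one hp.ne', div_eq_mul_inv, inv_div]
  have e4 : (m / (m - 1)) ^ (m - 1) ≤ Real.exp 1 := by
    have hb : m / (m - 1) ≤ Real.exp (1 / (m - 1)) := by
      have := Real.add_one_le_exp (1 / (m - 1))
      have e : 1 / (m - 1) + 1 = m / (m - 1) := by field_simp; ring
      linarith
    refine (Real.rpow_le_rpow (by positivity) hb h1.le).trans_eq ?_
    rw [← Real.exp_mul, one_div, inv_mul_cancel₀ h1.ne']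
  rw [mul_assoc, e1, e2, e3]
  have : 0 ≤ (m - 1) / m := by positivity
  gcongr

/-- The Nikolskii-type inequality for Jacobi-weighted polynomials. -/
theorem chebRatio_mul_sq_le {α β : ℝ} (hα : -1 / 2 ≤ α) (hβ : -1 / 2 ≤ β) {n : ℕ} {Q : ℝ[X]}
    (hQ : Q.natDegree ≤ n) {x : ℝ} (hx : x ∈ Set.Icc (-1 : ℝ) 1) :
    chebRatio α β x * Q.eval x ^ 2 ≤
      Real.exp 1 * (n + (α + β) / 2 + 1) *
        jInt (by linarith : -1 < α) (by linarith : -1 < β) (Q ^ 2) := by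
  have hα' : -1 < α := by linarith
  have hβ' : -1 < β := by linarith
  have hs : 0 ≤ α + 1 / 2 := by linarith
  have ht : 0 ≤ β + 1 / 2 := by linarith
  have hnc := normConst_pos hα' hβ'
  obtain ⟨R, hR1, hR2⟩ := exists_zeroFree n (Q.map (algebraMap ℝ ℂ))
    ((natDegree_map_le).trans hQ)
  have hRre : ∀ z : ℂ, ‖z‖ = 1 → ‖R.eval z‖ ^ 2 = Q.eval z.re ^ 2 := by
    intro z hz
    rw [hR1 z hz]
    have : (Q.map (algebraMap ℝ ℂ)).eval (z.re : ℂ) = ((Q.eval z.re : ℝ) : ℂ) :=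
      eval_map_algebraMap Q (z.re : ℂ) |>.trans (aeval_algebraMap_apply_eq_algebraMap_eval z.re Q)
    rw [this, Complex.norm_real, Real.norm_eq_abs, sq_abs]
  -- On the circle |f|² is, up to a constant, (ρ/ρ_c)Q² at x = Re z, so its circle average is a
  -- multiple of ∫ Q²ρ.
  set f : ℂ → ℂ := fun z => (1 - (1 : ℝ) * z) ^ ((α + 1 / 2 : ℝ) : ℂ) *
    (1 - (-1 : ℝ) * z) ^ ((β + 1 / 2 : ℝ) : ℂ) * R.eval z with hf
  have hfd : DiffContOnCl ℂ f (Metric.ball 0 1) := by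
    refine DiffContOnCl.smul (DiffContOnCl.smul
      (diffContOnCl_cpow_one_sub_mul hs (by simp)) (diffContOnCl_cpow_one_sub_mul ht (by simp)))
      R.differentiable.diffContOnCl
  set H : ℝ → ℝ := fun x => (2 * (1 - 1 * x)) ^ (α + 1 / 2) * (2 * (1 - -1 * x)) ^ (β + 1 / 2) *
    Q.eval x ^ 2 with hH
  have hfH : ∀ z : ℂ, ‖z‖ = 1 → ‖f z‖ ^ 2 = H z.re := by
    intro z hz
    simp only [hf, hH, norm_mul, mul_pow]
    rw [norm_cpow_one_sub_mul_sq _ hz (by simp), norm_cpow_one_sub_mul_sq _ hz (by simp),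
      hRre z hz]
  have hHc : ContinuousOn H (Set.Icc (-1) 1) := by
    refine Continuous.continuousOn ?_
    refine (Continuous.mul ?_ ?_).mul (Q.continuous.pow 2)
    · exact (by fun_prop : Continuous fun x : ℝ => 2 * (1 - 1 * x)).rpow_const
        fun x => Or.inr hs
    · exact (by fun_prop : Continuous fun x : ℝ => 2 * (1 - -1 * x)).rpow_const
        fun x => Or.inr ht
  have h2split : (2 : ℝ) ^ (α + β + 1) = 2 ^ (α + 1 / 2) * 2 ^ (β + 1 / 2) := by
    rw [← Real.rpow_add two_pos]; congr 1; ring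
  have hHr : ∀ x ∈ Set.Icc (-1 : ℝ) 1, Real.pi * normConst α β * H x =
      2 ^ (α + β + 1) * (chebRatio α β x * Q.eval x ^ 2) := by
    intro x hx
    simp only [hH, chebRatio]
    rw [Real.mul_rpow two_pos.le (by linarith [hx.2]),
      Real.mul_rpow two_pos.le (by linarith [hx.1]), h2split, one_mul, neg_one_mul,
      sub_neg_eq_add]
    ring
  have hav : normConst α β * Real.circleAverage (fun z => ‖f z‖ ^ 2) 0 1 =
      Real.pi⁻¹ * (2 ^ (α + β + 1) * jInt hα' hβ' (Q ^ 2)) := by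
    have e : Real.circleAverage (fun z => ‖f z‖ ^ 2) 0 1 =
        Real.circleAverage (fun z => H z.re) 0 1 := by
      rw [Real.circleAverage_def, Real.circleAverage_def]
      congr 1
      exact intervalIntegral.integral_congr fun θ _ => hfH _ (by simp)
    rw [e, circleAverage_comp_re H hHc, jInt_apply, ← integral_comp_cos_Ioo, mul_left_comm]
    congr 1
    rw [← intervalIntegral.integral_const_mul, ← intervalIntegral.integral_const_mul]
    refine intervalIntegral.integral_congr_uIoo fun θ hθ => ?_
    rw [Set.uIoo_of_le Real.pi_pos.le] at hθ
    have hsin := Real.sin_pos_of_mem_Ioo hθ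
    have hsq := Real.sin_sq_add_cos_sq θ
    have h1 : 0 < 1 - Real.cos θ := by nlinarith [Real.neg_one_le_cos θ, Real.cos_le_one θ]
    have h2 : 0 < 1 + Real.cos θ := by nlinarith [Real.neg_one_le_cos θ, Real.cos_le_one θ]
    have hsqrt : Real.sin θ = (1 - Real.cos θ) ^ (1 / 2 : ℝ) * (1 + Real.cos θ) ^ (1 / 2 : ℝ) := by
      rw [← Real.mul_rpow h1.le h2.le, ← Real.sqrt_eq_rpow, ← Real.sqrt_sq hsin.le]
      congr 1
      linear_combination hsq
    simp only [hH, eval_pow, density, one_mul, neg_one_mul, sub_neg_eq_add]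
    rw [Real.mul_rpow two_pos.le h1.le, Real.mul_rpow two_pos.le h2.le,
      Real.rpow_add h1, Real.rpow_add h2, hsqrt, h2split]
    ring
  have hn0 : (0 : ℝ) ≤ n := n.cast_nonneg
  -- The dilation exponents of f add up to 2n + (α + 1/2) + (β + 1/2) = (m - 2)/2, and m ≥ 2 even
  -- for n = 0.
  set m : ℝ := 4 * (n + (α + β) / 2 + 1) with hm
  have hm2 : 2 ≤ m := by rw [hm]; linarith
  set r : ℝ := 1 - 2 / m with hr
  have hr0 : 0 ≤ r := by
    have : 2 / m ≤ 1 := by rw [div_le_one (by linarith)]; exact hm2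
    rw [hr]; linarith
  have hr1 : r < 1 := by
    have : 0 < 2 / m := by positivity
    rw [hr]; linarith
  set ζ : ℂ := Complex.exp (Real.arccos x * Complex.I) with hζ
  have hζ1 : ‖ζ‖ = 1 := Complex.norm_exp_ofReal_mul_I _
  have hζre : ζ.re = x := by
    rw [hζ, Complex.exp_ofReal_mul_I_re, Real.cos_arccos hx.1 hx.2]
  have hq : 0 < 2 / (1 + r) := by positivity
  have hdil : ‖f ζ‖ ^ 2 ≤ (2 / (1 + r)) ^ (m - 2) * ‖f (r * ζ)‖ ^ 2 := by
    have i1 := norm_cpow_le_dilate (c := 1) hs hζ1 (by simp) hr0 hr1.le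
    have i2 := norm_cpow_le_dilate (c := -1) ht hζ1 (by simp) hr0 hr1.le
    have i3 := hR2 ζ r hζ1 hr0 hr1.le
    have : ‖f ζ‖ ≤ (2 / (1 + r)) ^ ((m - 2) / 2) * ‖f (r * ζ)‖ := by
      have e : (2 / (1 + r)) ^ ((m - 2) / 2) = (2 / (1 + r)) ^ (α + 1 / 2) *
          (2 / (1 + r)) ^ (β + 1 / 2) * (2 / (1 + r)) ^ (2 * n) := by
        rw [← Real.rpow_natCast, ← Real.rpow_add hq, ← Real.rpow_add hq]
        congr 1
        rw [hm]; push_cast; ring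
      simp only [hf, norm_mul] at i1 i2 i3 ⊢
      rw [e]
      refine (mul_le_mul (mul_le_mul i1 i2 (norm_nonneg _) (by positivity)) i3 (norm_nonneg _)
        (by positivity)).trans_eq ?_
      ring
    calc ‖f ζ‖ ^ 2 ≤ ((2 / (1 + r)) ^ ((m - 2) / 2) * ‖f (r * ζ)‖) ^ 2 := by gcongr
      _ = _ := by
        rw [mul_pow, ← Real.rpow_natCast (_ ^ _), ← Real.rpow_mul hq.le]
        congr 2
        push_cast; ring
  have hwn : ‖(r : ℂ) * ζ‖ = r := by
    rw [norm_mul, hζ1, Complex.norm_real, Real.norm_of_nonneg hr0, mul_one]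
  have hhardy := norm_sq_mul_le_circleAverage hfd (w := r * ζ) (by rw [hwn]; exact hr1)
  rw [hwn] at hhardy
  have hfac := dilation_factor_le hm2
  rw [← hr] at hfac
  have hle : ‖f ζ‖ ^ 2 ≤ Real.exp 1 * (m / 4) *
      Real.circleAverage (fun z => ‖f z‖ ^ 2) 0 1 := by
    have h0 : 0 ≤ Real.exp 1 * (m / 4) := by positivity
    calc _ ≤ (2 / (1 + r)) ^ (m - 2) * ‖f (r * ζ)‖ ^ 2 := hdil
      _ ≤ (Real.exp 1 * (m / 4) * (1 - r ^ 2)) * ‖f (r * ζ)‖ ^ 2 := by gcongr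
      _ = Real.exp 1 * (m / 4) * (‖f (r * ζ)‖ ^ 2 * (1 - r ^ 2)) := by ring
      _ ≤ _ := by gcongr
  rw [hfH ζ hζ1, hζre] at hle
  have h2 : (0 : ℝ) < 2 ^ (α + β + 1) := Real.rpow_pos_of_pos two_pos _
  refine le_of_mul_le_mul_left ?_ h2
  rw [← hHr x hx]
  have hpn : 0 < Real.pi * normConst α β := mul_pos Real.pi_pos hnc
  calc _ ≤ Real.pi * normConst α β * (Real.exp 1 * (m / 4) *
      Real.circleAverage (fun z => ‖f z‖ ^ 2) 0 1) := by gcongr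
    _ = Real.exp 1 * (m / 4) * (Real.pi * (normConst α β *
      Real.circleAverage (fun z => ‖f z‖ ^ 2) 0 1)) := by ring
    _ = _ := by
      rw [hav, mul_inv_cancel_left₀ Real.pi_pos.ne', hm]
      ring

/-- The Christoffel function bound: the diagonal of the reproducing kernel. -/
theorem IsJacobiBasis.chebRatio_mul_kernel_le {α β : ℝ} {p : ℕ → ℝ[X]}
    (h : IsJacobiBasis α β p) (hα : -1 / 2 ≤ α) (hβ : -1 / 2 ≤ β) (n : ℕ) {x : ℝ}
    (hx : x ∈ Set.Icc (-1 : ℝ) 1) :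
    chebRatio α β x * ∑ k ∈ Finset.range (n + 1), (p k).eval x ^ 2 ≤
      Real.exp 1 * (n + (α + β) / 2 + 1) := by
  have hα' : -1 < α := by linarith
  have hβ' : -1 < β := by linarith
  set K := ∑ k ∈ Finset.range (n + 1), (p k).eval x ^ 2 with hK
  -- The extremal choice is the reproducing kernel at x, for which Q(x) and ∫ Q²ρ are both K;
  -- dividing by K gives the bound.
  set Q : ℝ[X] := ∑ k ∈ Finset.range (n + 1), C ((p k).eval x) * p k with hQ
  have hdeg : Q.natDegree ≤ n := by
    refine natDegree_sum_le_of_forall_le _ _ fun k hk => ?_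
    refine (natDegree_C_mul_le _ _).trans ?_
    rw [natDegree_eq_of_degree_eq_some (h.degree_eq k)]
    exact Nat.lt_succ_iff.1 (Finset.mem_range.1 hk)
  have hev : Q.eval x = K := by
    rw [hQ, eval_finsetSum]
    exact Finset.sum_congr rfl fun k _ => by rw [eval_mul, eval_C, sq]
  have hintg : jInt hα' hβ' (Q ^ 2) = K := by
    have : ∀ k ∈ Finset.range (n + 1), jInt hα' hβ' (p k * Q) = (p k).eval x := by
      intro k hk
      rw [hQ, Finset.mul_sum, map_sum, Finset.sum_eq_single k]
      · rw [mul_left_comm, jInt_C_mul, h.jInt_mul]; simp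
      · intro j _ hj
        rw [mul_left_comm, jInt_C_mul, h.jInt_mul, if_neg hj.symm, mul_zero]
      · exact fun h' => absurd hk h'
    rw [sq]
    conv_lhs => rw [hQ, Finset.sum_mul, map_sum, ← hQ]
    rw [hK]
    refine Finset.sum_congr rfl fun k hk => ?_
    rw [mul_assoc, jInt_C_mul, this k hk, sq]
  have key := chebRatio_mul_sq_le hα hβ hdeg hx
  rw [hev, hintg] at key
  have hK0 : 0 ≤ K := Finset.sum_nonneg fun k _ => sq_nonneg _
  rcases hK0.eq_or_lt with h0 | h0
  · rw [← h0, mul_zero]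
    have : (0 : ℝ) ≤ n := n.cast_nonneg
    exact mul_nonneg (Real.exp_pos 1).le (by linarith)
  · exact le_of_mul_le_mul_right (by nlinarith) h0

/-! ### The oscillatory equation `u'' = -q u` -/

/-- If `u'' = -q u` with `q' ≥ L > 0`, `u` vanishes at `0`, and the energy `u'² + q u²` is
nonnegative wherever `u²` increases, then `q` is bounded below at a maximum of `u`. -/
theorem cube_lower_bound_of_pos {u u' q q' : ℝ → ℝ} {T L : ℝ} (hT : 0 < T) (hu0 : u 0 = 0)
    (hc : ContinuousOn u (Set.Icc 0 T))
    (hu : ∀ θ ∈ Set.Ioc 0 T, HasDerivAt u (u' θ) θ)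
    (hu' : ∀ θ ∈ Set.Ioc 0 T, HasDerivAt u' (-q θ * u θ) θ)
    (hq : ∀ θ ∈ Set.Ioc 0 T, HasDerivAt q (q' θ) θ)
    (hL0 : 0 < L) (hL : ∀ θ ∈ Set.Ioc 0 T, L ≤ q' θ)
    (hen : ∀ θ ∈ Set.Ioc 0 T, 0 ≤ u θ * u' θ → 0 ≤ u' θ ^ 2 + q θ * u θ ^ 2)
    (hcrit : u' T = 0) (hpos : 0 < u T) (hmax : ∀ θ ∈ Set.Icc 0 T, u θ ≤ u T) :
    4 / 9 * L ^ 2 ≤ q T ^ 3 := by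
  have hTm : T ∈ Set.Ioc 0 T := ⟨hT, le_rfl⟩
  -- The uu' terms cancel along u'' = -qu, leaving only q'u².
  have hdE : ∀ θ ∈ Set.Ioc 0 T,
      HasDerivAt (fun θ => u' θ ^ 2 + q θ * u θ ^ 2) (q' θ * u θ ^ 2) θ := by
    intro θ hθ
    refine (((hu' θ hθ).pow 2).add ((hq θ hθ).mul ((hu θ hθ).pow 2))).congr_deriv ?_
    simp only [Pi.pow_apply]
    push_cast
    ring
  have hmonoE : MonotoneOn (fun θ => u' θ ^ 2 + q θ * u θ ^ 2) (Set.Ioc 0 T) := by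
    refine monotoneOn_of_hasDerivWithinAt_nonneg (convex_Ioc 0 T)
      (fun θ hθ => (hdE θ hθ).continuousAt.continuousWithinAt)
      (fun θ hθ => (hdE θ (interior_subset hθ)).hasDerivWithinAt) fun θ hθ => ?_
    exact mul_nonneg (hL0.le.trans (hL θ (interior_subset hθ))) (sq_nonneg _)
  have hmonoq : MonotoneOn q (Set.Ioc 0 T) := by
    refine monotoneOn_of_hasDerivWithinAt_nonneg (convex_Ioc 0 T)
      (fun θ hθ => (hq θ hθ).continuousAt.continuousWithinAt)
      (fun θ hθ => (hq θ (interior_subset hθ)).hasDerivWithinAt) fun θ hθ => ?_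
    exact hL0.le.trans (hL θ (interior_subset hθ))
  -- When u(θ) ≠ 0, u² rises from 0 at the left endpoint, so the mean value theorem gives an earlier
  -- η with uu' ≥ 0. There `hen` applies, and the energy increases from η to θ.
  have hE0 : ∀ θ ∈ Set.Ioc 0 T, 0 ≤ u' θ ^ 2 + q θ * u θ ^ 2 := by
    intro θ hθ
    by_cases hz : u θ = 0
    · rw [hz]; nlinarith [sq_nonneg (u' θ)]
    have hsub : Set.Icc 0 θ ⊆ Set.Icc 0 T := Set.Icc_subset_Icc_right hθ.2
    obtain ⟨η, hη, hη'⟩ := exists_hasDerivAt_eq_slope (fun θ => u θ ^ 2)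
      (fun θ => 2 * (u θ * u' θ)) hθ.1 ((hc.mono hsub).pow 2) (by
        intro x hx
        refine ((hu x ⟨hx.1, hx.2.le.trans hθ.2⟩).pow 2).congr_deriv ?_
        push_cast
        ring)
    have hηT : η ∈ Set.Ioc 0 T := ⟨hη.1, hη.2.le.trans hθ.2⟩
    have hpos : 0 ≤ u η * u' η := by
      have : 0 ≤ (u θ ^ 2 - u 0 ^ 2) / (θ - 0) := by
        rw [hu0, zero_pow two_ne_zero, sub_zero, sub_zero]
        exact div_nonneg (sq_nonneg _) hθ.1.le
      linarith
    exact (hen η hηT hpos).trans (hmonoE hηT hθ hη.2.le)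
  have hQ0 : 0 ≤ q T := by
    have := hE0 T hTm
    rw [hcrit] at this
    by_contra hneg
    nlinarith [mul_pos (sub_pos.2 (not_le.1 hneg)) (pow_pos hpos 2)]
  -- the last zero before `T`
  have hZc : IsCompact (Set.Icc 0 T ∩ u ⁻¹' {0}) :=
    isCompact_Icc.of_isClosed_subset (hc.preimage_isClosed_of_isClosed isClosed_Icc
      isClosed_singleton) Set.inter_subset_left
  obtain ⟨ξ, ⟨hξ, hξ0⟩, hξmax⟩ := hZc.exists_isGreatest ⟨0, ⟨le_rfl, hT.le⟩, hu0⟩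
  have hξ0 : u ξ = 0 := hξ0
  have hξT : ξ < T := lt_of_le_of_ne hξ.2 (by rintro rfl; exact hpos.ne' hξ0)
  have hsubξ : Set.Icc ξ T ⊆ Set.Icc 0 T := Set.Icc_subset_Icc_left hξ.1
  have hupos : ∀ θ ∈ Set.Ioc ξ T, 0 < u θ := by
    intro θ hθ
    by_contra hneg
    obtain ⟨η, hη, hη0⟩ := intermediate_value_Icc hθ.2
      (hc.mono (Set.Icc_subset_Icc_left (hξ.1.trans hθ.1.le))) ⟨not_lt.1 hneg, hpos.le⟩
    have : η ≤ ξ := hξmax ⟨⟨hξ.1.trans (hθ.1.le.trans hη.1), hη.2⟩, hη0⟩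
    linarith [hη.1, hθ.1]
  set Q := q T with hQ
  set U := u T with hU
  have hsub : ∀ θ ∈ Set.Ioc ξ T, θ ∈ Set.Ioc 0 T := fun θ hθ => ⟨hξ.1.trans_lt hθ.1, hθ.2⟩
  -- Comparison parabola tangent to u at T. Since q is increasing and u ≤ U, u'' = -qu ≥ -QU, so the
  -- parabola lies below u back to the last zero ξ.
  have hdg : ∀ θ, HasDerivAt (fun θ => U * (1 - Q * (T - θ) ^ 2 / 2)) (U * (Q * (T - θ))) θ := by
    intro θ
    have := ((((hasDerivAt_id θ).const_sub T).pow 2).const_mul Q |>.div_const 2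
      |>.const_sub 1 |>.const_mul U)
    refine this.congr_deriv ?_
    simp only [id]
    push_cast
    ring
  have hdg' : ∀ θ, HasDerivAt (fun θ => U * (Q * (T - θ))) (-(U * Q)) θ := by
    intro θ
    refine (((hasDerivAt_id θ).const_sub T).const_mul Q |>.const_mul U).congr_deriv ?_
    ring
  have hg' : ∀ θ ∈ Set.Ioc ξ T, u' θ ≤ U * (Q * (T - θ)) := by
    have hmono : MonotoneOn (fun θ => u' θ - U * (Q * (T - θ))) (Set.Ioc ξ T) := by
      refine monotoneOn_of_hasDerivWithinAt_nonneg (convex_Ioc ξ T)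
        (f' := fun θ => -q θ * u θ - -(U * Q))
        (fun θ hθ => ((hu' θ (hsub θ hθ)).sub (hdg' θ)).continuousAt.continuousWithinAt)
        (fun θ hθ => ((hu' θ (hsub θ (interior_subset hθ))).sub (hdg' θ)).hasDerivWithinAt)
        fun θ hθ => ?_
      have hθ := interior_subset hθ
      have h1 := hmonoq (hsub θ hθ) hTm hθ.2
      have h2 := hmax θ ⟨(hsub θ hθ).1.le, hθ.2⟩
      have h3 : q θ * u θ ≤ Q * U :=
        (mul_le_mul_of_nonneg_right h1 (hupos θ hθ).le).trans (mul_le_mul_of_nonneg_left h2 hQ0)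
      linarith
    intro θ hθ
    have := hmono hθ ⟨hξT, le_rfl⟩ hθ.2
    simp only [hcrit, sub_self, mul_zero] at this
    linarith
  have hg : ∀ θ ∈ Set.Icc ξ T, U * (1 - Q * (T - θ) ^ 2 / 2) ≤ u θ := by
    have hanti : AntitoneOn (fun θ => u θ - U * (1 - Q * (T - θ) ^ 2 / 2)) (Set.Icc ξ T) := by
      refine antitoneOn_of_hasDerivWithinAt_nonpos (convex_Icc ξ T)
        (f' := fun θ => u' θ - U * (Q * (T - θ)))
        ((hc.mono hsubξ).sub fun θ _ => (hdg θ).continuousAt.continuousWithinAt) ?_ ?_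
      · intro θ hθ
        rw [interior_Icc] at hθ
        exact ((hu θ (hsub θ ⟨hθ.1, hθ.2.le⟩)).sub (hdg θ)).hasDerivWithinAt
      · intro θ hθ
        rw [interior_Icc] at hθ
        have := hg' θ ⟨hθ.1, hθ.2.le⟩
        linarith
    intro θ hθ
    have := hanti hθ ⟨hξT.le, le_rfl⟩ hθ.2
    simp only [sub_self] at this
    rw [← hU] at this
    nlinarith
  have hwidth : 2 ≤ Q * (T - ξ) ^ 2 := by
    have := hg ξ ⟨le_rfl, hξT.le⟩
    rw [hξ0] at this
    by_contra hlt
    nlinarith [mul_pos hpos (sub_pos.2 (not_le.1 hlt))]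
  have hQpos : 0 < Q := by
    rcases hQ0.eq_or_lt with h | h
    · rw [← h] at hwidth; linarith
    · exact h
  -- At distance h from T the bound 1 - Q(T-θ)² for (u/U)² reaches zero; `hwidth` keeps this window
  -- to the right of ξ.
  set h := 1 / √Q with hh
  have hsq := Real.sq_sqrt hQ0
  have hsQ : 0 < √Q := Real.sqrt_pos.2 hQpos
  have hh0 : 0 < h := by positivity
  have hQh : Q * h ^ 2 = 1 := by
    rw [hh, div_pow, hsq]; field_simp
  have hhξ : h < T - ξ := by
    by_contra hle
    have h0 : 0 ≤ T - ξ := by linarith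
    have : (T - ξ) ^ 2 ≤ h ^ 2 := by gcongr; linarith
    nlinarith
  -- The energy gains at least LU² ∫₀^h (1 - Qs²) ds = (2/3)LU²h over the window. It starts
  -- nonnegative and ends at QU², whence Q^(3/2) ≥ (2/3)L.
  have hmonoG : MonotoneOn (fun θ => u' θ ^ 2 + q θ * u θ ^ 2 -
      L * U ^ 2 * (θ + Q * (T - θ) ^ 3 / 3)) (Set.Icc (T - h) T) := by
    have hmem : ∀ θ ∈ Set.Icc (T - h) T, θ ∈ Set.Ioc ξ T := fun θ hθ => ⟨by linarith [hθ.1], hθ.2⟩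
    have hd : ∀ θ ∈ Set.Icc (T - h) T, HasDerivAt (fun θ => u' θ ^ 2 + q θ * u θ ^ 2 -
        L * U ^ 2 * (θ + Q * (T - θ) ^ 3 / 3))
        (q' θ * u θ ^ 2 - L * U ^ 2 * (1 - Q * (T - θ) ^ 2)) θ := by
      intro θ hθ
      refine (hdE θ (hsub θ (hmem θ hθ))).sub ?_
      have := ((hasDerivAt_id θ).add ((((hasDerivAt_id θ).const_sub T).pow 3).const_mul Q
        |>.div_const 3)).const_mul (L * U ^ 2)
      refine this.congr_deriv ?_
      simp only [id]
      push_cast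
      ring
    refine monotoneOn_of_hasDerivWithinAt_nonneg (convex_Icc _ T)
      (fun θ hθ => (hd θ hθ).continuousAt.continuousWithinAt)
      (fun θ hθ => (hd θ (interior_subset hθ)).hasDerivWithinAt) fun θ hθ => ?_
    have hθ := interior_subset hθ
    have h1 := hg θ ⟨(hmem θ hθ).1.le, hθ.2⟩
    have hTθ : Q * (T - θ) ^ 2 ≤ 1 := by
      rw [← hQh]
      have : 0 ≤ T - θ := by linarith [hθ.2]
      have : T - θ ≤ h := by linarith [hθ.1]
      gcongr
    have h2 : 0 ≤ U * (1 - Q * (T - θ) ^ 2 / 2) := mul_nonneg hpos.le (by linarith)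
    have h3 : (U * (1 - Q * (T - θ) ^ 2 / 2)) ^ 2 ≤ u θ ^ 2 := by gcongr
    have h4 : U ^ 2 * (1 - Q * (T - θ) ^ 2) ≤ u θ ^ 2 := by
      refine le_trans ?_ h3
      rw [mul_pow]
      gcongr
      nlinarith [sq_nonneg (Q * (T - θ) ^ 2)]
    have h5 : L * (U ^ 2 * (1 - Q * (T - θ) ^ 2)) ≤ q' θ * u θ ^ 2 :=
      (mul_le_mul_of_nonneg_left h4 hL0.le).trans
        (mul_le_mul_of_nonneg_right (hL θ (hsub θ (hmem θ hθ))) (sq_nonneg _))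
    linarith
  have hfin := hmonoG (a := T - h) (b := T) ⟨le_rfl, by linarith⟩ ⟨by linarith, le_rfl⟩
    (by linarith)
  have hE := hE0 (T - h) ⟨by linarith [hξ.1], by linarith⟩
  simp only [hcrit, sub_self, sub_sub_cancel] at hfin
  rw [← hQ, ← hU] at hfin
  have hU2 : 0 < U ^ 2 := by positivity
  have hcore : L * (2 / 3 * h) ≤ Q := by
    have e : Q * h ^ 3 = h := by
      have : Q * h ^ 3 = Q * h ^ 2 * h := by ring
      rw [this, hQh, one_mul]
    rw [e] at hfin
    refine le_of_mul_le_mul_right ?_ hU2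
    linarith
  have hsqr : (L * (2 / 3 * h)) ^ 2 ≤ Q ^ 2 := by gcongr
  calc 4 / 9 * L ^ 2 = (L * (2 / 3 * h)) ^ 2 * Q := by
        rw [show (L * (2 / 3 * h)) ^ 2 * Q = 4 / 9 * L ^ 2 * (Q * h ^ 2) by ring, hQh, mul_one]
    _ ≤ Q ^ 2 * Q := by gcongr
    _ = Q ^ 3 := by ring

/-- Replacing u by -u reduces to a positive maximum; the equation and the energy are even in u. -/
theorem cube_lower_bound {u u' q q' : ℝ → ℝ} {T L : ℝ} (hT : 0 < T) (hu0 : u 0 = 0)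
    (hc : ContinuousOn u (Set.Icc 0 T))
    (hu : ∀ θ ∈ Set.Ioc 0 T, HasDerivAt u (u' θ) θ)
    (hu' : ∀ θ ∈ Set.Ioc 0 T, HasDerivAt u' (-q θ * u θ) θ)
    (hq : ∀ θ ∈ Set.Ioc 0 T, HasDerivAt q (q' θ) θ)
    (hL0 : 0 < L) (hL : ∀ θ ∈ Set.Ioc 0 T, L ≤ q' θ)
    (hen : ∀ θ ∈ Set.Ioc 0 T, 0 ≤ u θ * u' θ → 0 ≤ u' θ ^ 2 + q θ * u θ ^ 2)
    (hcrit : u' T = 0) (hne : u T ≠ 0) (hmax : ∀ θ ∈ Set.Icc 0 T, u θ ^ 2 ≤ u T ^ 2) :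
    4 / 9 * L ^ 2 ≤ q T ^ 3 := by
  rcases lt_or_gt_of_ne hne with hneg | hpos
  · refine cube_lower_bound_of_pos (u := -u) (u' := -u') hT (by simp [hu0]) hc.neg
      (fun θ hθ => (hu θ hθ).neg) (fun θ hθ => ((hu' θ hθ).neg).congr_deriv ?_) hq hL0 hL
      (fun θ hθ h => ?_) (by simp [hcrit]) (by simpa using hneg) fun θ hθ => ?_
    · simp
    · have := hen θ hθ (by simpa using h)
      simpa using this
    · have h1 : 0 ≤ -u T := by linarith
      have := (abs_le_of_sq_le_sq' (a := -u θ) (b := -u T) (by simpa using hmax θ hθ) h1).2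
      simpa using this
  · exact cube_lower_bound_of_pos hT hu0 hc hu hu' hq hL0 hL hen hcrit hpos fun θ hθ =>
      (abs_le_of_sq_le_sq' (hmax θ hθ) hpos.le).2

/-! ### The uniform bound for Jacobi polynomials -/

/-- The weight `√(ρ/ρ_c)` in the variable `θ = arccos x`. -/
def angWeight (α β θ : ℝ) : ℝ :=
  √(Real.pi * normConst α β * 2 ^ (α + β + 1)) *
    (Real.sin (θ / 2) ^ (α + 1 / 2) * Real.cos (θ / 2) ^ (β + 1 / 2))

/-- The logarithmic derivative of `angWeight`. -/
def angLog (α β θ : ℝ) : ℝ :=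
  (α + 1 / 2) * Real.cos (θ / 2) / (2 * Real.sin (θ / 2)) -
    (β + 1 / 2) * Real.sin (θ / 2) / (2 * Real.cos (θ / 2))

/-- The potential of the Jacobi equation in Liouville normal form. -/
def angPot (α β ν θ : ℝ) : ℝ :=
  ν ^ 2 - (α ^ 2 - 1 / 4) / 4 / Real.sin (θ / 2) ^ 2 -
    (β ^ 2 - 1 / 4) / 4 / Real.cos (θ / 2) ^ 2

theorem sin_half_pos {θ : ℝ} (hθ : θ ∈ Set.Ioo 0 Real.pi) : 0 < Real.sin (θ / 2) :=
  Real.sin_pos_of_pos_of_lt_pi (by linarith [hθ.1]) (by linarith [hθ.1, hθ.2])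

theorem cos_half_pos {θ : ℝ} (hθ : θ ∈ Set.Ioo 0 Real.pi) : 0 < Real.cos (θ / 2) :=
  Real.cos_pos_of_mem_Ioo ⟨by linarith [hθ.1, hθ.2], by linarith [hθ.2]⟩

theorem cos_eq_half (θ : ℝ) : Real.cos θ = 1 - 2 * Real.sin (θ / 2) ^ 2 := by
  have h := Real.cos_two_mul (θ / 2)
  have h2 := Real.sin_sq_add_cos_sq (θ / 2)
  rw [mul_div_cancel₀ θ two_ne_zero] at h
  linarith

theorem sin_eq_half (θ : ℝ) : Real.sin θ = 2 * Real.sin (θ / 2) * Real.cos (θ / 2) := by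
  have h := Real.sin_two_mul (θ / 2)
  rwa [mul_div_cancel₀ θ two_ne_zero] at h

theorem hasDerivAt_sin_half (θ : ℝ) :
    HasDerivAt (fun θ => Real.sin (θ / 2)) (Real.cos (θ / 2) / 2) θ := by
  refine ((hasDerivAt_id θ).div_const 2).sin.congr_deriv ?_
  simp only [id]; ring

theorem hasDerivAt_cos_half (θ : ℝ) :
    HasDerivAt (fun θ => Real.cos (θ / 2)) (-Real.sin (θ / 2) / 2) θ := by
  refine ((hasDerivAt_id θ).div_const 2).cos.congr_deriv ?_
  simp only [id]; ring

theorem angWeight_sq {α β : ℝ} (hα : -1 / 2 ≤ α) (hβ : -1 / 2 ≤ β) {θ : ℝ}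
    (hθ : θ ∈ Set.Icc 0 Real.pi) : angWeight α β θ ^ 2 = chebRatio α β (Real.cos θ) := by
  have hs : 0 ≤ Real.sin (θ / 2) :=
    Real.sin_nonneg_of_nonneg_of_le_pi (by linarith [hθ.1]) (by linarith [hθ.1, hθ.2])
  have hc : 0 ≤ Real.cos (θ / 2) :=
    Real.cos_nonneg_of_mem_Icc ⟨by linarith [hθ.1, hθ.2], by linarith [hθ.2]⟩
  have hnc := normConst_pos (by linarith : -1 < α) (by linarith : -1 < β)
  have h2 := Real.sin_sq_add_cos_sq (θ / 2)
  have e1 : 1 - Real.cos θ = 2 * Real.sin (θ / 2) ^ 2 := by rw [cos_eq_half]; ring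
  have e2 : 1 + Real.cos θ = 2 * Real.cos (θ / 2) ^ 2 := by rw [cos_eq_half]; linarith
  have e3 : ∀ {y : ℝ} (s : ℝ), 0 ≤ y → (2 * y ^ 2) ^ s = 2 ^ s * (y ^ s) ^ 2 := by
    intro y s hy
    rw [Real.mul_rpow two_pos.le (by positivity), ← Real.rpow_natCast, ← Real.rpow_natCast,
      ← Real.rpow_mul hy, ← Real.rpow_mul hy, mul_comm s]
  have e4 : (2 : ℝ) ^ (α + β + 1) = 2 ^ (α + 1 / 2) * 2 ^ (β + 1 / 2) := by
    rw [← Real.rpow_add two_pos]; congr 1; ring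
  have hpi := Real.pi_pos
  rw [angWeight, chebRatio, e1, e2, e3 _ hs, e3 _ hc, mul_pow, mul_pow, Real.sq_sqrt
    (by positivity), e4]
  ring

theorem continuous_angWeight {α β : ℝ} (hα : -1 / 2 ≤ α) (hβ : -1 / 2 ≤ β) :
    Continuous (angWeight α β) := by
  refine continuous_const.mul (Continuous.mul ?_ ?_)
  · exact (by fun_prop : Continuous fun θ : ℝ => Real.sin (θ / 2)).rpow_const
      fun _ => Or.inr (by linarith)
  · exact (by fun_prop : Continuous fun θ : ℝ => Real.cos (θ / 2)).rpow_const
      fun _ => Or.inr (by linarith)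

theorem hasDerivAt_angWeight (α β : ℝ) {θ : ℝ} (hθ : θ ∈ Set.Ioo 0 Real.pi) :
    HasDerivAt (angWeight α β) (angWeight α β θ * angLog α β θ) θ := by
  have hs := sin_half_pos hθ
  have hc := cos_half_pos hθ
  have d1 := (hasDerivAt_sin_half θ).rpow_const (p := α + 1 / 2) (Or.inl hs.ne')
  have d2 := (hasDerivAt_cos_half θ).rpow_const (p := β + 1 / 2) (Or.inl hc.ne')
  refine ((d1.mul d2).const_mul _).congr_deriv ?_
  rw [angWeight, angLog, Real.rpow_sub_one hs.ne', Real.rpow_sub_one hc.ne']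
  field_simp
  ring

theorem hasDerivAt_angLog (α β : ℝ) {θ : ℝ} (hθ : θ ∈ Set.Ioo 0 Real.pi) :
    HasDerivAt (angLog α β) (-(α + 1 / 2) / (4 * Real.sin (θ / 2) ^ 2) -
      (β + 1 / 2) / (4 * Real.cos (θ / 2) ^ 2)) θ := by
  have hs := (sin_half_pos hθ).ne'
  have hc := (cos_half_pos hθ).ne'
  have h2 := Real.sin_sq_add_cos_sq (θ / 2)
  have d1 := hasDerivAt_sin_half θ
  have d2 := hasDerivAt_cos_half θ
  refine (((d2.const_mul (α + 1 / 2)).div (d1.const_mul 2) (by positivity)).sub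
    ((d1.const_mul (β + 1 / 2)).div (d2.const_mul 2) (by positivity))).congr_deriv ?_
  field_simp
  linear_combination (-4 * (α * 2 + 1) * Real.cos (θ / 2) ^ 2 -
    4 * (β * 2 + 1) * Real.sin (θ / 2) ^ 2) * h2

/-- This is why the weight √(ρ/ρ_c) suits x = cos θ: the identity cancels the first-order term of
the Jacobi equation in Liouville form. -/
theorem two_mul_angLog_mul_sin (α β : ℝ) {θ : ℝ} (hθ : θ ∈ Set.Ioo 0 Real.pi) :
    2 * angLog α β θ * Real.sin θ = (α - β) + (α + β + 1) * Real.cos θ := by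
  have hs := (sin_half_pos hθ).ne'
  have hc := (cos_half_pos hθ).ne'
  have h2 := Real.sin_sq_add_cos_sq (θ / 2)
  rw [angLog, sin_eq_half θ, cos_eq_half θ]
  field_simp
  linear_combination (2 * α + 1) * h2

/-- The potential through the logarithmic derivative of the weight. -/
theorem angLog_sq_add_angPot (α β ν : ℝ) {θ : ℝ} (hθ : θ ∈ Set.Ioo 0 Real.pi) :
    angLog α β θ ^ 2 + angPot α β ν θ = ν ^ 2 - (α + β + 1) ^ 2 / 4 +
      (α + 1 / 2) / (4 * Real.sin (θ / 2) ^ 2) + (β + 1 / 2) / (4 * Real.cos (θ / 2) ^ 2) := by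
  have hs := (sin_half_pos hθ).ne'
  have hc := (cos_half_pos hθ).ne'
  have h2 := Real.sin_sq_add_cos_sq (θ / 2)
  have e : angLog α β θ ^ 2 = (α + 1 / 2) ^ 2 * Real.cos (θ / 2) ^ 2 / (4 * Real.sin (θ / 2) ^ 2) -
      (α + 1 / 2) * (β + 1 / 2) / 2 +
      (β + 1 / 2) ^ 2 * Real.sin (θ / 2) ^ 2 / (4 * Real.cos (θ / 2) ^ 2) := by
    rw [angLog]
    field_simp
    ring
  rw [e, angPot]
  have hS : Real.sin (θ / 2) ^ 2 ≠ 0 := pow_ne_zero 2 hs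
  have hC : Real.cos (θ / 2) ^ 2 ≠ 0 := pow_ne_zero 2 hc
  generalize Real.sin (θ / 2) ^ 2 = Y at *
  obtain rfl : Y = 1 - Real.cos (θ / 2) ^ 2 := by linarith
  generalize Real.cos (θ / 2) ^ 2 = Z at *
  field_simp
  ring

theorem hasDerivAt_angPot (α β ν : ℝ) {θ : ℝ} (hθ : θ ∈ Set.Ioo 0 Real.pi) :
    HasDerivAt (angPot α β ν)
      ((α ^ 2 - 1 / 4) / 4 * Real.cos (θ / 2) / Real.sin (θ / 2) ^ 3 -
        (β ^ 2 - 1 / 4) / 4 * Real.sin (θ / 2) / Real.cos (θ / 2) ^ 3) θ := by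
  have hs := (sin_half_pos hθ).ne'
  have hc := (cos_half_pos hθ).ne'
  have d1 := (hasDerivAt_sin_half θ).pow 2
  have d2 := (hasDerivAt_cos_half θ).pow 2
  have := (((hasDerivAt_const θ ((α ^ 2 - 1 / 4) / 4)).div d1 (by simpa using hs)).const_sub
    (ν ^ 2)).sub ((hasDerivAt_const θ ((β ^ 2 - 1 / 4) / 4)).div d2 (by simpa using hc))
  refine this.congr_deriv ?_
  simp only [Pi.pow_apply]
  field_simp
  push_cast
  ring

/-- `√(ρ/ρ_c) p` in the variable `θ = arccos x`. -/
def angFun (α β : ℝ) (p : ℝ[X]) (θ : ℝ) : ℝ := angWeight α β θ * p.eval (Real.cos θ)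

/-- The derivative of `angFun`. -/
def angFun' (α β : ℝ) (p : ℝ[X]) (θ : ℝ) : ℝ :=
  angWeight α β θ * (angLog α β θ * p.eval (Real.cos θ) -
    Real.sin θ * (derivative p).eval (Real.cos θ))

theorem hasDerivAt_eval_cos (p : ℝ[X]) (θ : ℝ) :
    HasDerivAt (fun θ => p.eval (Real.cos θ)) (-Real.sin θ * (derivative p).eval (Real.cos θ)) θ :=
  ((p.hasDerivAt (Real.cos θ)).comp θ (Real.hasDerivAt_cos θ)).congr_deriv (by ring)

theorem hasDerivAt_angFun (α β : ℝ) (p : ℝ[X]) {θ : ℝ} (hθ : θ ∈ Set.Ioo 0 Real.pi) :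
    HasDerivAt (angFun α β p) (angFun' α β p θ) θ := by
  refine ((hasDerivAt_angWeight α β hθ).mul (hasDerivAt_eval_cos p θ)).congr_deriv ?_
  rw [angFun']
  ring

theorem IsJacobiBasis.hasDerivAt_angFun' {α β : ℝ} {p : ℕ → ℝ[X]} (h : IsJacobiBasis α β p)
    (hα : -1 < α) (hβ : -1 < β) (n : ℕ) {θ : ℝ} (hθ : θ ∈ Set.Ioo 0 Real.pi) :
    HasDerivAt (angFun' α β (p n))
      (-angPot α β (n + (α + β + 1) / 2) θ * angFun α β (p n) θ) θ := by
  have hs := (sin_half_pos hθ).ne'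
  have hc := (cos_half_pos hθ).ne'
  have h2 := Real.sin_sq_add_cos_sq (θ / 2)
  have hode := congrArg (eval (Real.cos θ)) (h.jOp_eq hα hβ n)
  simp only [jOp, eval_add, eval_mul, eval_sub, eval_one, eval_pow, eval_X, eval_C,
    eval_neg] at hode
  have := (hasDerivAt_angWeight α β hθ).mul
    (((hasDerivAt_angLog α β hθ).mul (hasDerivAt_eval_cos (p n) θ)).sub
      ((Real.hasDerivAt_sin θ).mul (hasDerivAt_eval_cos (derivative (p n)) θ)))
  refine this.congr_deriv ?_
  simp only [Pi.mul_apply, Pi.sub_apply]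
  rw [angFun]
  set g := angWeight α β θ
  set y := (p n).eval (Real.cos θ)
  set y' := (derivative (p n)).eval (Real.cos θ)
  set y'' := (derivative (derivative (p n))).eval (Real.cos θ)
  have hk := two_mul_angLog_mul_sin α β hθ
  have hsin : Real.sin θ ^ 2 = 1 - Real.cos θ ^ 2 := by
    linarith [Real.sin_sq_add_cos_sq θ]
  have hq : angLog α β θ ^ 2 + (-(α + 1 / 2) / (4 * Real.sin (θ / 2) ^ 2) -
      (β + 1 / 2) / (4 * Real.cos (θ / 2) ^ 2)) - n * (n + α + β + 1) =
      -angPot α β (n + (α + β + 1) / 2) θ := by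
    have := angLog_sq_add_angPot α β (n + (α + β + 1) / 2) hθ
    linear_combination this
  rw [← hq]
  linear_combination g * hode - g * y' * hk + g * y'' * hsin

/-- The reproducing kernel as an energy of `angFun`. -/
theorem IsJacobiBasis.energy_eq {α β : ℝ} {p : ℕ → ℝ[X]} (h : IsJacobiBasis α β p)
    (hα : -1 < α) (hβ : -1 < β) (n : ℕ) {θ : ℝ} (hθ : θ ∈ Set.Ioo 0 Real.pi) :
    Real.sin θ * (angFun' α β (p (n + 1)) θ ^ 2 +
      (angPot α β (n + 1 + (α + β + 1) / 2) θ - (n + 1 + (α + β + 1) / 2)) *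
        angFun α β (p (n + 1)) θ ^ 2) -
      Real.cos θ * (angFun α β (p (n + 1)) θ * angFun' α β (p (n + 1)) θ) =
    Real.sin θ * ((2 * (n + 1 + (α + β + 1) / 2)) * (angWeight α β θ ^ 2 *
      ∑ k ∈ Finset.range (n + 1), (p k).eval (Real.cos θ) ^ 2)) := by
  have hs := (sin_half_pos hθ).ne'
  have hc := (cos_half_pos hθ).ne'
  have h2 := Real.sin_sq_add_cos_sq (θ / 2)
  have hker := congrArg (eval (Real.cos θ)) (h.kernel_eq hα hβ n)
  simp only [eval_add, eval_mul, eval_sub, eval_one, eval_pow, eval_X, eval_C,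
    eval_finsetSum] at hker
  rw [angFun, angFun']
  set g := angWeight α β θ
  set y := (p (n + 1)).eval (Real.cos θ)
  set y' := (derivative (p (n + 1))).eval (Real.cos θ)
  set K := ∑ k ∈ Finset.range (n + 1), (p k).eval (Real.cos θ) ^ 2
  have hk := two_mul_angLog_mul_sin α β hθ
  have hsin : Real.sin θ ^ 2 = 1 - Real.cos θ ^ 2 := by
    linarith [Real.sin_sq_add_cos_sq θ]
  have hq : Real.sin θ * (angLog α β θ ^ 2 + angPot α β (n + 1 + (α + β + 1) / 2) θ -
      (n + 1 + (α + β + 1) / 2)) - Real.cos θ * angLog α β θ =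
      Real.sin θ * ((n + 1) * (n + 1 + α + β)) := by
    refine mul_left_cancel₀ (Real.sin_pos_of_mem_Ioo hθ).ne' ?_
    have e1 := angLog_sq_add_angPot α β (n + 1 + (α + β + 1) / 2) hθ
    rw [e1, mul_sub, mul_left_comm _ (Real.cos θ),
      show Real.sin θ * angLog α β θ = ((α - β) + (α + β + 1) * Real.cos θ) / 2 by linarith,
      ← mul_assoc, ← mul_assoc, ← sq, sin_eq_half θ, cos_eq_half θ, mul_pow, mul_pow]
    have hS : Real.sin (θ / 2) ^ 2 ≠ 0 := pow_ne_zero 2 hs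
    have hC : Real.cos (θ / 2) ^ 2 ≠ 0 := pow_ne_zero 2 hc
    generalize Real.sin (θ / 2) ^ 2 = Y at *
    obtain rfl : Y = 1 - Real.cos (θ / 2) ^ 2 := by linarith
    generalize Real.cos (θ / 2) ^ 2 = Z at *
    field_simp
    ring
  -- Both sides are quadratic forms in y and y': `hq` matches the coefficients of y², `hk` those of
  -- yy', and `hsin` those of y'².
  linear_combination g ^ 2 * y ^ 2 * hq - g ^ 2 * Real.sin θ * hker -
    g ^ 2 * Real.sin θ * y * y' * hk + g ^ 2 * Real.sin θ * y' ^ 2 * hsin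

/-- If q(2 + A) < ν², most of ν² must be consumed by X = a/S². Since a ≤ A²/4 ≤ ν²/16, this makes S
small and the slope L at least of order X/S. Eliminating S through X S² = a gives L²a ≥ (5/6)D³,
where D is comparable to q(1 + A), too large for q³ ≥ 4L²/9. -/
theorem potential_slope_bound {A ν a b b' q S Co : ℝ} (hA : 0 ≤ A) (hν : 7 / 2 + 2 * A < ν)
    (ha : 0 < a) (hb : b ≤ b') (hb' : 0 ≤ b') (hab : 4 * (a + b') ≤ A ^ 2) (hS : 0 < S)
    (hC : 0 < Co) (hSC : S ^ 2 + Co ^ 2 = 1) (hS2 : S ^ 2 ≤ 1 / 2)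
    (hq : q = ν ^ 2 - a / S ^ 2 - b / Co ^ 2) (hqν : q * (2 + A) < ν ^ 2) :
    0 < a * Co / S ^ 3 - b' * S / Co ^ 3 ∧
      q ^ 3 < 4 / 9 * (a * Co / S ^ 3 - b' * S / Co ^ 3) ^ 2 := by
  have hV : 4 * A ^ 2 ≤ ν ^ 2 := by
    calc 4 * A ^ 2 = (2 * A) ^ 2 := by ring
      _ ≤ ν ^ 2 := by gcongr; linarith
  have hV0 : 0 < ν ^ 2 := by have : 0 < ν := by linarith
                             positivity
  have hq2 : q ≤ ν ^ 2 / 2 := by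
    rcases le_total q 0 with h | h
    · linarith
    · linarith [mul_nonneg h hA]
  set X := a / S ^ 2 with hX
  have hXa : X * S ^ 2 = a := by rw [hX]; field_simp
  have hC2 : 1 / 2 ≤ Co ^ 2 := by linarith
  have hbC : b / Co ^ 2 ≤ b' / Co ^ 2 := by gcongr
  have hbC2 : b' / Co ^ 2 ≤ 2 * b' := by
    rw [div_le_iff₀ (by positivity)]
    linarith [mul_le_mul_of_nonneg_left hC2 hb']
  have hX1 : 3 / 8 * ν ^ 2 ≤ X := by linarith
  have hy : S ^ 2 ≤ 1 / 6 := by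
    by_contra hcon
    push Not at hcon
    have := mul_lt_mul_of_pos_left hcon (show 0 < X by linarith)
    linarith
  have hC56 : 5 / 6 ≤ Co ^ 2 := by linarith
  have hbC4 : b' / Co ^ 4 ≤ 9 / 100 * ν ^ 2 := by
    rw [div_le_iff₀ (by positivity)]
    have : 25 / 36 ≤ Co ^ 4 := by
      calc (25 / 36 : ℝ) = (5 / 6) ^ 2 := by norm_num
        _ ≤ (Co ^ 2) ^ 2 := by gcongr
        _ = Co ^ 4 := by ring
    linarith [mul_le_mul_of_nonneg_left this hV0.le]
  -- 91/100 is what remains of ν² after `hbC4`: b/Co² and the correction b'S²/Co⁴ to the slope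
  -- together cost at most b'/Co⁴.
  set D := 91 / 100 * ν ^ 2 - q with hD
  have hD0 : 0 < D := by rw [hD]; linarith
  have hsplit : b' / Co ^ 2 + b' * S ^ 2 / Co ^ 4 = b' / Co ^ 4 := by
    have : S ^ 2 = 1 - Co ^ 2 := by linarith
    rw [this]; field_simp; ring
  have hX2 : D ≤ X - b' * S ^ 2 / Co ^ 4 := by rw [hD]; linarith
  have hX3 : D ≤ X := by
    have : 0 ≤ b' * S ^ 2 / Co ^ 4 := by positivity
    linarith
  set L := a * Co / S ^ 3 - b' * S / Co ^ 3 with hL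
  have hLS : L * S = Co * (X - b' * S ^ 2 / Co ^ 4) := by
    rw [hL, hX]; field_simp
  have hLS2 : Co * D ≤ L * S := by rw [hLS]; gcongr
  have hL0 : 0 < L := by
    have : 0 < L * S := (mul_pos hC hD0).trans_le hLS2
    exact pos_of_mul_pos_left this hS.le
  refine ⟨hL0, ?_⟩
  have h1 : (Co * D) ^ 2 ≤ (L * S) ^ 2 := by gcongr
  have h2 : 5 / 6 * D ^ 3 ≤ L ^ 2 * a := by
    calc 5 / 6 * D ^ 3 = 5 / 6 * D ^ 2 * D := by ring
      _ ≤ Co ^ 2 * D ^ 2 * X := by gcongr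
      _ = (Co * D) ^ 2 * X := by ring
      _ ≤ (L * S) ^ 2 * X := by gcongr
      _ = L ^ 2 * (X * S ^ 2) := by ring
      _ = L ^ 2 * a := by rw [hXa]
  have h3 : L ^ 2 * a ≤ L ^ 2 * (A ^ 2 / 4) := by gcongr; linarith
  by_contra hcon
  push Not at hcon
  have hq0 : 0 < q := by
    by_contra hneg
    have : q ^ 3 ≤ 0 := by
      rw [show q ^ 3 = q * q ^ 2 by ring]
      exact mul_nonpos_of_nonpos_of_nonneg (not_lt.1 hneg) (sq_nonneg q)
    linarith [pow_pos hL0 2]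
  have h4 : q * (82 / 100 + 91 / 100 * A) ≤ D := by rw [hD]; linarith
  have h5 : (q * (82 / 100 + 91 / 100 * A)) ^ 3 ≤ D ^ 3 := by gcongr
  have h6 : 10 / 27 * (q * (82 / 100 + 91 / 100 * A)) ^ 3 ≤ q ^ 3 * (A ^ 2 / 4) := by
    have : 4 / 9 * L ^ 2 * (A ^ 2 / 4) ≤ q ^ 3 * (A ^ 2 / 4) := by gcongr
    linarith
  have hq3 : 0 < q ^ 3 := by positivity
  have h7 : 10 / 27 * (82 / 100 + 91 / 100 * A) ^ 3 ≤ A ^ 2 / 4 := by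
    refine le_of_mul_le_mul_left ?_ hq3
    rw [mul_pow] at h6
    linarith
  -- After the factor 10/27 the A² term of the cubic alone dominates A²/4, and the constant term is
  -- positive.
  have h8 : (82 / 100 + 91 / 100 * A) ^ 3 = (82 / 100) ^ 3 + 3 * (82 / 100) ^ 2 * (91 / 100) * A +
      3 * (82 / 100) * (91 / 100) ^ 2 * A ^ 2 + (91 / 100) ^ 3 * A ^ 3 := by ring
  rw [h8] at h7
  linarith [pow_nonneg hA 3, pow_nonneg hA 2]

theorem normConst_comm (α β : ℝ) : normConst β α = normConst α β := by
  rw [normConst, normConst, add_comm β α, mul_comm (Real.Gamma (α + 1))]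

theorem chebRatio_neg (α β x : ℝ) : chebRatio β α (-x) = chebRatio α β x := by
  rw [chebRatio, chebRatio, normConst_comm, sub_neg_eq_add, ← sub_eq_add_neg,
    mul_comm ((1 + x) ^ _)]

/-- Reflection exchanges the two parameters. -/
theorem IsJacobiBasis.comp_neg {α β : ℝ} {p : ℕ → ℝ[X]} (h : IsJacobiBasis α β p) :
    IsJacobiBasis β α (fun n => (p n).comp (-X)) := by
  refine ⟨fun n => ?_, fun n m => ?_⟩
  · have hne : (p n).comp (-X) ≠ 0 := by
      intro h0
      have := h.degree_eq n
      rw [comp_neg_X_eq_zero_iff.1 h0] at this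
      simp at this
    rw [degree_eq_natDegree hne, natDegree_comp, natDegree_neg, natDegree_X, mul_one,
      natDegree_eq_of_degree_eq_some (h.degree_eq n)]
  · rw [← h.orthonormal n m]
    have := intervalIntegral.integral_comp_neg (a := (-1 : ℝ)) (b := 1)
      (fun x => (p n).eval x * (p m).eval x * density α β x)
    rw [neg_neg] at this
    rw [← this]
    refine intervalIntegral.integral_congr fun x _ => ?_
    simp only [eval_comp, eval_neg, eval_X, density]
    rw [normConst_comm, sub_neg_eq_add, ← sub_eq_add_neg]
    ring

/-- Adding 2νu² to the energy identity completes the kernel to degree n + 1, which the Christoffel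
bound controls. The u'² term and the cosine term have favourable signs and are dropped. -/
theorem IsJacobiBasis.angFun_sq_mul_le {α β : ℝ} {p : ℕ → ℝ[X]} (h : IsJacobiBasis α β p)
    (hα : -1 / 2 ≤ α) (hβ : -1 / 2 ≤ β) (n : ℕ) {ν : ℝ} (hν : ν = n + 1 + (α + β + 1) / 2) {θ : ℝ}
    (hθ : θ ∈ Set.Ioo 0 Real.pi)
    (hle : Real.cos θ * (angFun α β (p (n + 1)) θ * angFun' α β (p (n + 1)) θ) ≤ 0) :
    (angPot α β ν θ + ν) * angFun α β (p (n + 1)) θ ^ 2 ≤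
      2 * ν * (Real.exp 1 * (ν + 1 / 2)) := by
  have hE := h.energy_eq (by linarith) (by linarith) n hθ
  rw [← hν] at hE
  have hI : θ ∈ Set.Icc 0 Real.pi := Set.Ioo_subset_Icc_self hθ
  have hker := h.chebRatio_mul_kernel_le hα hβ (n + 1) (x := Real.cos θ)
    ⟨Real.neg_one_le_cos θ, Real.cos_le_one θ⟩
  rw [← angWeight_sq hα hβ hI, Finset.sum_range_succ] at hker
  have hsin := Real.sin_pos_of_mem_Ioo hθ
  have hn : (0 : ℝ) ≤ n := n.cast_nonneg
  have hν0 : 0 < ν := by rw [hν]; linarith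
  have hu : angFun α β (p (n + 1)) θ ^ 2 =
    angWeight α β θ ^ 2 * (p (n + 1)).eval (Real.cos θ) ^ 2 := by rw [angFun, mul_pow]
  push_cast at hker
  have hker' : angWeight α β θ ^ 2 * ∑ k ∈ Finset.range (n + 1), (p k).eval (Real.cos θ) ^ 2 +
      angFun α β (p (n + 1)) θ ^ 2 ≤ Real.exp 1 * (ν + 1 / 2) := by
    rw [hu, ← mul_add]
    refine hker.trans_eq ?_
    rw [hν]; ring
  have h2 := mul_le_mul_of_nonneg_left hker' (by positivity : 0 ≤ 2 * ν)
  have h3 : Real.sin θ * ((angPot α β ν θ - ν) * angFun α β (p (n + 1)) θ ^ 2) ≤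
      Real.sin θ * (2 * ν * (angWeight α β θ ^ 2 *
        ∑ k ∈ Finset.range (n + 1), (p k).eval (Real.cos θ) ^ 2)) := by
    rw [← hE]
    nlinarith [mul_nonneg hsin.le (sq_nonneg (angFun' α β (p (n + 1)) θ))]
  have h4 := le_of_mul_le_mul_left h3 hsin
  linarith

/-- The kernel is nonnegative, so under this sign condition the energy identity gives u'² + (q -
ν)u² ≥ 0. It supplies hypothesis `hen` of `cube_lower_bound`. -/
theorem IsJacobiBasis.energy_nonneg {α β : ℝ} {p : ℕ → ℝ[X]} (h : IsJacobiBasis α β p)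
    (hα : -1 / 2 ≤ α) (hβ : -1 / 2 ≤ β) (n : ℕ) {ν : ℝ} (hν : ν = n + 1 + (α + β + 1) / 2) {θ : ℝ}
    (hθ : θ ∈ Set.Ioo 0 Real.pi)
    (hle : 0 ≤ Real.cos θ * (angFun α β (p (n + 1)) θ * angFun' α β (p (n + 1)) θ)) :
    0 ≤ angFun' α β (p (n + 1)) θ ^ 2 + angPot α β ν θ * angFun α β (p (n + 1)) θ ^ 2 := by
  have hE := h.energy_eq (by linarith) (by linarith) n hθ
  rw [← hν] at hE
  have hsin := Real.sin_pos_of_mem_Ioo hθ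
  have hn : (0 : ℝ) ≤ n := n.cast_nonneg
  have hν0 : 0 < ν := by rw [hν]; linarith
  have hK : 0 ≤ Real.sin θ * (2 * ν * (angWeight α β θ ^ 2 *
      ∑ k ∈ Finset.range (n + 1), (p k).eval (Real.cos θ) ^ 2)) := by
    have : 0 ≤ ∑ k ∈ Finset.range (n + 1), (p k).eval (Real.cos θ) ^ 2 :=
      Finset.sum_nonneg fun k _ => sq_nonneg _
    positivity
  have h1 : 0 ≤ Real.sin θ * (angFun' α β (p (n + 1)) θ ^ 2 +
      (angPot α β ν θ - ν) * angFun α β (p (n + 1)) θ ^ 2) := by linarith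
  have h2 := nonneg_of_mul_nonneg_right h1 hsin
  nlinarith [mul_nonneg hν0.le (sq_nonneg (angFun α β (p (n + 1)) θ))]

theorem half_angle_bounds {θ : ℝ} (h0 : 0 ≤ θ) (h1 : θ ≤ Real.pi / 2) :
    Real.sin (θ / 2) ^ 2 ≤ 1 / 2 := by
  have := cos_eq_half θ
  have := Real.cos_nonneg_of_mem_Icc (x := θ) ⟨by linarith [Real.pi_pos], h1⟩
  linarith

/-- Here cos/sin³ of the half angle decreases and sin/cos³ increases; with a nonnegative majorant b'
the slope is therefore bounded below by its value at T. -/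
theorem slope_le {a b b' θ T : ℝ} (ha : 0 ≤ a) (hb : b ≤ b') (hb' : 0 ≤ b') (hθ : 0 < θ)
    (hθT : θ ≤ T) (hT : T < Real.pi) :
    a * Real.cos (T / 2) / Real.sin (T / 2) ^ 3 - b' * Real.sin (T / 2) / Real.cos (T / 2) ^ 3 ≤
      a * Real.cos (θ / 2) / Real.sin (θ / 2) ^ 3 - b * Real.sin (θ / 2) / Real.cos (θ / 2) ^ 3 := by
  have hS := sin_half_pos ⟨hθ, hθT.trans_lt hT⟩
  have hC := cos_half_pos ⟨hθ, hθT.trans_lt hT⟩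
  have hST := sin_half_pos ⟨hθ.trans_le hθT, hT⟩
  have hCT := cos_half_pos ⟨hθ.trans_le hθT, hT⟩
  have hSle : Real.sin (θ / 2) ≤ Real.sin (T / 2) :=
    Real.sin_le_sin_of_le_of_le_pi_div_two (by linarith) (by linarith) (by linarith)
  have hCle : Real.cos (T / 2) ≤ Real.cos (θ / 2) :=
    Real.cos_le_cos_of_nonneg_of_le_pi (by linarith) (by linarith) (by linarith)
  have t1 : a * Real.cos (T / 2) / Real.sin (T / 2) ^ 3 ≤
      a * Real.cos (θ / 2) / Real.sin (θ / 2) ^ 3 := by gcongr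
  have t2 : b * Real.sin (θ / 2) / Real.cos (θ / 2) ^ 3 ≤
      b' * Real.sin (T / 2) / Real.cos (T / 2) ^ 3 := by
    calc _ ≤ b' * Real.sin (θ / 2) / Real.cos (θ / 2) ^ 3 := by gcongr
      _ ≤ _ := by gcongr
  linarith

/-- The potential is large away from the left endpoint unless the first parameter is. -/
theorem angPot_ge {α β ν θ : ℝ} (ha : α ^ 2 - 1 / 4 ≤ 0) (hν : 4 * (α ^ 2 + β ^ 2) ≤ ν ^ 2)
    (hθ : θ ∈ Set.Ioc 0 (Real.pi / 2)) : 7 / 8 * ν ^ 2 ≤ angPot α β ν θ := by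
  have hθ' : θ ∈ Set.Ioo 0 Real.pi := ⟨hθ.1, by linarith [hθ.2, Real.pi_pos]⟩
  have hs := sin_half_pos hθ'
  have hc := cos_half_pos hθ'
  have h2 := Real.sin_sq_add_cos_sq (θ / 2)
  have hs2 := half_angle_bounds hθ.1.le hθ.2
  have t1 : (α ^ 2 - 1 / 4) / 4 / Real.sin (θ / 2) ^ 2 ≤ 0 :=
    div_nonpos_of_nonpos_of_nonneg (by linarith) (by positivity)
  have t2 : (β ^ 2 - 1 / 4) / 4 / Real.cos (θ / 2) ^ 2 ≤ β ^ 2 / 2 := by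
    rw [div_le_iff₀ (by positivity)]
    nlinarith [sq_nonneg β]
  rw [angPot]
  linarith [sq_nonneg α]

/-- The bound at a maximum in the right half of the interval, for large degree. -/
theorem IsJacobiBasis.angFun_sq_le_of_isMax {α β : ℝ} {p : ℕ → ℝ[X]} (h : IsJacobiBasis α β p)
    (hα : -1 / 2 ≤ α) (hβ : -1 / 2 ≤ β) (n : ℕ)
    (hlarge : 7 / 2 + 2 * √(α ^ 2 + β ^ 2) < n + 1 + (α + β + 1) / 2) {T : ℝ}
    (hT0 : 0 ≤ T) (hT1 : T ≤ Real.pi / 2)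
    (hmax : ∀ θ ∈ Set.Icc 0 Real.pi, angFun α β (p (n + 1)) θ ^ 2 ≤ angFun α β (p (n + 1)) T ^ 2) :
    angFun α β (p (n + 1)) T ^ 2 ≤ 2 * Real.exp 1 * (2 + √(α ^ 2 + β ^ 2)) := by
  have hA2 := Real.sq_sqrt (by positivity : 0 ≤ α ^ 2 + β ^ 2)
  have hA0 := Real.sqrt_nonneg (α ^ 2 + β ^ 2)
  set A := √(α ^ 2 + β ^ 2)
  obtain ⟨ν, hν⟩ : ∃ ν : ℝ, ν = n + 1 + (α + β + 1) / 2 := ⟨_, rfl⟩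
  rw [← hν] at hlarge
  have hν0 : 0 < ν := by linarith
  have hpi := Real.pi_pos
  have he := Real.exp_pos 1
  set u := angFun α β (p (n + 1)) with hu
  set u' := angFun' α β (p (n + 1)) with hu'
  set q := angPot α β ν with hq
  have hcont : Continuous u :=
    (continuous_angWeight hα hβ).mul ((p (n + 1)).continuous.comp Real.continuous_cos)
  have hd : ∀ θ ∈ Set.Ioo 0 Real.pi, HasDerivAt u (u' θ) θ :=
    fun θ hθ => hasDerivAt_angFun α β (p (n + 1)) hθ
  have hν4 : 4 * (α ^ 2 + β ^ 2) ≤ ν ^ 2 := by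
    rw [← hA2]
    calc 4 * A ^ 2 = (2 * A) ^ 2 := by ring
      _ ≤ ν ^ 2 := by gcongr; linarith
  have hqlow : α ^ 2 - 1 / 4 ≤ 0 → ∀ θ ∈ Set.Ioc 0 (Real.pi / 2), 7 / 8 * ν ^ 2 ≤ q θ := by
    exact fun ha θ hθ => angPot_ge ha hν4 hθ
  by_contra hbig
  push Not at hbig
  -- Such a point would require (7ν/8 + 1)(2 + A) ≤ ν + 1/2, which fails already for A = 0.
  have hcontra : ∀ θ, 7 / 8 * ν ^ 2 ≤ q θ → 2 * Real.exp 1 * (2 + A) < u θ ^ 2 →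
      (q θ + ν) * u θ ^ 2 ≤ 2 * ν * (Real.exp 1 * (ν + 1 / 2)) → False := by
    intro θ h1 h2 h3
    have h4 : (7 / 8 * ν ^ 2 + ν) * (2 * Real.exp 1 * (2 + A)) ≤
        2 * ν * (Real.exp 1 * (ν + 1 / 2)) := by
      refine le_trans ?_ h3
      have : 0 ≤ q θ + ν := by linarith [sq_nonneg ν]
      gcongr
    have h5 : (2 * Real.exp 1 * ν) * ((7 / 8 * ν + 1) * (2 + A)) ≤
        (2 * Real.exp 1 * ν) * (ν + 1 / 2) := by linarith
    have h6 := le_of_mul_le_mul_left h5 (by positivity)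
    nlinarith
  rcases hT0.eq_or_lt with rfl | hTpos
  · -- maximum at the endpoint
    have hα0 : α = -1 / 2 := by
      by_contra hne
      have : u 0 = 0 := by
        simp only [hu, angFun, angWeight, zero_div, Real.sin_zero]
        rw [Real.zero_rpow (fun h0 => hne (by linarith))]
        simp
      rw [this] at hbig
      have : 0 < 2 * Real.exp 1 * (2 + A) := by positivity
      nlinarith
    -- The derivative formulas hold only inside the interval. The mean value theorem supplies a
    -- nearby η with uu' ≤ 0, and continuity keeps u(η)² above the bound.
    have hev : ∀ᶠ θ in nhds (0 : ℝ), 2 * Real.exp 1 * (2 + A) < u θ ^ 2 :=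
      (hcont.pow 2).continuousAt.eventually (lt_mem_nhds hbig)
    obtain ⟨ε, hε, hball⟩ := Metric.eventually_nhds_iff.1 hev
    set δ := min (ε / 2) (Real.pi / 2) with hδ
    have hδ0 : 0 < δ := lt_min (by linarith) (by linarith)
    obtain ⟨η, hη, hη'⟩ := exists_hasDerivAt_eq_slope (fun θ => u θ ^ 2)
      (fun θ => 2 * (u θ * u' θ)) hδ0 (hcont.pow 2).continuousOn (by
        intro x hx
        have : x < Real.pi := by linarith [hx.2, min_le_right (ε / 2) (Real.pi / 2)]
        refine ((hd x ⟨hx.1, this⟩).pow 2).congr_deriv ?_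
        push_cast
        ring)
    have hηδ : η < ε := by linarith [hη.2, min_le_left (ε / 2) (Real.pi / 2)]
    have hηpi : η ≤ Real.pi / 2 := hη.2.le.trans (min_le_right _ _)
    have hδpi : δ ≤ Real.pi := by linarith [min_le_right (ε / 2) (Real.pi / 2)]
    have hneg : u η * u' η ≤ 0 := by
      have : (u δ ^ 2 - u 0 ^ 2) / (δ - 0) ≤ 0 :=
        div_nonpos_of_nonpos_of_nonneg (by linarith [hmax δ ⟨hδ0.le, hδpi⟩]) (by linarith)
      linarith
    have hcos : 0 ≤ Real.cos η := Real.cos_nonneg_of_mem_Icc ⟨by linarith [hη.1], hηpi⟩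
    refine hcontra η (hqlow (by rw [hα0]; norm_num) η ⟨hη.1, hηpi⟩)
      (hball (by rw [Real.dist_eq, sub_zero, abs_of_pos hη.1]; exact hηδ)) ?_
    exact h.angFun_sq_mul_le hα hβ n hν ⟨hη.1, by linarith⟩
      (mul_nonpos_of_nonneg_of_nonpos hcos hneg)
  · have hTpi : T ∈ Set.Ioo 0 Real.pi := ⟨hTpos, by linarith⟩
    have hu2 : 0 < u T ^ 2 := lt_trans (by positivity) hbig
    have hne : u T ≠ 0 := by rintro h0; rw [h0] at hu2; norm_num at hu2
    have hcrit : u' T = 0 := by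
      have hloc : IsLocalMax (fun θ => u θ ^ 2) T := by
        filter_upwards [Ioo_mem_nhds hTpi.1 hTpi.2] with θ hθ
        exact hmax θ (Set.Ioo_subset_Icc_self hθ)
      have := hloc.hasDerivAt_eq_zero ((hd T hTpi).pow 2)
      push_cast at this
      simpa [hne] using this
    have hkey := h.angFun_sq_mul_le hα hβ n hν hTpi (by
      rw [← hu', hcrit, mul_zero, mul_zero])
    rw [← hu, ← hq] at hkey
    have hmem : ∀ θ ∈ Set.Ioc 0 T, θ ∈ Set.Ioo 0 Real.pi :=
      fun θ hθ => ⟨hθ.1, by linarith [hθ.2]⟩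
    by_cases ha : α ^ 2 - 1 / 4 ≤ 0
    · exact hcontra T (hqlow ha T ⟨hTpos, hT1⟩) hbig hkey
    push Not at ha
    have hα1 : α ≠ -1 / 2 := by rintro rfl; norm_num at ha
    have hqν : q T * (2 + A) < ν ^ 2 := by
      rcases le_or_gt (q T + ν) 0 with h0 | h0
      · nlinarith
      · have h4 : (q T + ν) * (2 * Real.exp 1 * (2 + A)) ≤
            2 * ν * (Real.exp 1 * (ν + 1 / 2)) := by
          refine le_trans ?_ hkey
          gcongr
        have h5 : (2 * Real.exp 1) * ((q T + ν) * (2 + A)) ≤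
            (2 * Real.exp 1) * (ν * (ν + 1 / 2)) := by linarith
        have h6 := le_of_mul_le_mul_left h5 (by positivity)
        nlinarith
    set a := (α ^ 2 - 1 / 4) / 4 with hadef
    set b := (β ^ 2 - 1 / 4) / 4 with hbdef
    have ha0 : 0 < a := by rw [hadef]; linarith
    -- b is negative when |β| < 1/2; its positive part keeps the slope estimate monotone, and 4(a +
    -- max b 0) ≤ A² still holds.
    have hb' : b ≤ max b 0 := le_max_left _ _
    have hb0 : 0 ≤ max b 0 := le_max_right _ _
    have hab : 4 * (a + max b 0) ≤ A ^ 2 := by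
      rcases max_cases b 0 with ⟨e, _⟩ | ⟨e, _⟩ <;> rw [e, hA2, hadef]
      · rw [hbdef]; linarith
      · nlinarith [sq_nonneg β]
    have hST := sin_half_pos hTpi
    have hCT := cos_half_pos hTpi
    obtain ⟨hL0, hLq⟩ := potential_slope_bound hA0 hlarge ha0 hb' hb0 hab hST hCT
      (Real.sin_sq_add_cos_sq (T / 2)) (half_angle_bounds hT0 hT1) (q := q T) rfl hqν
    refine absurd ?_ (not_le.2 hLq)
    refine cube_lower_bound (u := u) (u' := u') (q := q) hTpos ?_ hcont.continuousOn
      (fun θ hθ => hd θ (hmem θ hθ)) (fun θ hθ => ?_)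
      (fun θ hθ => hasDerivAt_angPot α β ν (hmem θ hθ)) hL0 (fun θ hθ => ?_) (fun θ hθ hpos => ?_)
      hcrit hne (fun θ hθ => hmax θ ⟨hθ.1, by linarith [hθ.2]⟩)
    · simp only [hu, angFun, angWeight, zero_div, Real.sin_zero]
      rw [Real.zero_rpow (fun h0 => hα1 (by linarith))]
      simp
    · have := h.hasDerivAt_angFun' (by linarith) (by linarith) (n + 1) (hmem θ hθ)
      rw [Nat.cast_add, Nat.cast_one, ← hν] at this
      exact this
    · exact slope_le ha0.le hb' hb0 hθ.1 hθ.2 (by linarith)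
    · refine h.energy_nonneg hα hβ n hν (hmem θ hθ) (mul_nonneg ?_ hpos)
      exact Real.cos_nonneg_of_mem_Icc ⟨by linarith [hθ.1], by linarith [hθ.2]⟩

/-- The uniform bound for orthonormal Jacobi polynomials. -/
theorem IsJacobiBasis.chebRatio_mul_sq_le {α β : ℝ} {p : ℕ → ℝ[X]} (h : IsJacobiBasis α β p)
    (hα : -1 / 2 ≤ α) (hβ : -1 / 2 ≤ β) (n : ℕ) {x : ℝ} (hx : x ∈ Set.Icc (-1 : ℝ) 1) :
    chebRatio α β x * (p n).eval x ^ 2 ≤ 2 * Real.exp 1 * (2 + √(α ^ 2 + β ^ 2)) := by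
  have he := Real.exp_pos 1
  -- The threshold is where the kernel bound e(ν + 1/2) equals 2e(2 + A).
  by_cases hsmall : n + (α + β + 1) / 2 ≤ 7 / 2 + 2 * √(α ^ 2 + β ^ 2)
  · have hk := h.chebRatio_mul_kernel_le hα hβ n hx
    have hnn : 0 ≤ chebRatio α β x := by
      have h1 : 0 ≤ 1 - x := by linarith [hx.2]
      have h2 : 0 ≤ 1 + x := by linarith [hx.1]
      have := normConst_pos (by linarith : -1 < α) (by linarith : -1 < β)
      have := Real.pi_pos
      unfold chebRatio
      positivity
    have h1 : (p n).eval x ^ 2 ≤ ∑ k ∈ Finset.range (n + 1), (p k).eval x ^ 2 :=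
      Finset.single_le_sum (f := fun k => (p k).eval x ^ 2) (fun k _ => sq_nonneg _)
        (Finset.self_mem_range_succ n)
    refine (mul_le_mul_of_nonneg_left h1 hnn).trans (hk.trans ?_)
    nlinarith
  push Not at hsmall
  obtain ⟨m, rfl⟩ : ∃ m, n = m + 1 := by
    rcases n with _ | m
    -- Degree 0 is never in the large range, because α + β is at most √2 A.
    · exfalso
      have hA2 := Real.sq_sqrt (by positivity : 0 ≤ α ^ 2 + β ^ 2)
      have hA0 := Real.sqrt_nonneg (α ^ 2 + β ^ 2)
      push_cast at hsmall
      nlinarith [sq_nonneg (α - β)]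
    · exact ⟨m, rfl⟩
  push_cast at hsmall
  obtain ⟨T, hT, hTmax⟩ := isCompact_Icc.exists_isMaxOn (s := Set.Icc 0 Real.pi)
    ⟨0, le_rfl, Real.pi_pos.le⟩
    (f := fun θ => angFun α β (p (m + 1)) θ ^ 2) (Continuous.continuousOn (Continuous.pow
      ((continuous_angWeight hα hβ).mul ((p (m + 1)).continuous.comp Real.continuous_cos)) 2))
  have hval : ∀ {α β : ℝ} (_ : -1 / 2 ≤ α) (_ : -1 / 2 ≤ β) (r : ℝ[X]) (θ : ℝ),
      θ ∈ Set.Icc 0 Real.pi → angFun α β r θ ^ 2 =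
        chebRatio α β (Real.cos θ) * r.eval (Real.cos θ) ^ 2 := by
    intro α β hα hβ r θ hθ
    rw [angFun, mul_pow, angWeight_sq hα hβ hθ]
  have hxT : chebRatio α β x * (p (m + 1)).eval x ^ 2 ≤ angFun α β (p (m + 1)) T ^ 2 := by
    have hmem : Real.arccos x ∈ Set.Icc 0 Real.pi := ⟨Real.arccos_nonneg x, Real.arccos_le_pi x⟩
    have := hTmax hmem
    simp only [Set.mem_ofPred_eq] at this
    rwa [hval hα hβ _ _ hmem, Real.cos_arccos hx.1 hx.2] at this
  refine hxT.trans ?_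
  rcases le_total T (Real.pi / 2) with hT1 | hT1
  · exact h.angFun_sq_le_of_isMax hα hβ m hsmall hT.1 hT1 fun θ hθ => hTmax hθ
  -- A maximum in the right half is reflected to the left half by θ ↦ π - θ, which exchanges α and
  -- β.
  · have hrefl : ∀ θ ∈ Set.Icc 0 Real.pi, angFun β α ((p (m + 1)).comp (-X)) (Real.pi - θ) ^ 2 =
        angFun α β (p (m + 1)) θ ^ 2 := by
      intro θ hθ
      rw [hval hβ hα _ _ ⟨by linarith [hθ.2], by linarith [hθ.1]⟩, hval hα hβ _ _ hθ,
        Real.cos_pi_sub, chebRatio_neg, eval_comp]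
      simp
    rw [← hrefl T hT, add_comm (α ^ 2)]
    refine h.comp_neg.angFun_sq_le_of_isMax hβ hα m ?_ (by linarith [hT.2]) (by linarith) ?_
    · rw [add_comm (β ^ 2), add_comm β α]; exact hsmall
    · intro θ hθ
      have h1 : Real.pi - θ ∈ Set.Icc 0 Real.pi := ⟨by linarith [hθ.2], by linarith [hθ.1]⟩
      have := hTmax h1
      simp only [Set.mem_ofPred_eq] at this
      rw [← hrefl _ h1, ← hrefl T hT, sub_sub_cancel] at this
      exact this

/-! ### The constant -/

/-- Below: (a+1)² ≥ a² because a ≥ -1/2. Above: the triangle inequality with the vector (1,1) adds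
at most √2 to the numerator, while the denominator is at least 2. -/
theorem gradRatio_bounds {a b : ℝ} (ha : -1 / 2 ≤ a) (hb : -1 / 2 ≤ b) :
    1 ≤ (2 + √((a + 1) ^ 2 + (b + 1) ^ 2)) / (2 + √(a ^ 2 + b ^ 2)) ∧
      (2 + √((a + 1) ^ 2 + (b + 1) ^ 2)) / (2 + √(a ^ 2 + b ^ 2)) ≤ 1 + √2 / 2 := by
  have h0 := Real.sqrt_nonneg (a ^ 2 + b ^ 2)
  have h2 := Real.sqrt_nonneg 2
  have hs := Real.sq_sqrt (by positivity : 0 ≤ a ^ 2 + b ^ 2)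
  have hs2 := Real.sq_sqrt (by norm_num : (0:ℝ) ≤ 2)
  have hpos : 0 < 2 + √(a ^ 2 + b ^ 2) := by linarith
  constructor
  · rw [le_div_iff₀ hpos, one_mul]
    gcongr 2 + ?_
    exact Real.sqrt_le_sqrt (by nlinarith)
  · have htri : √((a + 1) ^ 2 + (b + 1) ^ 2) ≤ √(a ^ 2 + b ^ 2) + √2 := by
      refine Real.sqrt_le_iff.2 ⟨by positivity, ?_⟩
      have : a + b ≤ √(a ^ 2 + b ^ 2) * √2 := by
        rw [← Real.sqrt_mul (by positivity)]
        exact Real.le_sqrt_of_sq_le (by nlinarith [sq_nonneg (a - b)])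
      nlinarith
    rw [div_le_iff₀ hpos]
    nlinarith [mul_nonneg h0 h2]

theorem gradConst_spec {d : ℕ} (hd : 0 < d) {α β : Fin d → ℝ} (hα : ∀ j, -1 / 2 ≤ α j)
    (hβ : ∀ j, -1 / 2 ≤ β j) :
    1 ≤ gradConst α β ∧ gradConst α β ≤ 1 + √2 / 2 ∧
      ((∀ k, α k = -1 / 2 ∧ β k = -1 / 2) → gradConst α β = 1) ∧
      ((∃ k, α k = 0 ∧ β k = 0) → gradConst α β = 1 + √2 / 2) := by
  have : Nonempty (Fin d) := ⟨⟨0, hd⟩⟩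
  have hbdd := Set.Finite.bddAbove (Set.finite_range fun j =>
    (2 + √((α j + 1) ^ 2 + (β j + 1) ^ 2)) / (2 + √(α j ^ 2 + β j ^ 2)))
  have hle : gradConst α β ≤ 1 + √2 / 2 := ciSup_le fun j => (gradRatio_bounds (hα j) (hβ j)).2
  refine ⟨?_, hle, ?_, ?_⟩
  · exact (gradRatio_bounds (hα ⟨0, hd⟩) (hβ ⟨0, hd⟩)).1.trans (le_ciSup hbdd ⟨0, hd⟩)
  · intro h
    have : ∀ j, (2 + √((α j + 1) ^ 2 + (β j + 1) ^ 2)) / (2 + √(α j ^ 2 + β j ^ 2)) = 1 := by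
      intro j
      rw [(h j).1, (h j).2]
      norm_num
      positivity
    simp only [gradConst, this, ciSup_const]
  · rintro ⟨k, h1, h2⟩
    refine le_antisymm hle ?_
    refine le_trans (le_of_eq ?_) (le_ciSup hbdd k)
    simp only [h1, h2]
    norm_num
    ring

theorem raised_le_gradConst_mul {d : ℕ} (α β : Fin d → ℝ) (m : Fin d) :
    2 * Real.exp 1 * (2 + √((α m + 1) ^ 2 + (β m + 1) ^ 2)) ≤
      gradConst α β * (2 * Real.exp 1 * (2 + √(α m ^ 2 + β m ^ 2))) := by
  have hbdd := Set.Finite.bddAbove (Set.finite_range fun j =>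
    (2 + √((α j + 1) ^ 2 + (β j + 1) ^ 2)) / (2 + √(α j ^ 2 + β j ^ 2)))
  have h := le_ciSup hbdd m
  have hpos : 0 < 2 + √(α m ^ 2 + β m ^ 2) := by positivity
  rw [div_le_iff₀ hpos] at h
  have := mul_le_mul_of_nonneg_left h (by positivity : 0 ≤ 2 * Real.exp 1)
  refine this.trans_eq ?_
  rw [gradConst]
  ring

/-! ### The coherence bounds -/

theorem chebRatio_pos {α β x : ℝ} (hα : -1 < α) (hβ : -1 < β) (hx : x ∈ Set.Ioo (-1 : ℝ) 1) :
    0 < chebRatio α β x := by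
  have h1 : 0 < 1 - x := by linarith [hx.2]
  have h2 : 0 < 1 + x := by linarith [hx.1]
  have := normConst_pos hα hβ
  have := Real.pi_pos
  unfold chebRatio
  positivity

theorem chebRatio_raised_pos {d : ℕ} {α β : Fin d → ℝ} (hα : ∀ j, -1 / 2 ≤ α j)
    (hβ : ∀ j, -1 / 2 ≤ β j) {x : Fin d → ℝ} (hx : x ∈ cube d) (m j : Fin d) :
    0 < chebRatio ((α + Pi.single m 1 : Fin d → ℝ) j) ((β + Pi.single m 1 : Fin d → ℝ) j)
      (x j) := by
  have hone : 0 ≤ (Pi.single m (1 : ℝ) : Fin d → ℝ) j := by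
    by_cases h : j = m
    · subst h; simp
    · simp [h]
  exact chebRatio_pos (by rw [Pi.add_apply]; linarith [hα j, hone])
    (by rw [Pi.add_apply]; linarith [hβ j, hone]) (hx j)

theorem densityPi_div_cheb {d : ℕ} (α β : Fin d → ℝ) {x : Fin d → ℝ} (hx : x ∈ cube d) :
    densityPi α β x / chebDensity x = ∏ j, chebRatio (α j) (β j) (x j) := by
  rw [chebDensity, densityPi, densityPi, ← Finset.prod_div_distrib]
  exact Finset.prod_congr rfl fun j _ => density_div_cheb _ _ (hx j)

/-- The squared value of a weighted derivative of a Jacobi polynomial. -/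
theorem IsJacobiBasis.chebRatio_mul_derivative_sq_le {α β : ℝ} {p : ℕ → ℝ[X]}
    (h : IsJacobiBasis α β p) (hα : -1 / 2 ≤ α) (hβ : -1 / 2 ≤ β) (n : ℕ) {x : ℝ}
    (hx : x ∈ Set.Icc (-1 : ℝ) 1) :
    chebRatio (α + 1) (β + 1) x * (derivative (p n)).eval x ^ 2 ≤
      cSq n α β * (2 * Real.exp 1 * (2 + √((α + 1) ^ 2 + (β + 1) ^ 2))) := by
  rcases n with _ | n
  · have : derivative (p 0) = 0 := by
      rw [eq_C_of_degree_le_zero (h.degree_eq 0).le, derivative_C]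
    rw [this]
    simp [cSq]
  · have hb := (h.raise hα hβ).chebRatio_mul_sq_le (by linarith) (by linarith) n hx
    have hc := cSq_pos hα hβ n
    rw [eval_mul, eval_C, mul_pow, inv_pow, Real.sq_sqrt hc.le] at hb
    have := mul_le_mul_of_nonneg_left hb hc.le
    refine le_trans (le_of_eq ?_) this
    field_simp

theorem cSq_nonneg {α β : ℝ} (hα : -1 / 2 ≤ α) (hβ : -1 / 2 ≤ β) (m : ℕ) : 0 ≤ cSq m α β := by
  rcases m with _ | m
  · simp [cSq]
  · exact (cSq_pos hα hβ m).le

theorem psi_update {d : ℕ} (φ : Fin d → ℕ → ℝ[X]) (k : Fin d → ℕ) (x : Fin d → ℝ) (m : Fin d)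
    (t : ℝ) : psi φ k (Function.update x m t) =
      (φ m (k m)).eval t * ∏ j ∈ Finset.univ.erase m, (φ j (k j)).eval (x j) := by
  rw [psi, ← Finset.mul_prod_erase _ _ (Finset.mem_univ m), Function.update_self]
  congr 1
  refine Finset.prod_congr rfl fun j hj => ?_
  rw [Function.update_of_ne (Finset.ne_of_mem_erase hj)]

theorem partialDeriv_psi {d : ℕ} (φ : Fin d → ℕ → ℝ[X]) (k : Fin d → ℕ) (x : Fin d → ℝ)
    (m : Fin d) : partialDeriv m (psi φ k) x =
      (derivative (φ m (k m))).eval (x m) *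
        ∏ j ∈ Finset.univ.erase m, (φ j (k j)).eval (x j) := by
  simp only [partialDeriv, psi_update]
  exact (((φ m (k m)).hasDerivAt (x m)).mul_const _).deriv

theorem PhiPre_apply {d : ℕ} (α β : Fin d → ℝ) (φ : Fin d → ℕ → ℝ[X]) (n : ℕ) {N : ℕ}
    (z : Fin N → Fin d → ℝ) (i : Fin N) (k : totalDegree d n) :
    PhiPre α β φ n z i k = w0 α β z i * psi φ k (z i) := by
  rw [PhiPre, Matrix.diagonal_mul]; rfl

theorem PhiHat_inl {d : ℕ} (α β : Fin d → ℝ) (φ : Fin d → ℕ → ℝ[X]) (n : ℕ) {N : ℕ}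
    (z : Fin N → Fin d → ℝ) (i : Fin N) (k : totalDegree d n) :
    PhiHat α β φ n z (Sum.inl i) k =
      w0 α β z i * psi φ k (z i) * (√(1 + ∑ j, cSq (k.1 j) (α j) (β j)))⁻¹ := by
  rw [PhiHat, P, Matrix.mul_diagonal, W, Matrix.diagonal_mul]; rfl

theorem PhiHat_inr {d : ℕ} (α β : Fin d → ℝ) (φ : Fin d → ℕ → ℝ[X]) (n : ℕ) {N : ℕ}
    (z : Fin N → Fin d → ℝ) (m : Fin d) (i : Fin N) (k : totalDegree d n) :
    PhiHat α β φ n z (Sum.inr (m, i)) k =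
      wGrad α β z (m, i) * partialDeriv m (psi φ k) (z i) *
        (√(1 + ∑ j, cSq (k.1 j) (α j) (β j)))⁻¹ := by
  rw [PhiHat, P, Matrix.mul_diagonal, W, Matrix.diagonal_mul]; rfl

theorem cohBound_nonneg {d : ℕ} (α β : Fin d → ℝ) : 0 ≤ cohBound α β :=
  Finset.prod_nonneg fun j _ => by positivity

section Bounds

variable {d : ℕ} {α β : Fin d → ℝ} {φ : Fin d → ℕ → ℝ[X]}

theorem w0_psi_sq_le (hα : ∀ j, -1 / 2 ≤ α j) (hβ : ∀ j, -1 / 2 ≤ β j)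
    (hφ : ∀ j, IsJacobiBasis (α j) (β j) (φ j)) {N : ℕ} {z : Fin N → Fin d → ℝ} {i : Fin N}
    (hz : z i ∈ cube d) (k : Fin d → ℕ) :
    (w0 α β z i * psi φ k (z i)) ^ 2 ≤ cohBound α β := by
  have hpos : ∀ j, 0 < chebRatio (α j) (β j) (z i j) := fun j =>
    chebRatio_pos (by linarith [hα j]) (by linarith [hβ j]) (hz j)
  rw [mul_pow, w0, densityPi_div_cheb α β hz, Real.sq_sqrt (Finset.prod_nonneg fun j _ => (hpos j).le),
    psi, ← Finset.prod_pow, ← Finset.prod_mul_distrib]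
  refine Finset.prod_le_prod (fun j _ => mul_nonneg (hpos j).le (sq_nonneg _)) fun j _ => ?_
  exact (hφ j).chebRatio_mul_sq_le (hα j) (hβ j) (k j) (Set.Ioo_subset_Icc_self (hz j))

/-- The m-th gradient weight raises the parameters only in coordinate m, just where the derivative
acts. That factor costs c² and the change of constant absorbed by C; the others are as in
`w0_psi_sq_le`. -/
theorem wGrad_partialDeriv_sq_le (hα : ∀ j, -1 / 2 ≤ α j) (hβ : ∀ j, -1 / 2 ≤ β j)
    (hφ : ∀ j, IsJacobiBasis (α j) (β j) (φ j)) {N : ℕ} {z : Fin N → Fin d → ℝ} {i : Fin N}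
    (hz : z i ∈ cube d) (k : Fin d → ℕ) (m : Fin d) :
    (wGrad α β z (m, i) * partialDeriv m (psi φ k) (z i)) ^ 2 ≤
      cSq (k m) (α m) (β m) * (gradConst α β * cohBound α β) := by
  have hpos := chebRatio_raised_pos hα hβ hz m
  rw [mul_pow, wGrad, densityPi_div_cheb _ _ hz,
    Real.sq_sqrt (Finset.prod_nonneg fun j _ => (hpos j).le), partialDeriv_psi, mul_pow,
    ← Finset.prod_pow, ← Finset.mul_prod_erase _ _ (Finset.mem_univ m), mul_mul_mul_comm,
    ← Finset.prod_mul_distrib]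
  rw [cohBound, ← Finset.mul_prod_erase Finset.univ (fun j => 2 * Real.exp 1 *
    (2 + √(α j ^ 2 + β j ^ 2))) (Finset.mem_univ m), ← mul_assoc, ← mul_assoc]
  have hc := cSq_nonneg (hα m) (hβ m) (k m)
  have h1 : chebRatio ((α + Pi.single m 1 : Fin d → ℝ) m)
      ((β + Pi.single m 1 : Fin d → ℝ) m) (z i m) *
      (derivative (φ m (k m))).eval (z i m) ^ 2 ≤
      cSq (k m) (α m) (β m) * gradConst α β *
        (2 * Real.exp 1 * (2 + √(α m ^ 2 + β m ^ 2))) := by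
    rw [Pi.add_apply, Pi.add_apply, Pi.single_eq_same]
    refine ((hφ m).chebRatio_mul_derivative_sq_le (hα m) (hβ m) (k m)
      (Set.Ioo_subset_Icc_self (hz m))).trans ?_
    rw [mul_assoc (cSq _ _ _) (gradConst _ _)]
    exact mul_le_mul_of_nonneg_left (raised_le_gradConst_mul α β m) hc
  refine mul_le_mul h1 ?_ ?_ ?_
  · refine Finset.prod_le_prod (fun j _ => mul_nonneg (hpos j).le (sq_nonneg _)) fun j hj => ?_
    have hjm : j ≠ m := Finset.ne_of_mem_erase hj
    rw [Pi.add_apply, Pi.add_apply, Pi.single_eq_of_ne hjm, add_zero, add_zero]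
    exact (hφ j).chebRatio_mul_sq_le (hα j) (hβ j) (k j) (Set.Ioo_subset_Icc_self (hz j))
  · exact Finset.prod_nonneg fun j _ => mul_nonneg (hpos j).le (sq_nonneg _)
  · exact le_trans (mul_nonneg (hpos m).le (sq_nonneg _)) h1

theorem muL_PhiPre_le (hα : ∀ j, -1 / 2 ≤ α j) (hβ : ∀ j, -1 / 2 ≤ β j)
    (hφ : ∀ j, IsJacobiBasis (α j) (β j) (φ j)) (n : ℕ) {N : ℕ} {z : Fin N → Fin d → ℝ}
    (hz : ∀ i, z i ∈ cube d) : muL (PhiPre α β φ n z) ≤ cohBound α β := by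
  refine Real.iSup_le (fun q => ?_) (cohBound_nonneg α β)
  rw [PhiPre_apply]
  exact w0_psi_sq_le hα hβ hφ (hz _) _

/-- The d + 1 squared entries are bounded by 1 and the c² of each coordinate times the same
constant. Their sum of weights s is what the squared diagonal entry of P divides out. -/
theorem betaL_PhiHat_le (hd : 0 < d) (hα : ∀ j, -1 / 2 ≤ α j) (hβ : ∀ j, -1 / 2 ≤ β j)
    (hφ : ∀ j, IsJacobiBasis (α j) (β j) (φ j)) (n : ℕ) {N : ℕ} {z : Fin N → Fin d → ℝ}
    (hz : ∀ i, z i ∈ cube d) :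
    betaL (PhiHat α β φ n z) ≤ gradConst α β * cohBound α β := by
  have hC := (gradConst_spec hd hα hβ).1
  have hB := cohBound_nonneg α β
  have hCB : 0 ≤ gradConst α β * cohBound α β := mul_nonneg (by linarith) hB
  refine Real.iSup_le (fun q => ?_) hCB
  obtain ⟨k, i⟩ := q
  set s := 1 + ∑ j, cSq (k.1 j) (α j) (β j) with hs
  have hs0 : 0 < s := by
    have : 0 ≤ ∑ j, cSq (k.1 j) (α j) (β j) :=
      Finset.sum_nonneg fun j _ => cSq_nonneg (hα j) (hβ j) _
    linarith
  have h1 : (w0 α β z i * psi φ k (z i)) ^ 2 ≤ 1 * (gradConst α β * cohBound α β) := by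
    rw [one_mul]
    exact (w0_psi_sq_le hα hβ hφ (hz i) k.1).trans (le_mul_of_one_le_left hB hC)
  have h2 : ∑ m, (wGrad α β z (m, i) * partialDeriv m (psi φ k) (z i)) ^ 2 ≤
      ∑ m, cSq (k.1 m) (α m) (β m) * (gradConst α β * cohBound α β) :=
    Finset.sum_le_sum fun m _ => wGrad_partialDeriv_sq_le hα hβ hφ (hz i) k.1 m
  rw [← Finset.sum_mul] at h2
  have h3 := add_le_add h1 h2
  rw [← add_mul, ← hs] at h3
  simp only [PhiHat_inl, PhiHat_inr, ← hs]
  simp only [mul_pow _ (√s)⁻¹, inv_pow, Real.sq_sqrt hs0.le]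
  rw [← Finset.sum_mul, ← add_mul, ← div_eq_mul_inv, div_le_iff₀ hs0, mul_comm _ s]
  exact h3

end Bounds

/-! ### The nullspaces -/

theorem w0_pos {d : ℕ} {α β : Fin d → ℝ} (hα : ∀ j, -1 / 2 ≤ α j) (hβ : ∀ j, -1 / 2 ≤ β j)
    {N : ℕ} {z : Fin N → Fin d → ℝ} {i : Fin N} (hz : z i ∈ cube d) : 0 < w0 α β z i := by
  rw [w0, densityPi_div_cheb α β hz]
  exact Real.sqrt_pos.2 (Finset.prod_pos fun j _ =>
    chebRatio_pos (by linarith [hα j]) (by linarith [hβ j]) (hz j))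

theorem wGrad_pos {d : ℕ} {α β : Fin d → ℝ} (hα : ∀ j, -1 / 2 ≤ α j) (hβ : ∀ j, -1 / 2 ≤ β j)
    {N : ℕ} {z : Fin N → Fin d → ℝ} {i : Fin N} (hz : z i ∈ cube d) (m : Fin d) :
    0 < wGrad α β z (m, i) := by
  rw [wGrad, densityPi_div_cheb _ _ hz]
  exact Real.sqrt_pos.2 (Finset.prod_pos fun j _ => chebRatio_raised_pos hα hβ hz m j)

/-- All weights are positive on the open cube, so W can be cancelled and both blocks annihilate Pv.
-/
theorem mulVec_eq_zero_of_mem_map {d : ℕ} {α β : Fin d → ℝ} (hα : ∀ j, -1 / 2 ≤ α j)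
    (hβ : ∀ j, -1 / 2 ≤ β j) {φ : Fin d → ℕ → ℝ[X]} {n N : ℕ} {z : Fin N → Fin d → ℝ}
    (hz : ∀ i, z i ∈ cube d) {c : totalDegree d n → ℝ}
    (hc : c ∈ (nullspace (PhiHat α β φ n z)).map (P α β n).mulVecLin) :
    (Phi φ n z).mulVec c = 0 ∧ (PhiGrad φ n z).mulVec c = 0 := by
  obtain ⟨v, hv, rfl⟩ := hc
  have hv : (PhiHat α β φ n z).mulVec v = 0 := hv
  rw [PhiHat, ← Matrix.mulVec_mulVec, ← Matrix.mulVec_mulVec, Matrix.fromRows_mulVec] at hv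
  rw [Matrix.mulVecLin_apply]
  constructor
  · funext i
    have := congrFun hv (Sum.inl i)
    rw [W, Matrix.mulVec_diagonal] at this
    simpa [(w0_pos hα hβ (hz i)).ne'] using this
  · funext r
    have := congrFun hv (Sum.inr r)
    rw [W, Matrix.mulVec_diagonal] at this
    simpa [(wGrad_pos hα hβ (hz r.2) r.1).ne'] using this

theorem map_nullspace_le {d : ℕ} {α β : Fin d → ℝ} (hα : ∀ j, -1 / 2 ≤ α j)
    (hβ : ∀ j, -1 / 2 ≤ β j) {φ : Fin d → ℕ → ℝ[X]} {n N : ℕ} {z : Fin N → Fin d → ℝ}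
    (hz : ∀ i, z i ∈ cube d) :
    (nullspace (PhiHat α β φ n z)).map (P α β n).mulVecLin ≤ nullspace (Phi φ n z) :=
  fun _ hc => (mulVec_eq_zero_of_mem_map hα hβ hz hc).1

/-! ### Polynomial functions and their zeros -/

/-- The zero set of a nonzero polynomial is null for a product of atomless measures. -/
theorem ae_mvPolynomial_eval_ne_zero (ν : Measure ℝ) [SigmaFinite ν] [NullSingletonClass ν]
    (d : ℕ) : ∀ f : MvPolynomial (Fin d) ℝ, f ≠ 0 →
      ∀ᵐ x ∂Measure.pi (fun _ : Fin d => ν), MvPolynomial.eval x f ≠ 0 := by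
  induction d with
  | zero =>
    intro f hf
    refine ae_of_all _ fun x h0 => hf ?_
    rw [MvPolynomial.eq_C_of_isEmpty f] at h0 ⊢
    rw [MvPolynomial.eval_C] at h0
    rw [h0, map_zero]
  | succ d ih =>
    intro f hf
    have hg : MvPolynomial.finSuccEquiv ℝ d f ≠ 0 := by
      rwa [Ne, EmbeddingLike.map_eq_zero_iff]
    obtain ⟨i, hi⟩ : ∃ i, (MvPolynomial.finSuccEquiv ℝ d f).coeff i ≠ 0 := by
      by_contra hcon
      push Not at hcon
      exact hg (Polynomial.ext fun i => by rw [hcon i, coeff_zero])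
    have hmeas : MeasurableSet {p : ℝ × (Fin d → ℝ) |
        MvPolynomial.eval (Fin.cons p.1 p.2 : Fin (d + 1) → ℝ) f ≠ 0} := by
      refine IsOpen.measurableSet (isOpen_ne_fun ?_ continuous_const)
      exact (MvPolynomial.continuous_eval f).comp (by fun_prop)
    have hae : ∀ᵐ p ∂(ν.prod (Measure.pi fun _ : Fin d => ν)),
        MvPolynomial.eval (Fin.cons p.1 p.2 : Fin (d + 1) → ℝ) f ≠ 0 := by
      refine (Measure.ae_prod_mem_iff_ae_ae_mem hmeas).2 ?_
      -- Fix the last d variables first: almost surely some coefficient in the first variable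
      -- survives, leaving a nonzero univariate polynomial with finitely many roots.
      refine (Measure.ae_ae_comm
        (p := fun a s => MvPolynomial.eval (Fin.cons a s : Fin (d + 1) → ℝ) f ≠ 0) hmeas).2 ?_
      filter_upwards [ih _ hi] with s hs
      set g := Polynomial.map (MvPolynomial.eval s) (MvPolynomial.finSuccEquiv ℝ d f) with hgdef
      have hg0 : g ≠ 0 := by
        intro h0
        apply hs
        have := congrArg (fun q => q.coeff i) h0
        simpa [hgdef, coeff_map] using this
      have hnull : ν (g.roots.toFinset : Set ℝ) = 0 := Finset.measure_zero _ _
      filter_upwards [compl_mem_ae_iff.2 hnull] with a ha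
      rw [MvPolynomial.eval_eq_eval_mv_eval']
      intro h0
      apply ha
      simp only [SetLike.mem_coe, Multiset.mem_toFinset, mem_roots hg0]
      exact h0
    have hmp := measurePreserving_piFinSuccAbove (fun _ : Fin (d + 1) => ν) 0
    have := hmp.quasiMeasurePreserving.ae hae
    filter_upwards [this] with x hx
    have e : (Fin.cons (x 0) (fun j => x ((0 : Fin (d + 1)).succAbove j)) : Fin (d + 1) → ℝ) = x := by
      funext j
      refine Fin.cases ?_ (fun j => ?_) j <;> simp
    rw [← e]
    exact hx

/-- Real functions on `ℝᵈ` given by a polynomial. -/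
def IsPolyFun {d : ℕ} (f : (Fin d → ℝ) → ℝ) : Prop :=
  ∃ p : MvPolynomial (Fin d) ℝ, ∀ x, f x = MvPolynomial.eval x p

namespace IsPolyFun

variable {d : ℕ} {f g : (Fin d → ℝ) → ℝ}

theorem const (c : ℝ) : IsPolyFun (fun _ : Fin d → ℝ => c) :=
  ⟨MvPolynomial.C c, fun x => by simp⟩

theorem mul (hf : IsPolyFun f) (hg : IsPolyFun g) : IsPolyFun fun x => f x * g x := by
  obtain ⟨p, hp⟩ := hf
  obtain ⟨q, hq⟩ := hg
  exact ⟨p * q, fun x => by simp only [hp, hq, map_mul]⟩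

theorem sub (hf : IsPolyFun f) (hg : IsPolyFun g) : IsPolyFun fun x => f x - g x := by
  obtain ⟨p, hp⟩ := hf
  obtain ⟨q, hq⟩ := hg
  exact ⟨p - q, fun x => by simp only [hp, hq, map_sub]⟩

theorem sum {ι : Type*} (s : Finset ι) {F : ι → (Fin d → ℝ) → ℝ} (h : ∀ i, IsPolyFun (F i)) :
    IsPolyFun fun x => ∑ i ∈ s, F i x := by
  choose p hp using h
  exact ⟨∑ i ∈ s, p i, fun x => by simp only [hp, map_sum]⟩

theorem prod {ι : Type*} (s : Finset ι) {F : ι → (Fin d → ℝ) → ℝ} (h : ∀ i, IsPolyFun (F i)) :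
    IsPolyFun fun x => ∏ i ∈ s, F i x := by
  choose p hp using h
  exact ⟨∏ i ∈ s, p i, fun x => by simp only [hp, map_prod]⟩

theorem eval_coord (q : ℝ[X]) (j : Fin d) : IsPolyFun fun x => q.eval (x j) := by
  refine ⟨Polynomial.aeval (MvPolynomial.X j) q, fun x => ?_⟩
  have h := Polynomial.aeval_algHom_apply (MvPolynomial.aeval x) (MvPolynomial.X j) q
  rw [MvPolynomial.aeval_X] at h
  change q.eval (x j) = _
  rw [← Polynomial.coe_aeval_eq_eval, h, MvPolynomial.aeval_eq_eval]

theorem continuous (hf : IsPolyFun f) : Continuous f := by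
  obtain ⟨p, hp⟩ := hf
  rw [funext hp]
  exact MvPolynomial.continuous_eval p

theorem ae_ne_zero (hf : IsPolyFun f) (hne : ∃ x, f x ≠ 0) (ν : Measure ℝ) [SigmaFinite ν]
    [NullSingletonClass ν] : ∀ᵐ x ∂Measure.pi (fun _ : Fin d => ν), f x ≠ 0 := by
  obtain ⟨p, hp⟩ := hf
  obtain ⟨x, hx⟩ := hne
  have hp0 : p ≠ 0 := by
    rintro rfl
    exact hx (by rw [hp, map_zero])
  filter_upwards [ae_mvPolynomial_eval_ne_zero ν d p hp0] with y hy
  rwa [hp]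

/-- A ball of the sup metric is a product of infinite sets, and a polynomial vanishing on such a
product is zero. -/
theorem eq_zero_of_ball (hf : IsPolyFun f) {x₀ : Fin d → ℝ} {r : ℝ} (hr : 0 < r)
    (h0 : ∀ x ∈ Metric.ball x₀ r, f x = 0) (x : Fin d → ℝ) : f x = 0 := by
  obtain ⟨p, hp⟩ := hf
  have : p = 0 := by
    refine MvPolynomial.funext_set (fun j => Metric.ball (x₀ j) r) (fun j => ?_) fun y hy => ?_
    · rw [Real.ball_eq_Ioo]
      exact Set.Ioo_infinite (by linarith)
    · rw [← hp, map_zero]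
      exact h0 y (by rwa [ball_pi _ hr])
  rw [hp, this, map_zero]

end IsPolyFun

/-! ### Expansions in the tensor-product basis -/

/-- The function with coefficients `c` in the basis `ψ_k`. -/
def expansion {d : ℕ} (φ : Fin d → ℕ → ℝ[X]) {n : ℕ} (c : totalDegree d n → ℝ)
    (x : Fin d → ℝ) : ℝ := ∑ k : totalDegree d n, psi φ k x * c k

/-- The partial derivatives of `expansion`. -/
def expansionGrad {d : ℕ} (φ : Fin d → ℕ → ℝ[X]) {n : ℕ} (c : totalDegree d n → ℝ)
    (m : Fin d) (x : Fin d → ℝ) : ℝ := ∑ k : totalDegree d n, partialDeriv m (psi φ k) x * c k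

section Expansion

variable {d n : ℕ} (φ : Fin d → ℕ → ℝ[X])

theorem isPolyFun_psi (k : Fin d → ℕ) : IsPolyFun (psi φ k) :=
  IsPolyFun.prod _ fun j => IsPolyFun.eval_coord _ j

theorem isPolyFun_partialDeriv_psi (k : Fin d → ℕ) (m : Fin d) :
    IsPolyFun (partialDeriv m (psi φ k)) := by
  rw [funext fun x => partialDeriv_psi φ k x m]
  exact (IsPolyFun.eval_coord _ m).mul (IsPolyFun.prod _ fun j => IsPolyFun.eval_coord _ j)

theorem isPolyFun_expansion (c : totalDegree d n → ℝ) : IsPolyFun (expansion φ c) :=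
  IsPolyFun.sum _ fun k => (isPolyFun_psi φ k).mul (IsPolyFun.const _)

theorem isPolyFun_expansionGrad (c : totalDegree d n → ℝ) (m : Fin d) :
    IsPolyFun (expansionGrad φ c m) :=
  IsPolyFun.sum _ fun k => (isPolyFun_partialDeriv_psi φ k m).mul (IsPolyFun.const _)

theorem differentiable_psi (k : Fin d → ℕ) : Differentiable ℝ (psi φ k) := by
  intro x
  have h : ∀ j ∈ Finset.univ, HasFDerivAt (fun x : Fin d → ℝ => (φ j (k j)).eval (x j))
      (fderiv ℝ (fun x : Fin d → ℝ => (φ j (k j)).eval (x j)) x) x := fun j _ =>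
    ((φ j (k j)).differentiable.comp (differentiable_apply j) x).hasFDerivAt
  exact (HasFDerivAt.finsetProd h).differentiableAt

theorem fderiv_psi_single (k : Fin d → ℕ) (m : Fin d) (x : Fin d → ℝ) :
    fderiv ℝ (psi φ k) x (Pi.single m 1) = partialDeriv m (psi φ k) x := by
  have h1 : HasFDerivAt (psi φ k) (fderiv ℝ (psi φ k) x) (Function.update x m (x m)) := by
    rw [Function.update_eq_self]
    exact (differentiable_psi φ k x).hasFDerivAt
  exact (h1.comp_hasDerivAt (x m) (hasDerivAt_update x m (x m))).deriv.symm

theorem differentiable_expansion (c : totalDegree d n → ℝ) :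
    Differentiable ℝ (expansion φ c) := by
  unfold expansion
  exact Differentiable.fun_sum fun k _ => (differentiable_psi φ k).mul_const _

theorem fderiv_expansion_single (c : totalDegree d n → ℝ) (m : Fin d) (x : Fin d → ℝ) :
    fderiv ℝ (expansion φ c) x (Pi.single m 1) = expansionGrad φ c m x := by
  have : HasFDerivAt (expansion φ c) (∑ k : totalDegree d n, c k • fderiv ℝ (psi φ k) x) x := by
    refine HasFDerivAt.fun_sum fun k _ => ?_
    exact ((differentiable_psi φ k x).hasFDerivAt).mul_const (c k)
  rw [this.fderiv, expansionGrad]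
  simp [fderiv_psi_single, mul_comm]

theorem expansion_sub_smul (a b : ℝ) (c c' : totalDegree d n → ℝ) (x : Fin d → ℝ) :
    expansion φ (a • c - b • c') x = a * expansion φ c x - b * expansion φ c' x := by
  simp only [expansion, Finset.mul_sum, ← Finset.sum_sub_distrib]
  exact Finset.sum_congr rfl fun k _ => by simp; ring

theorem expansionGrad_sub_smul (a b : ℝ) (c c' : totalDegree d n → ℝ) (m : Fin d)
    (x : Fin d → ℝ) :
    expansionGrad φ (a • c - b • c') m x =
      a * expansionGrad φ c m x - b * expansionGrad φ c' m x := by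
  simp only [expansionGrad, Finset.mul_sum, ← Finset.sum_sub_distrib]
  exact Finset.sum_congr rfl fun k _ => by simp; ring

end Expansion

/-! ### Linear independence of the basis -/

instance (α β : ℝ) : SigmaFinite (jacobiMeasure α β) := by
  unfold jacobiMeasure; infer_instance

instance (α β : ℝ) : NullSingletonClass (jacobiMeasure α β) := by
  unfold jacobiMeasure; infer_instance

theorem measurable_density (α β : ℝ) : Measurable (density α β) := by
  unfold density; fun_prop

theorem integral_jacobiMeasure {α β : ℝ} (hα : -1 < α) (hβ : -1 < β) (f : ℝ → ℝ) :
    ∫ x, f x ∂jacobiMeasure α β = ∫ x in (-1 : ℝ)..1, f x * density α β x := by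
  rw [jacobiMeasure, integral_withDensity_eq_integral_toReal_smul
    (measurable_density α β).ennreal_ofReal (ae_of_all _ fun x => ENNReal.ofReal_lt_top),
    intervalIntegral.integral_of_le (by norm_num), integral_Ioc_eq_integral_Ioo]
  refine setIntegral_congr_fun measurableSet_Ioo fun x hx => ?_
  simp only [smul_eq_mul, ENNReal.toReal_ofReal (density_pos hα hβ hx).le]
  ring

theorem integrable_eval_jacobiMeasure {α β : ℝ} (hα : -1 < α) (hβ : -1 < β) (q : ℝ[X]) :
    Integrable (fun x => q.eval x) (jacobiMeasure α β) := by
  rw [jacobiMeasure, integrable_withDensity_iff_integrable_smul'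
    (measurable_density α β).ennreal_ofReal (ae_of_all _ fun x => ENNReal.ofReal_lt_top)]
  have h := (intervalIntegrable_iff_integrableOn_Ioo_of_le (by norm_num)).1
    (poly_density_integrable hα hβ q)
  refine (integrableOn_congr_fun (fun x hx => ?_) measurableSet_Ioo).1 h
  simp only [smul_eq_mul, ENNReal.toReal_ofReal (density_pos hα hβ hx).le]
  ring

/-- By Fubini the ψ_k are orthonormal for the product Jacobi measure; pairing with ψ_k isolates the
k-th coefficient. -/
theorem coeff_eq_zero_of_expansion_eq_zero {d n : ℕ} {α β : Fin d → ℝ} (hα : ∀ j, -1 < α j)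
    (hβ : ∀ j, -1 < β j) {φ : Fin d → ℕ → ℝ[X]} (hφ : ∀ j, IsJacobiBasis (α j) (β j) (φ j))
    {c : totalDegree d n → ℝ} (hc : ∀ x, expansion φ c x = 0) : c = 0 := by
  have hmul : ∀ (k l : Fin d → ℕ) (x : Fin d → ℝ), psi φ k x * psi φ l x =
      ∏ j, (φ j (k j) * φ j (l j)).eval (x j) := by
    intro k l x
    simp only [psi, eval_mul, Finset.prod_mul_distrib]
  have hintg : ∀ k l : Fin d → ℕ, Integrable (fun x => psi φ k x * psi φ l x)
      (Measure.pi fun j => jacobiMeasure (α j) (β j)) := by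
    intro k l
    simp only [hmul]
    exact Integrable.fintype_prod (f := fun j t => (φ j (k j) * φ j (l j)).eval t)
      fun j => integrable_eval_jacobiMeasure (hα j) (hβ j) _
  have hon : ∀ k l : Fin d → ℕ, ∫ x, psi φ k x * psi φ l x
      ∂(Measure.pi fun j => jacobiMeasure (α j) (β j)) = if k = l then 1 else 0 := by
    intro k l
    simp only [hmul]
    rw [integral_fintype_prod_eq_prod (f := fun j t => (φ j (k j) * φ j (l j)).eval t)]
    have : ∀ j, ∫ t, (φ j (k j) * φ j (l j)).eval t ∂jacobiMeasure (α j) (β j) =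
        if k j = l j then 1 else 0 := by
      intro j
      rw [integral_jacobiMeasure (hα j) (hβ j), ← (hφ j).orthonormal (k j) (l j)]
      simp only [eval_mul]
    simp only [this]
    by_cases hkl : k = l
    · subst hkl; simp
    · rw [if_neg hkl]
      obtain ⟨j, hj⟩ := Function.ne_iff.1 hkl
      exact Finset.prod_eq_zero (Finset.mem_univ j) (if_neg hj)
  funext k
  have h0 : ∫ x, expansion φ c x * psi φ k x
      ∂(Measure.pi fun j => jacobiMeasure (α j) (β j)) = 0 := by
    simp [hc]
  have h1 : ∀ x, expansion φ c x * psi φ k x =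
      ∑ l : totalDegree d n, c l * (psi φ l x * psi φ k x) := by
    intro x
    rw [expansion, Finset.sum_mul]
    exact Finset.sum_congr rfl fun l _ => by ring
  simp only [h1] at h0
  rw [integral_finsetSum _ fun (l : totalDegree d n) _ => (hintg l k).const_mul (c l)] at h0
  simp only [integral_const_mul, hon, Subtype.coe_inj] at h0
  simpa using h0

/-- For two independent expansions, the Wronskian-type expressions do not all vanish. -/
theorem exists_wronskian_ne_zero {d n : ℕ} {α β : Fin d → ℝ} (hα : ∀ j, -1 < α j)
    (hβ : ∀ j, -1 < β j) {φ : Fin d → ℕ → ℝ[X]} (hφ : ∀ j, IsJacobiBasis (α j) (β j) (φ j))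
    {c c' : totalDegree d n → ℝ} (hli : LinearIndependent ℝ ![c, c']) :
    ∃ m x, expansion φ c' x * expansionGrad φ c m x -
      expansion φ c x * expansionGrad φ c' m x ≠ 0 := by
  by_contra hcon
  push Not at hcon
  have hli' := LinearIndependent.pair_iff.1 hli
  obtain ⟨x₀, hx₀⟩ : ∃ x, expansion φ c' x ≠ 0 := by
    by_contra h0
    push Not at h0
    have := coeff_eq_zero_of_expansion_eq_zero hα hβ hφ h0
    have := hli' 0 1 (by simp [this])
    simp at this
  have hev := (isPolyFun_expansion φ c').continuous.continuousAt.eventually_ne hx₀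
  obtain ⟨r, hr, hball⟩ := Metric.eventually_nhds_iff_ball.1 hev
  have hF := differentiable_expansion φ c
  have hG := differentiable_expansion φ c'
  -- Vanishing Wronskians say that the quotient of the expansions has zero derivative where the
  -- denominator is nonzero. It is then constant on a ball, and proportionality spreads everywhere
  -- because both are polynomials.
  have hd : ∀ x ∈ Metric.ball x₀ r,
      HasFDerivAt (fun x => expansion φ c x * (expansion φ c' x)⁻¹)
        (0 : (Fin d → ℝ) →L[ℝ] ℝ) x := by
    intro x hx
    have hinv := (hasDerivAt_inv (hball x hx)).comp_hasFDerivAt x (hG x).hasFDerivAt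
    refine ((hF x).hasFDerivAt.mul hinv).congr_fderiv ?_
    refine ContinuousLinearMap.coe_injective (LinearMap.pi_ext' fun m => LinearMap.ext_ring ?_)
    have hne := hball x hx
    have hw := hcon m x
    simp only [LinearMap.comp_apply, ContinuousLinearMap.coe_coe, LinearMap.coe_single,
      add_apply, smul_apply, fderiv_expansion_single,
      smul_eq_mul, Function.comp_apply, zero_apply]
    field_simp
    linear_combination hw
  obtain ⟨a, ha⟩ := Metric.isOpen_ball.exists_is_const_of_fderiv_eq_zero
    (convex_ball x₀ r).isPreconnected
    (fun x hx => (hd x hx).differentiableAt.differentiableWithinAt)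
    (fun x hx => (hd x hx).fderiv)
  have hzero : ∀ x, expansion φ ((1 : ℝ) • c - a • c') x = 0 := by
    refine (isPolyFun_expansion φ _).eq_zero_of_ball (x₀ := x₀) hr fun x hx => ?_
    rw [expansion_sub_smul, one_mul, ← ha x hx, inv_mul_cancel_right₀ (hball x hx), sub_self]
  have := coeff_eq_zero_of_expansion_eq_zero hα hβ hφ hzero
  have := hli' 1 (-a) (by rw [← this, neg_smul, sub_eq_add_neg])
  simp at this

/-! ### Strictness of the inclusion of null spaces -/

instance (d : ℕ) : SigmaFinite (chebMeasure d) := by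
  unfold chebMeasure; infer_instance

theorem ae_jacobiMeasure_mem_Ioo (α β : ℝ) :
    ∀ᵐ x ∂jacobiMeasure α β, x ∈ Set.Ioo (-1 : ℝ) 1 :=
  (withDensity_absolutelyContinuous _ _).ae_le (ae_restrict_mem measurableSet_Ioo)

theorem ae_chebMeasure_mem_cube (d : ℕ) : ∀ᵐ x ∂chebMeasure d, x ∈ cube d := by
  refine ae_all_iff.2 fun j => ?_
  exact (Measure.tendsto_eval_ae_ae (i := j)).eventually (ae_jacobiMeasure_mem_Ioo _ _)

theorem measurableSet_of_isSigmaCompact {X : Type*} [TopologicalSpace X] [T2Space X]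
    [MeasurableSpace X] [OpensMeasurableSpace X] {s : Set X} (hs : IsSigmaCompact s) :
    MeasurableSet s := by
  obtain ⟨K, hK, rfl⟩ := hs
  exact MeasurableSet.iUnion fun i => (hK i).measurableSet

theorem isSigmaCompact_isClosed_inter_isOpen {X : Type*} [PseudoEMetricSpace X]
    [SigmaCompactSpace X] {s u : Set X} (hs : IsClosed s) (hu : IsOpen u) :
    IsSigmaCompact (s ∩ u) := by
  obtain ⟨F, hF, -, hFu, -⟩ := hu.exists_iUnion_isClosed
  rw [← hFu, Set.inter_iUnion]
  exact isSigmaCompact_iUnion _ fun i =>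
    isSigmaCompact_univ.of_isClosed_subset (hs.inter (hF i)) (Set.subset_univ _)

section Strict

variable {d n : ℕ} (φ : Fin d → ℕ → ℝ[X])

/-- Some expansion vanishes at all samples while its gradient at the first one does not. -/
def HasNonflatNullVector (n : ℕ) {N : ℕ} (z : Fin (N + 1) → Fin d → ℝ) : Prop :=
  ∃ c : totalDegree d n → ℝ, (∀ i, expansion φ c (z i) = 0) ∧ ∃ m, expansionGrad φ c m (z 0) ≠ 0

/-- Measurability is needed for Fubini. The set is the projection of a closed set intersected with
an open one in a finite-dimensional space; that intersection is σ-compact, and so is its continuous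
image. -/
theorem measurableSet_hasNonflatNullVector (N : ℕ) :
    MeasurableSet {z : Fin (N + 1) → Fin d → ℝ | HasNonflatNullVector φ n z} := by
  have hexp : ∀ i : Fin (N + 1), Continuous
      fun p : (Fin (N + 1) → Fin d → ℝ) × (totalDegree d n → ℝ) => expansion φ p.2 (p.1 i) := by
    intro i
    refine continuous_finsetSum _ fun k _ => ?_
    exact ((isPolyFun_psi φ k).continuous.comp (by fun_prop)).mul (by fun_prop)
  have hgrad : ∀ m : Fin d, Continuous
      fun p : (Fin (N + 1) → Fin d → ℝ) × (totalDegree d n → ℝ) => expansionGrad φ p.2 m (p.1 0) := by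
    intro m
    refine continuous_finsetSum _ fun k _ => ?_
    exact ((isPolyFun_partialDeriv_psi φ k m).continuous.comp (by fun_prop)).mul (by fun_prop)
  have hclosed : IsClosed {p : (Fin (N + 1) → Fin d → ℝ) × (totalDegree d n → ℝ) |
       ∀ i, expansion φ p.2 (p.1 i) = 0} := by
    simp only [Set.ofPred_forall]
    exact isClosed_iInter fun i => isClosed_eq (hexp i) continuous_const
  have hopen : IsOpen {p : (Fin (N + 1) → Fin d → ℝ) × (totalDegree d n → ℝ) |
       ∃ m, expansionGrad φ p.2 m (p.1 0) ≠ 0} := by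
    simp only [Set.ofPred_exists]
    exact isOpen_iUnion fun m => isOpen_ne_fun (hgrad m) continuous_const
  have := (isSigmaCompact_isClosed_inter_isOpen hclosed hopen).image continuous_fst
  convert measurableSet_of_isSigmaCompact this using 1
  ext z
  simp [HasNonflatNullVector]

variable {φ} {α β : Fin d → ℝ}

/-- The N fixed samples impose N equations on more than N + 1 coefficients, so two independent
solutions remain whatever `w` is; only the new sample has to be generic. -/
theorem ae_hasNonflatNullVector_cons (hα : ∀ j, -1 < α j) (hβ : ∀ j, -1 < β j)
    (hφ : ∀ j, IsJacobiBasis (α j) (β j) (φ j)) {N : ℕ} (hN : N + 1 < (totalDegree d n).card)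
    (w : Fin N → Fin d → ℝ) :
    ∀ᵐ x ∂chebMeasure d,
      HasNonflatNullVector φ n (Fin.cons x w : Fin (N + 1) → Fin d → ℝ) := by
  have hrank : 1 < Module.finrank ℝ (LinearMap.ker (Phi φ n w).mulVecLin) := by
    have h1 := LinearMap.finrank_range_add_finrank_ker (Phi φ n w).mulVecLin
    have h2 := Submodule.finrank_le (LinearMap.range (Phi φ n w).mulVecLin)
    rw [Module.finrank_fintype_fun_eq_card, Fintype.card_coe] at h1
    rw [Module.finrank_fintype_fun_eq_card, Fintype.card_fin] at h2
    omega
  have : Nontrivial (LinearMap.ker (Phi φ n w).mulVecLin) :=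
    Module.nontrivial_of_finrank_pos (R := ℝ) (by omega)
  obtain ⟨a, ha⟩ := exists_ne (0 : LinearMap.ker (Phi φ n w).mulVecLin)
  obtain ⟨b, hab⟩ := exists_linearIndependent_pair_of_one_lt_finrank hrank ha
  have hli : LinearIndependent ℝ ![a.1, b.1] := by
    refine LinearIndependent.pair_iff.2 fun s t h => LinearIndependent.pair_iff.1 hab s t ?_
    exact Subtype.ext h
  have hker : ∀ (c : LinearMap.ker (Phi φ n w).mulVecLin) (i : Fin N),
      expansion φ c.1 (w i) = 0 := fun c i => congrFun (LinearMap.mem_ker.1 c.2) i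
  obtain ⟨m, hm⟩ := exists_wronskian_ne_zero hα hβ hφ hli
  have hpoly : IsPolyFun fun x => expansion φ b.1 x * expansionGrad φ a.1 m x -
      expansion φ a.1 x * expansionGrad φ b.1 m x :=
    ((isPolyFun_expansion φ _).mul (isPolyFun_expansionGrad φ _ m)).sub
      ((isPolyFun_expansion φ _).mul (isPolyFun_expansionGrad φ _ m))
  filter_upwards [hpoly.ae_ne_zero hm (jacobiMeasure (-1 / 2) (-1 / 2))] with x hx
  -- This combination is made to vanish at x; its m-th derivative there is the Wronskian, nonzero by
  -- the choice of x.
  refine ⟨expansion φ b.1 x • a.1 - expansion φ a.1 x • b.1, fun i => ?_, m, ?_⟩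
  · rw [expansion_sub_smul]
    refine Fin.cases ?_ (fun i => ?_) i
    · rw [Fin.cons_zero]
      ring
    · rw [Fin.cons_succ, hker, hker]
      ring
  · rw [expansionGrad_sub_smul, Fin.cons_zero]
    exact hx

theorem ae_hasNonflatNullVector (hα : ∀ j, -1 < α j) (hβ : ∀ j, -1 < β j)
    (hφ : ∀ j, IsJacobiBasis (α j) (β j) (φ j)) {N : ℕ} (hN : N + 1 < (totalDegree d n).card) :
    ∀ᵐ z ∂Measure.pi (fun _ : Fin (N + 1) => chebMeasure d), HasNonflatNullVector φ n z := by
  have hmeas : MeasurableSet {p : (Fin d → ℝ) × (Fin N → Fin d → ℝ) |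
      HasNonflatNullVector φ n (Fin.cons p.1 p.2 : Fin (N + 1) → Fin d → ℝ)} := by
    have hc : Continuous fun p : (Fin d → ℝ) × (Fin N → Fin d → ℝ) =>
        (Fin.cons p.1 p.2 : Fin (N + 1) → Fin d → ℝ) := by fun_prop
    exact hc.measurable (measurableSet_hasNonflatNullVector φ N)
  have hae : ∀ᵐ p ∂((chebMeasure d).prod (Measure.pi fun _ : Fin N => chebMeasure d)),
      HasNonflatNullVector φ n (Fin.cons p.1 p.2 : Fin (N + 1) → Fin d → ℝ) := by
    refine (Measure.ae_prod_mem_iff_ae_ae_mem hmeas).2 ?_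
    refine (Measure.ae_ae_comm (p := fun x w =>
      HasNonflatNullVector φ n (Fin.cons x w : Fin (N + 1) → Fin d → ℝ)) hmeas).2 ?_
    exact ae_of_all _ fun w => ae_hasNonflatNullVector_cons hα hβ hφ hN w
  have hmp := measurePreserving_piFinSuccAbove (fun _ : Fin (N + 1) => chebMeasure d) 0
  filter_upwards [hmp.quasiMeasurePreserving.ae hae] with z hz
  have e : (Fin.cons (z 0) (fun j => z ((0 : Fin (N + 1)).succAbove j)) :
      Fin (N + 1) → Fin d → ℝ) = z := by
    funext j
    refine Fin.cases ?_ (fun j => ?_) j <;> simp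
  rw [← e]
  exact hz

/-- The nonflat vector lies in the larger null space, but every vector of the smaller one is
annihilated by the gradient rows too. -/
theorem HasNonflatNullVector.map_nullspace_lt (hα : ∀ j, -1 / 2 ≤ α j)
    (hβ : ∀ j, -1 / 2 ≤ β j) {N : ℕ} {z : Fin (N + 1) → Fin d → ℝ} (hz : ∀ i, z i ∈ cube d)
    (h : HasNonflatNullVector φ n z) :
    (nullspace (PhiHat α β φ n z)).map (P α β n).mulVecLin < nullspace (Phi φ n z) := by
  obtain ⟨c, hc, m, hm⟩ := h
  refine SetLike.lt_iff_le_and_exists.2 ⟨map_nullspace_le hα hβ hz, c, ?_, fun hmem => hm ?_⟩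
  · exact LinearMap.mem_ker.2 (funext hc)
  · exact congrFun (mulVec_eq_zero_of_mem_map hα hβ hz hmem).2 (m, 0)

theorem ae_map_nullspace_lt (hα : ∀ j, -1 / 2 ≤ α j) (hβ : ∀ j, -1 / 2 ≤ β j)
    (hφ : ∀ j, IsJacobiBasis (α j) (β j) (φ j)) {N : ℕ} {Ω : Type*} [MeasurableSpace Ω]
    {μ : Measure Ω} [IsProbabilityMeasure μ] {Z : Fin N → Ω → Fin d → ℝ}
    (hZ : ∀ i, HasLaw (Z i) (chebMeasure d) μ) (hindep : iIndepFun Z μ) :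
    ∀ᵐ ω ∂μ, (∀ i, Z i ω ∈ cube d) ∧ (0 < N → N < (totalDegree d n).card →
      (nullspace (PhiHat α β φ n fun i => Z i ω)).map (P α β n).mulVecLin <
        nullspace (Phi φ n fun i => Z i ω)) := by
  have hcube : ∀ᵐ ω ∂μ, ∀ i, Z i ω ∈ cube d := by
    refine ae_all_iff.2 fun i => ae_of_ae_map (hZ i).aemeasurable ?_
    rw [(hZ i).map_eq]
    exact ae_chebMeasure_mem_cube d
  obtain _ | N := N
  · filter_upwards [hcube] with ω hω
    exact ⟨hω, fun h => absurd h (lt_irrefl 0)⟩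
  by_cases hN : N + 1 < (totalDegree d n).card
  swap
  · filter_upwards [hcube] with ω hω
    exact ⟨hω, fun _ h => absurd h hN⟩
  -- Independence is used only here, to make the joint law a product measure.
  have hlaw : μ.map (fun ω i => Z i ω) = Measure.pi fun _ => chebMeasure d := by
    rw [(iIndepFun_iff_map_fun_eq_pi_map fun i => (hZ i).aemeasurable).1 hindep]
    simp only [(hZ _).map_eq]
  have hgood : ∀ᵐ ω ∂μ, HasNonflatNullVector φ n fun i => Z i ω := by
    refine ae_of_ae_map (f := fun ω i => Z i ω)
      (aemeasurable_pi_lambda _ fun i => (hZ i).aemeasurable) ?_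
    rw [hlaw]
    exact ae_hasNonflatNullVector (fun j => by linarith [hα j]) (fun j => by linarith [hβ j])
      hφ hN
  filter_upwards [hcube, hgood] with ω hω h
  exact ⟨hω, fun _ _ => h.map_nullspace_lt hα hβ hω⟩

end Strict

end JacobiPCE

end

theorem mainTheorem1 (d : ℕ) (hd : 0 < d) (α β : Fin d → ℝ)
    (hα : ∀ j, -1 / 2 ≤ α j) (hβ : ∀ j, -1 / 2 ≤ β j)
    (φ : Fin d → ℕ → Polynomial ℝ) (hφ : ∀ j, JacobiPCE.IsJacobiBasis (α j) (β j) (φ j))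
    (n N : ℕ) {Ω : Type*} [MeasurableSpace Ω] (μ : Measure Ω) [IsProbabilityMeasure μ]
    (Z : Fin N → Ω → Fin d → ℝ) (hZ : ∀ i, HasLaw (Z i) (JacobiPCE.chebMeasure d) μ)
    (hindep : iIndepFun Z μ) :
    -- the constant
    (1 ≤ JacobiPCE.gradConst α β ∧ JacobiPCE.gradConst α β ≤ 1 + √2 / 2 ∧
      ((∀ k, α k = -1 / 2 ∧ β k = -1 / 2) → JacobiPCE.gradConst α β = 1) ∧
      ((∃ k, α k = 0 ∧ β k = 0) → JacobiPCE.gradConst α β = 1 + √2 / 2)) ∧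
    -- for every sample set in the open cube: the two coherence bounds and the inclusion
    (∀ z : Fin N → Fin d → ℝ, (∀ i, z i ∈ JacobiPCE.cube d) →
      JacobiPCE.muL (JacobiPCE.PhiPre α β φ n z) ≤ JacobiPCE.cohBound α β ∧
      JacobiPCE.betaL (JacobiPCE.PhiHat α β φ n z) ≤
        JacobiPCE.gradConst α β * JacobiPCE.cohBound α β ∧
      (JacobiPCE.nullspace (JacobiPCE.PhiHat α β φ n z)).map (JacobiPCE.P α β n).mulVecLin ≤
        JacobiPCE.nullspace (JacobiPCE.Phi φ n z)) ∧
    -- almost surely, the samples lie in the open cube, and the inclusion is strict when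
    -- there are fewer samples than basis functions
    (∀ᵐ ω ∂μ, (∀ i, Z i ω ∈ JacobiPCE.cube d) ∧
      (0 < N → N < (JacobiPCE.totalDegree d n).card →
        (JacobiPCE.nullspace (JacobiPCE.PhiHat α β φ n fun i => Z i ω)).map
            (JacobiPCE.P α β n).mulVecLin <
          JacobiPCE.nullspace (JacobiPCE.Phi φ n fun i => Z i ω))) := by
  exact ⟨JacobiPCE.gradConst_spec hd hα hβ, fun z hz =>
    ⟨JacobiPCE.muL_PhiPre_le hα hβ hφ n hz, JacobiPCE.betaL_PhiHat_le hd hα hβ hφ n hz,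
      JacobiPCE.map_nullspace_le hα hβ hz⟩,
    JacobiPCE.ae_map_nullspace_lt hα hβ hφ hZ hindep⟩
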